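/- Let $M$ be a real $C^2$ manifold (finite-dimensional, Hausdorff, second countable, without boundary), let $K \subset TM$ be a $C^1$ subbundle of rank $m \ge 2$, and let $N \subset M$ be an embedded $C^2$ submanifold that is closed as a subset of $M$, with $\operatorname{codim}_M N \ge 2$ and $T_pN \not\supset K(p)$ for all $p \in N$. Put $$N^c = \{p \in N : \dim_{\mathbb R} (K(p) \cap T_pN) = m-1\},$$ and let $\Upsilon$ be the set of (local) $C^1$ sections $Y$ of $K$ such that $Y(p) \in T_pN$ for every $p \in N^c$ in the domain of $Y$. For an open set $W \subset M$ and a set $\mathcal S$ of $C^1$ vector fields defined on open subsets of $M$, the $\mathcal S$-orbit $\mathcal O_{\mathcal S}(W,p)$ of $p \in W$ in $W$ is the set of all points $L^j_{t_j} \circ \cdots \circ L^1_{t_1}(p)$ with $j \ge 0$, $t_1,\dots,t_j \in \mathbb R$, and $L^1,\dots,L^j \in \mathcal S$ defined on open subsets of $W$, where $t \mapsto L_t(x)$ denotes the integral curve of $L$ with $L_0(x) = x$. A $K$-orbit of $W$ is an orbit in $W$ under the set of all local $C^1$ sections of $K$. Suppose that for each $p \in N$ the orbit $\mathcal O_\Upsilon(M,p)$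 is not contained in $N$. Then every $K$-orbit of $M \setminus N$ is of the form $\mathcal O_K \setminus N$ for some $K$-orbit $\mathcal O_K$ of $M$. -/

import Mathlib

open Set Filter Topology
open scoped Manifold ContDiff

namespace OrbitDecomposition

section Definitions

variable {E : Type*} [NormedAddCommGroup E] [NormedSpace ℝ E]
  {M : Type*} [TopologicalSpace M] [ChartedSpace E M] [IsManifold 𝓘(ℝ, E) 2 M]

/-- A (set-theoretic) vector field on `M`. -/
abbrev VField (E : Type*) [NormedAddCommGroup E] [NormedSpace ℝ E]
    (M : Type*) [TopologicalSpace M] [ChartedSpace E M] : Type _ :=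
  (x : M) → TangentSpace 𝓘(ℝ, E) x

/-- A choice of a linear subspace of each tangent space of `M`. -/
abbrev Distr (E : Type*) [NormedAddCommGroup E] [NormedSpace ℝ E]
    (M : Type*) [TopologicalSpace M] [ChartedSpace E M] : Type _ :=
  (x : M) → Submodule ℝ (TangentSpace 𝓘(ℝ, E) x)

/-- The vector field `X` is of class `C^1` on the set `U` (its values outside `U` are irrelevant). -/
def IsC1On (X : VField E M) (U : Set M) : Prop :=
  ContMDiffOn 𝓘(ℝ, E) (𝓘(ℝ, E)).tangent 1
    (fun x => (⟨x, X x⟩ : TangentBundle 𝓘(ℝ, E) M)) U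

/-- `K` is a `C^1` subbundle of rank `m` of the tangent bundle: locally it has a frame of `m`
vector fields of class `C^1`. -/
def IsC1Subbundle (m : ℕ) (K : Distr E M) : Prop :=
  ∀ p : M, ∃ U : Set M, IsOpen U ∧ p ∈ U ∧ ∃ X : Fin m → VField E M,
    (∀ i, IsC1On (X i) U) ∧
    ∀ x ∈ U, LinearIndependent ℝ (fun i => X i x) ∧
      Submodule.span ℝ (range fun i => X i x) = K x

/-- `N` is an (embedded) `C^2` submanifold of dimension `k` of `M`: around each of its points there
is a `C^2` chart of `M` in which `N` is a `k`-dimensional linear subspace. -/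
def IsC2Submanifold (k : ℕ) (N : Set M) : Prop :=
  ∀ p ∈ N, ∃ φ ∈ IsManifold.maximalAtlas 𝓘(ℝ, E) 2 M, p ∈ φ.source ∧
    ∃ F : Submodule ℝ E, Module.finrank ℝ F = k ∧ ∀ x ∈ φ.source, x ∈ N ↔ φ x ∈ F

/-- The tangent space to `N` at `p`: the space of the velocities at `p` of the curves in `N` through
`p`. (If `N` is a submanifold and `p ∈ N`, these velocities already form a linear subspace.) -/
noncomputable def tangentTo (N : Set M) (p : M) : Submodule ℝ (TangentSpace 𝓘(ℝ, E) p) :=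
  Submodule.span ℝ {v | ∃ γ : ℝ → M, γ 0 = p ∧ (∀ᶠ t in 𝓝 (0 : ℝ), γ t ∈ N) ∧
    HasMFDerivAt 𝓘(ℝ, ℝ) 𝓘(ℝ, E) γ 0
      ((1 : ℝ →L[ℝ] ℝ).smulRight (v : E) : ℝ →L[ℝ] E)}

/-- `X` is, over the open set `U`, a `C^1` section of `K`. -/
def IsSectionOn (K : Distr E M) (U : Set M) (X : VField E M) : Prop :=
  IsC1On X U ∧ ∀ x ∈ U, X x ∈ K x

/-- The set `N^c` of the points `p` of `N` with `dim (K p ∩ T_p N) = m - 1`. -/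
def excSet (m : ℕ) (K : Distr E M) (N : Set M) : Set M :=
  {p | p ∈ N ∧
    Module.finrank ℝ (K p ⊓ tangentTo N p : Submodule ℝ (TangentSpace 𝓘(ℝ, E) p)) + 1 = m}

/-- `Y` is, over the open set `U`, a `C^1` section of `K` that is tangent to `N` at the points
of `N^c`. -/
def IsTangentSectionOn (m : ℕ) (K : Distr E M) (N : Set M) (U : Set M) (Y : VField E M) : Prop :=
  IsSectionOn K U Y ∧ ∀ x ∈ excSet m K N ∩ U, Y x ∈ tangentTo N x

/-- `FlowStep S W p q`: the point `q = L_t(p)` is obtained by following for some time `t` (of any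
sign) the flow of a vector field `L` that is defined on some open subset `U` of `W` and belongs to
the family `S` of local vector fields. -/
def FlowStep (S : Set M → VField E M → Prop) (W : Set M) (p q : M) : Prop :=
  ∃ (U : Set M) (L : VField E M), IsOpen U ∧ U ⊆ W ∧ S U L ∧
    ∃ (γ : ℝ → M) (a b t : ℝ), 0 ∈ Ioo a b ∧ t ∈ Ioo a b ∧ IsMIntegralCurveOn γ L (Ioo a b) ∧
      (∀ s ∈ Ioo a b, γ s ∈ U) ∧ γ 0 = p ∧ γ t = q

/-- The orbit of `p` in the open set `W` under the family `S` of local vector fields: all points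
`L^j_{t_j} ∘ ⋯ ∘ L^1_{t_1} (p)` for `L^1, …, L^j` in the family and defined on open subsets
of `W`. -/
def orbit (S : Set M → VField E M → Prop) (W : Set M) (p : M) : Set M :=
  {q | Relation.ReflTransGen (FlowStep S W) p q}

end Definitions

end OrbitDecomposition

/-!
The orbit of `p` in the complement of `N` is the part outside `N` of the orbit of `p` in `M`. The
non-trivial inclusion says that crossing or touching `N` along sections of `K` does not lead to new
orbits of the complement. Each point outside `N` is assigned its orbit in the complement, and a
point `x` of `N` is assigned an orbit `C` if all transversal curves along sections of `K` through
`x` run in `C` on both sides (`IsCrossingClass`). It has to be shown that every point of `N` is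
assigned an orbit, and that integral curves of sections of `K` then stay in one class.

All steps rest on one principle. An arbitrary equivalence relation has at each point a tangent space
(`orbitTangent`): the velocities of the `C^1` families of local diffeomorphisms that preserve the
classes. Its dimension is lower semicontinuous and invariant under class-preserving local
diffeomorphisms. Hence, if a local diffeomorphism `ψ` preserves the classes near the points `x τ`
of a tangent curve for a dense set of times `τ > 0`, and the rank at `ψ (x 0)` is not smaller than
along the curve, then `ψ (x 0)` lies in the class of the points `x τ`, even if `ψ` does not preserve
classes near `x 0` (`rel_of_transport`): composing `ψ ∘ x` with a spanning family of
class-preserving maps one obtains a curve whose derivative vanishes on a dense set. The inequality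
of the ranks always comes from semicontinuity along points at which classes are preserved.

* Transversal curves that leave `N` to the same side of a hyperplane enter the same class
  (`LeavesTo.congr`). Where `K` has two dimensions transversal to `N`, any two transversal
  directions lie on one side of a hyperplane or can be joined through a third one, so the point is
  assigned an orbit (`exists_crossesTo_of_codim_two`).
* The remaining points of `N` lie in the exceptional set. Let `B` be the closure of the set of
  points without an assigned orbit. If `B` is not empty, then by hypothesis there is a section `Y`
  of `K`, tangent to `N` along `B`, whose flow leads from a point of `B` out of `B`. Following `Y`
  past its last point in `B`, Gronwall's inequality provides transversal curves that start shortly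
  afterwards and avoid `B`; this gives the inequality of the ranks, and the flow of `Y` carries both
  transversal branches at points of `B` to one class (`IsFlowBox.exists_leavesTo_of_exit`). So all
  points near this point of `B` are assigned orbits, a contradiction
  (`forall_exists_isCrossingClass`).
* Once all points of `N` are assigned orbits, sections transversal to `N` preserve the classes by
  definition. For a section tangent to `N` at a point, one displaces its integral curves along a
  transversal section: by an argument as in Sard's theorem (`dense_compl_multiple_zeros`) almost all
  displaced curves meet `N` transversally only, and the transport principle applies
  (`preservesAt_of_crossesTo`).
-/

namespace OrbitDecomposition

/-! ### Flows of vector fields of class `C^1` -/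

section Nemytskii

variable {E : Type*} [NormedAddCommGroup E] [NormedSpace ℝ E]

/-- The derivative of the superposition operator `u ↦ f ∘ u` as a function of the derivative of `f`
along `u`: pointwise evaluation of a curve of linear maps on a curve of vectors. -/
noncomputable def evalCurve :
    C(unitInterval, E →L[ℝ] E) →L[ℝ] C(unitInterval, E) →L[ℝ] C(unitInterval, E) :=
  LinearMap.mkContinuous₂
    (LinearMap.mk₂ ℝ (fun (A : C(unitInterval, E →L[ℝ] E)) (h : C(unitInterval, E)) =>
        (⟨fun t => A t (h t), by fun_prop⟩ : C(unitInterval, E)))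
      (fun _ _ _ => by ext; simp) (fun _ _ _ => by ext; simp)
      (fun _ _ _ => by ext; simp) (fun _ _ _ => by ext; simp)) 1 (by
    intro A h
    rw [ContinuousMap.norm_le _ (by positivity)]
    intro t
    simp only [LinearMap.mk₂_apply, ContinuousMap.coe_mk, one_mul]
    exact ((A t).le_opNorm _).trans (mul_le_mul (A.norm_coe_le_norm t) (h.norm_coe_le_norm t)
      (norm_nonneg _) (by positivity)))

/-- The superposition operator `u ↦ f ∘ u` on continuous curves is of class `C^1` if `f` is. -/
lemma contDiff_superposition {f : E → E} (hf : ContDiff ℝ 1 f) :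
    ContDiff ℝ 1 (fun u : C(unitInterval, E) => (⟨f, hf.continuous⟩ : C(E, E)).comp u) := by
  rw [contDiff_one_iff_hasFDerivAt]
  have hDc : Continuous (fderiv ℝ f) := hf.continuous_fderiv one_ne_zero
  refine ⟨fun u => evalCurve ((⟨fderiv ℝ f, hDc⟩ : C(E, E →L[ℝ] E)).comp u),
    evalCurve.continuous.comp (ContinuousMap.continuous_postcomp _), fun u => ?_⟩
  rw [hasFDerivAt_iff_isLittleO_nhds_zero, Asymptotics.isLittleO_iff]
  intro ε hε
  have hcomp : IsCompact (range u) := isCompact_range u.continuous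
  have h1 := hcomp.uniformContinuousAt_of_continuousAt (fderiv ℝ f)
    (fun _ _ => hDc.continuousAt) (Metric.dist_mem_uniformity hε)
  obtain ⟨δ, hδ, h2⟩ := Metric.mem_uniformity_dist.1 h1
  filter_upwards [Metric.ball_mem_nhds (0 : C(unitInterval, E)) hδ] with h hh
  rw [mem_ball_zero_iff] at hh
  rw [ContinuousMap.norm_le _ (by positivity)]
  intro t
  have hht : ‖h t‖ < δ := (h.norm_coe_le_norm t).trans_lt hh
  have key := (convex_ball (u t) δ).norm_image_sub_le_of_norm_fderiv_le'
    (f := f) (𝕜 := ℝ) (φ := fderiv ℝ f (u t)) (C := ε) (x := u t) (y := u t + h t)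
    (fun x _ => (hf.differentiable one_ne_zero) x) (fun x hx => by
      have := h2 (a := u t) (b := x) (by rw [dist_comm]; exact hx) (mem_range_self t)
      have h3 : dist (fderiv ℝ f (u t)) (fderiv ℝ f x) < ε := this
      rw [dist_comm, dist_eq_norm] at h3
      exact h3.le) (Metric.mem_ball_self hδ) (by simpa using hht)
  simp only [add_sub_cancel_left] at key
  refine le_trans (le_of_eq ?_) (key.trans (mul_le_mul_of_nonneg_left (h.norm_coe_le_norm t) hε.le))
  rfl

/-- Integration `u ↦ (t ↦ ∫ s in 0..t, u s)` of continuous curves on the unit interval. -/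
noncomputable def primitiveCurve [CompleteSpace E] :
    C(unitInterval, E) →L[ℝ] C(unitInterval, E) :=
  LinearMap.mkContinuous
    { toFun := fun u => ⟨fun t => ∫ s in (0 : ℝ)..t, IccExtend zero_le_one u s, by
        have : Continuous (IccExtend zero_le_one u) := u.continuous.Icc_extend'
        exact (intervalIntegral.continuous_primitive
          (fun a b => this.intervalIntegrable a b) 0).comp
          continuous_subtype_val⟩
      map_add' := fun u v => by
        ext t
        have hu : Continuous (IccExtend zero_le_one u) := u.continuous.Icc_extend'
        have hv : Continuous (IccExtend zero_le_one v) := v.continuous.Icc_extend'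
        exact intervalIntegral.integral_add (hu.intervalIntegrable _ _) (hv.intervalIntegrable _ _)
      map_smul' := fun c u => by
        ext t
        exact intervalIntegral.integral_smul c _ } 1 (by
    intro u
    rw [ContinuousMap.norm_le _ (by positivity)]
    intro t
    have := intervalIntegral.norm_integral_le_of_norm_le_const (a := (0 : ℝ)) (b := (t : ℝ))
      (C := ‖u‖) (f := IccExtend zero_le_one u) (fun s _ => u.norm_coe_le_norm _)
    refine this.trans ?_
    rw [sub_zero, abs_of_nonneg t.2.1, one_mul]
    exact mul_le_of_le_one_right (norm_nonneg _) t.2.2)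

end Nemytskii

section Flow

variable {E : Type*} [NormedAddCommGroup E] [NormedSpace ℝ E] [CompleteSpace E]

/-- A globally defined vector field of class `C^1` has near each point a local flow which is of
class `C^1` in time and initial point together. The rescaled integral curves `u s = Φ (t * s, x)`
solve `u = x + t * ∫ g ∘ u`, an equation in the Banach space of continuous curves to which the
implicit function theorem applies at `t = 0`. -/
lemma exists_flow_of_contDiff {g : E → E} (hg : ContDiff ℝ 1 g) (z : E) :
    ∃ Φ : ℝ × E → E, ContDiffAt ℝ 1 Φ (0, z) ∧ ∀ᶠ p in 𝓝 ((0 : ℝ), z),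
      Φ (0, p.2) = p.2 ∧ HasDerivAt (fun t => Φ (t, p.2)) (g (Φ p)) p.1 := by
  set N : C(unitInterval, E) → C(unitInterval, E) :=
    fun u => (⟨g, hg.continuous⟩ : C(E, E)).comp u with hN
  have hNs : ContDiff ℝ 1 N := contDiff_superposition hg
  set cst : E →L[ℝ] C(unitInterval, E) := ContinuousLinearMap.const ℝ unitInterval with hcst
  have hcsta : ∀ x t, cst x t = x := fun _ _ => rfl
  set P : (ℝ × E) × C(unitInterval, E) → C(unitInterval, E) :=
    fun p => p.2 - cst p.1.2 - p.1.1 • primitiveCurve (N p.2) with hP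
  have hPs : ContDiff ℝ 1 P := by
    have : ContDiff ℝ 1 (fun p : (ℝ × E) × C(unitInterval, E) => N p.2) := hNs.comp contDiff_snd
    fun_prop
  set v : (ℝ × E) × C(unitInterval, E) := ((0, z), cst z) with hv
  have hPv : P v = 0 := by simp [hP, hv]
  have hPc : ContDiffAt ℝ 1 P v := hPs.contDiffAt
  have hinv : (fderiv ℝ P v ∘L .inr ℝ (ℝ × E) C(unitInterval, E)).IsInvertible := by
    have h1 : HasFDerivAt (fun u => P (v.1, u))
        (fderiv ℝ P v ∘L .inr ℝ (ℝ × E) C(unitInterval, E)) v.2 :=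
      HasFDerivAt.comp (g := P) v.2 ((hPs.differentiable one_ne_zero) v).hasFDerivAt
        (hasFDerivAt_prodMk_right v.1 v.2)
    have h2 : HasFDerivAt (fun u => P (v.1, u)) (ContinuousLinearMap.id ℝ C(unitInterval, E))
        v.2 := by
      have : (fun u => P (v.1, u)) = fun u => u - cst z := by
        ext u; simp [hP, hv]
      rw [this]
      exact (hasFDerivAt_id _).sub_const _
    rw [h1.unique h2]
    exact ⟨ContinuousLinearEquiv.refl ℝ _, rfl⟩
  set ψ := hPc.implicitFunction one_ne_zero hinv with hψ
  have hψs : ContDiffAt ℝ 1 ψ (0, z) := hPc.contDiffAt_implicitFunction one_ne_zero hinv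
  have hψ0 : ψ (0, z) = cst z := hPc.implicitFunction_apply_self one_ne_zero hinv
  set ev : C(unitInterval, E) →L[ℝ] E := ContinuousMap.evalCLM ℝ (1 : unitInterval) with hev
  have hE1 := hPc.eventually_apply_eq_iff_implicitFunction one_ne_zero hinv
  rw [← hψ, hPv, Metric.eventually_nhds_iff_ball] at hE1
  obtain ⟨δ, hδ, hE1⟩ := hE1
  have hE2 : ∀ᶠ p in 𝓝 ((0 : ℝ), z), dist (ψ p) (cst z) < δ ∧ ContinuousAt ψ p := by
    refine .and ?_ ((hψs.eventually (by simp)).mono fun _ h => h.continuousAt)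
    have := hψs.continuousAt.tendsto
    rw [hψ0] at this
    exact this (Metric.ball_mem_nhds _ hδ)
  obtain ⟨δ', hδ', hE2⟩ := Metric.eventually_nhds_iff_ball.1 hE2
  set η := min δ δ' with hη
  have hη0 : 0 < η := lt_min hδ hδ'
  have hmem : ∀ t : ℝ, ∀ x : E, |t| < η → dist x z < η → ∀ r : ℝ, η ≤ r →
      (t, x) ∈ Metric.ball ((0 : ℝ), z) r := by
    intro t x ht hx r hr
    rw [Metric.mem_ball, Prod.dist_eq, max_lt_iff]
    exact ⟨by simpa [Real.dist_eq] using ht.trans_le hr, hx.trans_le hr⟩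
  -- near the base point the curve `ψ (t, x)` solves the rescaled integral equation
  have hsol : ∀ t x, |t| < η → dist x z < η → ∀ s : unitInterval,
      ψ (t, x) s = x + t • ∫ r in (0 : ℝ)..s, g (IccExtend zero_le_one (ψ (t, x)) r) := by
    intro t x ht hx s
    have h1 := (hE1 ((t, x), ψ (t, x)) (by
      rw [hv, Metric.mem_ball, Prod.dist_eq, max_lt_iff]
      exact ⟨hmem t x ht hx δ (min_le_left _ _),
        (hE2 _ (hmem t x ht hx _ (min_le_right _ _))).1⟩)).2
      rfl
    have h2 := DFunLike.congr_fun h1 s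
    have h3 : ψ (t, x) s - x -
        t • (∫ r in (0 : ℝ)..s, IccExtend zero_le_one (N (ψ (t, x))) r) = 0 :=
      h2
    rw [sub_sub, sub_eq_zero] at h3
    rw [h3]
    rfl
  -- the curves for different `t` are reparametrizations of each other
  have hscale : ∀ t x, |t| < η → dist x z < η → ∀ l : unitInterval,
      ψ (t, x) l = ψ (l * t, x) 1 := by
    intro t x ht hx l
    have hlt : |(l : ℝ) * t| < η := by
      rw [abs_mul, abs_of_nonneg l.2.1]
      exact (mul_le_of_le_one_left (abs_nonneg _) l.2.2).trans_lt ht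
    set w : C(unitInterval, E) := (ψ (t, x)).comp ⟨fun s => l * s, by fun_prop⟩ with hw
    have hwa : ∀ s, w s = ψ (t, x) (l * s) := fun _ => rfl
    have hdist : dist w (cst z) < δ := by
      refine lt_of_le_of_lt ?_ (hE2 _ (hmem t x ht hx _ (min_le_right _ _))).1
      rw [ContinuousMap.dist_le dist_nonneg]
      intro s
      rw [hwa, hcsta]
      exact ContinuousMap.dist_apply_le_dist (f := ψ (t, x)) (g := cst z) (l * s)
    have h1 := (hE1 ((l * t, x), w) (by
      rw [hv, Metric.mem_ball, Prod.dist_eq, max_lt_iff]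
      exact ⟨hmem _ x hlt hx δ (min_le_left _ _), hdist⟩)).1 (by
        ext s
        have h3 : P ((l * t, x), w) s
            = w s - x - ((l : ℝ) * t) • (∫ r in (0 : ℝ)..s, IccExtend zero_le_one (N w) r) := rfl
        rw [h3, hwa, hsol t x ht hx, ContinuousMap.zero_apply, mul_comm (l : ℝ) t, mul_smul]
        have h4 : ((l * s : unitInterval) : ℝ) = (l : ℝ) * s := rfl
        have h5 := intervalIntegral.smul_integral_comp_mul_left (a := 0) (b := (s : ℝ))
          (fun r => g (IccExtend zero_le_one (ψ (t, x)) r)) (l : ℝ)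
        rw [mul_zero, ← h4] at h5
        rw [← h5, sub_sub, sub_eq_zero]
        congr 3
        apply intervalIntegral.integral_congr
        intro r hr
        rw [uIcc_of_le s.2.1] at hr
        have hr' : r ∈ Icc (0 : ℝ) 1 := ⟨hr.1, hr.2.trans s.2.2⟩
        have hlr : (l : ℝ) * r ∈ Icc (0 : ℝ) 1 := (l * ⟨r, hr'⟩ : unitInterval).2
        simp only [IccExtend_of_mem _ _ hr', IccExtend_of_mem _ _ hlr]
        rfl)
    have h1' : ψ (l * t, x) = w := h1
    rw [h1', hwa, mul_one]
  refine ⟨fun p => ev (ψ p), ev.contDiff.contDiffAt.comp _ hψs, ?_⟩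
  have hU : Metric.ball ((0 : ℝ), z) η ∈ 𝓝 ((0 : ℝ), z) := Metric.ball_mem_nhds _ hη0
  filter_upwards [hU] with p hp
  rw [Metric.mem_ball, Prod.dist_eq, max_lt_iff, Real.dist_eq, sub_zero] at hp
  obtain ⟨t₀, x⟩ := p
  simp only at hp ⊢
  have hint : ∀ t, |t| < η → ev (ψ (t, x)) = x + ∫ r in (0 : ℝ)..t, g (ev (ψ (r, x))) := by
    intro t ht
    have h1 : ev (ψ (t, x)) = ψ (t, x) 1 := rfl
    rw [h1, hsol t x ht hp.2]
    congr 1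
    have h5 := intervalIntegral.smul_integral_comp_mul_left (a := 0) (b := 1)
          (fun r => g (ev (ψ (r, x)))) t
    rw [mul_zero, mul_one] at h5
    rw [← h5]
    congr 1
    apply intervalIntegral.integral_congr
    intro r hr
    have hr' : r ∈ Icc (0 : ℝ) 1 := by
      rw [← uIcc_of_le zero_le_one]; exact hr
    have h6 := hscale t x ht hp.2 ⟨r, hr'⟩
    simp only [IccExtend_of_mem _ _ hr', h6, mul_comm t r]
    rfl
  refine ⟨by simpa using hint 0 (by simpa using hη0), ?_⟩
  have hcont : ContinuousOn (fun r => g (ev (ψ (r, x)))) (Ioo (-η) η) := by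
    intro r hr
    have h1 := (hE2 _ (hmem r x (abs_lt.2 hr) hp.2 _ (min_le_right _ _))).2
    have h2 : ContinuousAt (fun r => ψ (r, x)) r := h1.comp (f := fun r => (r, x)) (by fun_prop)
    exact (hg.continuous.continuousAt.comp
      (ev.continuous.continuousAt.comp h2)).continuousWithinAt
  have hco : ContinuousAt (fun r => g (ev (ψ (r, x)))) t₀ :=
    hcont.continuousAt (Ioo_mem_nhds (abs_lt.1 hp.1).1 (abs_lt.1 hp.1).2)
  have hd := intervalIntegral.integral_hasDerivAt_right (a := 0) (b := t₀)
    (f := fun r => g (ev (ψ (r, x)))) ?_ ?_ hco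
  · refine (hd.const_add x).congr_of_eventuallyEq ?_
    filter_upwards [Ioo_mem_nhds (abs_lt.1 hp.1).1 (abs_lt.1 hp.1).2] with t ht
    exact hint t (abs_lt.2 ht)
  · refine (hcont.mono ?_).intervalIntegrable
    exact (ordConnected_Ioo).uIcc_subset ⟨by linarith, hη0⟩ (abs_lt.1 hp.1)
  · exact hcont.stronglyMeasurableAtFilter isOpen_Ioo _ (abs_lt.1 hp.1)

end Flow

/-! ### Local flows -/

section FlowBox

/-- A property that holds near `(0, z)` holds on all small enough boxes around that point. -/
lemma eventually_box {E : Type*} [NormedAddCommGroup E] {z : E} {p : ℝ → E → Prop}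
    (h : ∀ᶠ q in 𝓝 ((0 : ℝ), z), p q.1 q.2) :
    ∀ᶠ ε in 𝓝[>] (0 : ℝ), ∀ t x, |t| < ε → dist x z < ε → p t x := by
  obtain ⟨δ, hδ, h⟩ := Metric.eventually_nhds_iff_ball.1 h
  filter_upwards [Ioo_mem_nhdsGT hδ] with ε hε t x ht hx
  refine h (t, x) ?_
  rw [Metric.mem_ball, Prod.dist_eq, max_lt_iff]
  exact ⟨by simpa [Real.dist_eq] using ht.trans hε.2, hx.trans hε.2⟩

variable {E : Type*} [NormedAddCommGroup E] [NormedSpace ℝ E]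

/-- `Φ` is a local flow of the vector field `L`, of class `C^1` in time and initial point together,
for times in `(-ε, ε)` and initial points in the ball of radius `ε` around `z`. The integral curves
in that ball are given by `Φ`. -/
structure IsFlowBox (L : E → E) (Φ : ℝ × E → E) (z : E) (ε : ℝ) : Prop where
  pos : 0 < ε
  contDiffAt : ∀ t x, |t| < ε → dist x z < ε → ContDiffAt ℝ 1 Φ (t, x)
  zero : ∀ x, dist x z < ε → Φ (0, x) = x
  hasDerivAt : ∀ t x, |t| < ε → dist x z < ε → HasDerivAt (fun s => Φ (s, x)) (L (Φ (t, x))) t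
  invertible : ∀ t x, |t| < ε → dist x z < ε →
    ((fderiv ℝ Φ (t, x)) ∘L .inr ℝ ℝ E).IsInvertible
  unique : ∀ (γ : ℝ → E) (a b t₀ : ℝ), t₀ ∈ Ioo a b →
    (∀ t ∈ Ioo a b, HasDerivAt γ (L (γ t)) t ∧ dist (γ t) z < ε) →
    ∀ t ∈ Ioo a b, |t - t₀| < ε → γ t = Φ (t - t₀, γ t₀)

lemma IsFlowBox.mono {L : E → E} {Φ : ℝ × E → E} {z : E} {ε ε' : ℝ} (h : IsFlowBox L Φ z ε)
    (h0 : 0 < ε') (hle : ε' ≤ ε) : IsFlowBox L Φ z ε' where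
  pos := h0
  contDiffAt t x ht hx := h.contDiffAt t x (ht.trans_le hle) (hx.trans_le hle)
  zero x hx := h.zero x (hx.trans_le hle)
  hasDerivAt t x ht hx := h.hasDerivAt t x (ht.trans_le hle) (hx.trans_le hle)
  invertible t x ht hx := h.invertible t x (ht.trans_le hle) (hx.trans_le hle)
  unique γ a b t₀ ht₀ hγ t ht htt := h.unique γ a b t₀ ht₀
    (fun s hs => ⟨(hγ s hs).1, (hγ s hs).2.trans_le hle⟩) t ht (htt.trans_le hle)

lemma IsFlowBox.hasFDerivAt {L : E → E} {Φ : ℝ × E → E} {z : E} {ε : ℝ} (h : IsFlowBox L Φ z ε)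
    {t : ℝ} {x : E} (ht : |t| < ε) (hx : dist x z < ε) :
    HasFDerivAt (fun y => Φ (t, y)) ((fderiv ℝ Φ (t, x)) ∘L .inr ℝ ℝ E) x :=
  HasFDerivAt.comp (g := Φ) x ((h.contDiffAt t x ht hx).differentiableAt one_ne_zero).hasFDerivAt
    (hasFDerivAt_prodMk_right t x)

lemma IsFlowBox.continuousAt {L : E → E} {Φ : ℝ × E → E} {z : E} {ε : ℝ} (h : IsFlowBox L Φ z ε)
    {t : ℝ} {x : E} (ht : |t| < ε) (hx : dist x z < ε) : ContinuousAt Φ (t, x) :=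
  (h.contDiffAt t x ht hx).continuousAt

lemma IsFlowBox.zero_self {L : E → E} {Φ : ℝ × E → E} {z : E} {ε : ℝ} (h : IsFlowBox L Φ z ε) :
    Φ (0, z) = z := h.zero z (by simpa using h.pos)

/-- On small boxes a local flow stays in a given neighbourhood of its centre. -/
lemma IsFlowBox.eventually_mem {L : E → E} {Φ : ℝ × E → E} {z : E} {ε : ℝ}
    (h : IsFlowBox L Φ z ε) {p : E → Prop} (hp : ∀ᶠ y in 𝓝 z, p y) :
    ∀ᶠ δ in 𝓝[>] (0 : ℝ), ∀ t x, |t| < δ → dist x z < δ → p (Φ (t, x)) := by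
  apply eventually_box (p := fun t x => p (Φ (t, x)))
  have h1 := (h.continuousAt (t := 0) (x := z) (by simpa using h.pos)
    (by simpa using h.pos)).tendsto
  rw [h.zero_self] at h1
  exact h1.eventually hp

lemma IsFlowBox.eventually_mono {L : E → E} {Φ : ℝ × E → E} {z : E} {ε : ℝ}
    (h : IsFlowBox L Φ z ε) : ∀ᶠ δ in 𝓝[>] (0 : ℝ), IsFlowBox L Φ z δ := by
  filter_upwards [Ioo_mem_nhdsGT h.pos] with δ hδ
  exact h.mono hδ.1 hδ.2.le

/-- The group property of a local flow. -/
lemma IsFlowBox.comp {L : E → E} {Φ : ℝ × E → E} {z : E} {ε δ : ℝ} (h : IsFlowBox L Φ z ε)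
    (hδ : 2 * δ ≤ ε) (hδε : ∀ t x, |t| < 2 * δ → dist x z < δ → dist (Φ (t, x)) z < ε)
    {s t : ℝ} {x : E} (hs : |s| < δ) (ht : |t| < δ) (hx : dist x z < δ) :
    Φ (s, Φ (t, x)) = Φ (s + t, x) := by
  have hδ0 : 0 < δ := dist_nonneg.trans_lt hx
  have ht' := abs_lt.1 ht
  have hs' := abs_lt.1 hs
  have h1 := h.unique (fun r => Φ (r, x)) (-(2 * δ)) (2 * δ) t ⟨by linarith, by linarith⟩
    (fun r hr => ⟨h.hasDerivAt r x ((abs_lt.2 hr).trans_le hδ) (by linarith),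
      hδε r x (abs_lt.2 hr) hx⟩) (s + t) ⟨by linarith, by linarith⟩
    (by rw [add_sub_cancel_right]; linarith)
  rw [h1, add_sub_cancel_right]

variable [FiniteDimensional ℝ E]

/-- A vector field that is of class `C^1` near a point has near that point a local flow of class
`C^1`. -/
lemma exists_isFlowBox {L : E → E} {z : E} (hL : ContDiffAt ℝ 1 L z) :
    ∃ Φ ε, IsFlowBox L Φ z ε := by
  have : CompleteSpace E := FiniteDimensional.complete ℝ E
  -- a cut-off makes the field globally of class `C^1` without changing it near `z`
  obtain ⟨r, hr, hLr⟩ := Metric.eventually_nhds_iff_ball.1 (hL.eventually (by simp))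
  let c : ContDiffBump z := ⟨r / 3, r / 2, by positivity, by linarith⟩
  set g : E → E := fun x => c x • L x with hg
  have hgs : ContDiff ℝ 1 g := by
    rw [contDiff_iff_contDiffAt]
    intro x
    by_cases hx : x ∈ Metric.ball z r
    · exact c.contDiff.contDiffAt.smul (hLr x hx)
    · have hx' : x ∉ tsupport c := by
        rw [c.tsupport_eq, Metric.mem_closedBall, not_le]
        rw [Metric.mem_ball, not_lt] at hx
        change r / 2 < _
        linarith
      have : g =ᶠ[𝓝 x] fun _ => 0 := by
        filter_upwards [(isClosed_tsupport c).isOpen_compl.mem_nhds hx'] with y hy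
        simp [hg, image_eq_zero_of_notMem_tsupport hy]
      exact contDiffAt_const.congr_of_eventuallyEq this
  have hgL : ∀ x, dist x z < r / 3 → g x = L x := by
    intro x hx
    have : c x = 1 := c.one_of_mem_closedBall (Metric.mem_closedBall.2 (show _ ≤ r / 3 from hx.le))
    simp [hg, this]
  obtain ⟨Φ, hΦ, hΦ'⟩ := exists_flow_of_contDiff hgs z
  have hΦz : Φ (0, z) = z := (hΦ'.self_of_nhds).1
  have hΦc := hΦ.continuousAt.tendsto
  rw [hΦz] at hΦc
  obtain ⟨K, T, hT, hK⟩ := hL.exists_lipschitzOnWith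
  have hnear : ∀ᶠ p in 𝓝 ((0 : ℝ), z), dist (Φ p) z < r / 3 :=
    hΦc.eventually (Metric.ball_mem_nhds z (by positivity))
  have hnearT : ∀ᶠ p in 𝓝 ((0 : ℝ), z), Φ p ∈ T := hΦc.eventually hT
  have hinv : ∀ᶠ p in 𝓝 ((0 : ℝ), z), ((fderiv ℝ Φ p) ∘L .inr ℝ ℝ E).IsInvertible := by
    have h0 : (fderiv ℝ Φ (0, z)) ∘L .inr ℝ ℝ E
        = (ContinuousLinearEquiv.refl ℝ E : E →L[ℝ] E) := by
      have h1 : HasFDerivAt (fun y => Φ (0, y)) ((fderiv ℝ Φ (0, z)) ∘L .inr ℝ ℝ E) z :=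
        HasFDerivAt.comp (g := Φ) z (hΦ.differentiableAt one_ne_zero).hasFDerivAt
          (hasFDerivAt_prodMk_right 0 z)
      have h2 : HasFDerivAt (fun y => Φ (0, y)) (ContinuousLinearMap.id ℝ E) z := by
        refine (hasFDerivAt_id z).congr_of_eventuallyEq ?_
        have : Tendsto (fun y : E => ((0 : ℝ), y)) (𝓝 z) (𝓝 (0, z)) :=
          (Continuous.prodMk_right 0).tendsto z
        exact (this.eventually hΦ').mono fun y hy => hy.1
      exact h1.unique h2
    have hc : ContinuousAt (fun p => (fderiv ℝ Φ p) ∘L .inr ℝ ℝ E) (0, z) := by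
      have := (hΦ.fderiv_right (m := 0) (by norm_num)).continuousAt
      fun_prop
    have h3 := hc.tendsto
    rw [h0] at h3
    filter_upwards [h3.eventually ((ContinuousLinearEquiv.refl ℝ E).nhds)] with p hp
    obtain ⟨e, he⟩ := hp
    exact ⟨e, he⟩
  have hall := eventually_box (p := fun t x => ContDiffAt ℝ 1 Φ (t, x) ∧
    (Φ (0, x) = x ∧ HasDerivAt (fun t => Φ (t, x)) (g (Φ (t, x))) t) ∧
    dist (Φ (t, x)) z < r / 3 ∧ Φ (t, x) ∈ T ∧ ((fderiv ℝ Φ (t, x)) ∘L .inr ℝ ℝ E).IsInvertible)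
    ((hΦ.eventually (by simp)).and (hΦ'.and (hnear.and (hnearT.and hinv))))
  obtain ⟨δ, hδ, hδT⟩ := Metric.mem_nhds_iff.1 hT
  obtain ⟨ε, hall, hε0, hεδ⟩ := (hall.and (Ioo_mem_nhdsGT hδ)).exists
  have hder : ∀ t x, |t| < ε → dist x z < ε →
      HasDerivAt (fun s => Φ (s, x)) (L (Φ (t, x))) t := fun t x ht hx => by
    obtain ⟨-, ⟨-, h1⟩, h2, -⟩ := hall t x ht hx
    rwa [hgL _ h2] at h1
  refine ⟨Φ, ε, hε0, fun t x ht hx => (hall t x ht hx).1,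
    fun x hx => (hall 0 x (by simpa using hε0) hx).2.1.1, hder,
    fun t x ht hx => (hall t x ht hx).2.2.2.2, ?_⟩
  intro γ a b t₀ ht₀ hγ t ht htt
  have hx0 := (hγ t₀ ht₀).2
  have habs := abs_lt.1 htt
  have hmem : ∀ s ∈ Ioo (max a (t₀ - ε)) (min b (t₀ + ε)), s ∈ Ioo a b ∧ |s - t₀| < ε := by
    intro s hs
    rw [mem_Ioo, max_lt_iff, lt_min_iff] at hs
    exact ⟨⟨hs.1.1, hs.2.1⟩, abs_lt.2 ⟨by linarith, by linarith⟩⟩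
  have key := ODE_solution_unique_of_mem_Ioo (v := fun _ => L) (s := fun _ => T) (K := K)
    (f := γ) (g := fun s => Φ (s - t₀, γ t₀)) (t₀ := t₀)
    (a := max a (t₀ - ε)) (b := min b (t₀ + ε)) (fun _ _ => hK)
    ⟨max_lt ht₀.1 (by linarith), lt_min ht₀.2 (by linarith)⟩
    (fun s hs => ⟨(hγ s (hmem s hs).1).1, hδT (lt_trans (hγ s (hmem s hs).1).2 hεδ)⟩)
    (fun s hs => ⟨by
      have := (hder (s - t₀) (γ t₀) (hmem s hs).2 hx0).comp_sub_const s t₀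
      simpa using this, (hall _ _ (hmem s hs).2 hx0).2.2.2.1⟩)
    (by simp [(hall 0 (γ t₀) (by simpa using hε0) hx0).2.1.1])
  exact key ⟨max_lt ht.1 (by linarith), lt_min ht.2 (by linarith)⟩

end FlowBox

/-! ### The tangent spaces of an equivalence relation -/

section OrbitTangent

variable {E : Type*} [NormedAddCommGroup E] [NormedSpace ℝ E]
  {T : Type*} [NormedAddCommGroup T] [NormedSpace ℝ T]
  {S : Type*} [NormedAddCommGroup S] [NormedSpace ℝ S]

/-- `G` is near `z` a family of maps, of class `C^1` in the parameter and the point together, that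
starts at the identity and moves every point within its class for the relation `r`. -/
structure IsIsotopyAt (r : Setoid E) (z : E) (G : T × E → E) : Prop where
  contDiffAt : ContDiffAt ℝ 1 G (0, z)
  zero : ∀ᶠ x in 𝓝 z, G (0, x) = x
  rel : ∀ᶠ p in 𝓝 ((0 : T), z), r (G p) p.2

variable {r : Setoid E} {z : E}

lemma IsIsotopyAt.zero_self {G : T × E → E} (h : IsIsotopyAt r z G) : G (0, z) = z :=
  h.zero.self_of_nhds

lemma IsIsotopyAt.tendsto {G : T × E → E} (h : IsIsotopyAt r z G) :
    Tendsto G (𝓝 (0, z)) (𝓝 z) := by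
  simpa only [h.zero_self] using h.contDiffAt.continuousAt.tendsto

lemma IsIsotopyAt.eventually {G : T × E → E} (h : IsIsotopyAt r z G) :
    ∀ᶠ x in 𝓝 z, IsIsotopyAt r x G := by
  have ht : Tendsto (fun x : E => ((0 : T), x)) (𝓝 z) (𝓝 (0, z)) :=
    (Continuous.prodMk_right 0).tendsto z
  filter_upwards [ht.eventually (h.contDiffAt.eventually (by simp)),
    h.zero.eventually_nhds, ht.eventually h.rel.eventually_nhds] with x h1 h2 h3
  exact ⟨h1, h2, h3⟩

lemma IsIsotopyAt.fderiv_inr {G : T × E → E} (h : IsIsotopyAt r z G) (w : E) :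
    fderiv ℝ G (0, z) (0, w) = w := by
  have h1 : HasFDerivAt (fun y => G (0, y)) ((fderiv ℝ G (0, z)) ∘L .inr ℝ T E) z :=
    HasFDerivAt.comp (g := G) z (h.contDiffAt.differentiableAt one_ne_zero).hasFDerivAt
      (hasFDerivAt_prodMk_right 0 z)
  have h2 : HasFDerivAt (fun y => G (0, y)) (ContinuousLinearMap.id ℝ E) z :=
    (hasFDerivAt_id z).congr_of_eventuallyEq h.zero
  have h3 := DFunLike.congr_fun (h1.unique h2) w
  simpa using h3

/-- Reparametrization of an isotopy by a linear map. -/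
lemma IsIsotopyAt.comp_linear {G : T × E → E} (h : IsIsotopyAt r z G) (A : S →L[ℝ] T) :
    IsIsotopyAt r z (fun p : S × E => G (A p.1, p.2)) where
  contDiffAt := by
    have h1 : ContDiffAt ℝ 1 G ((A (0 : S)), z) := by simpa using h.contDiffAt
    exact h1.comp (f := fun p : S × E => (A p.1, p.2)) (0, z) (by fun_prop)
  zero := by simpa using h.zero
  rel := by
    have : Tendsto (fun p : S × E => (A p.1, p.2)) (𝓝 (0, z)) (𝓝 (0, z)) := by
      have : Continuous (fun p : S × E => (A p.1, p.2)) := by fun_prop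
      simpa using this.tendsto (0, z)
    exact this.eventually h.rel

lemma IsIsotopyAt.fderiv_comp_linear {G : T × E → E} (h : IsIsotopyAt r z G) (A : S →L[ℝ] T)
    (v : S) (w : E) :
    fderiv ℝ (fun p : S × E => G (A p.1, p.2)) (0, z) (v, w) = fderiv ℝ G (0, z) (A v, w) := by
  have h1 : HasFDerivAt G (fderiv ℝ G (0, z)) (A (0 : S), z) := by
    simpa using (h.contDiffAt.differentiableAt one_ne_zero).hasFDerivAt
  have h2 : HasFDerivAt (fun p : S × E => (A p.1, p.2))
      ((A ∘L .fst ℝ S E).prod (.snd ℝ S E)) (0, z) :=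
    (A.hasFDerivAt.comp (0, z) hasFDerivAt_fst).prodMk hasFDerivAt_snd
  have h3 := HasFDerivAt.comp (f := fun p : S × E => (A p.1, p.2)) (0, z) h1 h2
  have h4 : fderiv ℝ (fun p : S × E => G (A p.1, p.2)) (0, z) = _ := h3.fderiv
  rw [h4]
  simp

/-- Composition of isotopies with independent parameters. -/
lemma IsIsotopyAt.comp {G : T × E → E} {H : S × E → E} (hG : IsIsotopyAt r z G)
    (hH : IsIsotopyAt r z H) :
    IsIsotopyAt r z (fun p : (T × S) × E => G (p.1.1, H (p.1.2, p.2))) where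
  contDiffAt := by
    have h1 : ContDiffAt ℝ 1 G (0, H (0, z)) := by simpa only [hH.zero_self] using hG.contDiffAt
    have h2 : ContDiffAt ℝ 1 (fun p : (T × S) × E => H (p.1.2, p.2)) (0, z) :=
      hH.contDiffAt.comp (f := fun p : (T × S) × E => (p.1.2, p.2)) (0, z) (by fun_prop)
    exact h1.comp (f := fun p : (T × S) × E => (p.1.1, H (p.1.2, p.2))) (0, z)
      (contDiffAt_fst.fst.prodMk h2)
  zero := by
    filter_upwards [hG.zero, hH.zero] with x h1 h2
    simp [h1, h2]
  rel := by
    have hc : Tendsto (fun p : (T × S) × E => (p.1.2, p.2)) (𝓝 (0, z)) (𝓝 (0, z)) := by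
      have : Continuous (fun p : (T × S) × E => (p.1.2, p.2)) := by fun_prop
      exact this.tendsto (0, z)
    have hc2 : Tendsto (fun p : (T × S) × E => (p.1.1, H (p.1.2, p.2))) (𝓝 (0, z))
        (𝓝 (0, z)) := by
      refine Tendsto.prodMk_nhds ?_ (hH.tendsto.comp hc)
      have : Continuous (fun p : (T × S) × E => p.1.1) := by fun_prop
      exact this.tendsto (0, z)
    filter_upwards [hc.eventually hH.rel, hc2.eventually hG.rel] with p h1 h2
    exact r.trans h2 h1

lemma IsIsotopyAt.fderiv_comp {G : T × E → E} {H : S × E → E} (hG : IsIsotopyAt r z G)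
    (hH : IsIsotopyAt r z H) (t : T) (s : S) :
    fderiv ℝ (fun p : (T × S) × E => G (p.1.1, H (p.1.2, p.2))) (0, z) ((t, s), 0)
      = fderiv ℝ G (0, z) (t, 0) + fderiv ℝ H (0, z) (s, 0) := by
  have h1 : HasFDerivAt H (fderiv ℝ H (0, z)) (0, z) :=
    (hH.contDiffAt.differentiableAt one_ne_zero).hasFDerivAt
  have h2 : HasFDerivAt (fun p : (T × S) × E => (p.1.2, p.2))
      ((.snd ℝ T S ∘L .fst ℝ (T × S) E).prod (.snd ℝ (T × S) E)) (0, z) :=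
    hasFDerivAt_fst.snd.prodMk hasFDerivAt_snd
  have h3 := HasFDerivAt.comp (f := fun p : (T × S) × E => (p.1.2, p.2)) (0, z) h1 h2
  have h4 : HasFDerivAt G (fderiv ℝ G (0, z)) (0, H (0, z)) := by
    simpa only [hH.zero_self] using (hG.contDiffAt.differentiableAt one_ne_zero).hasFDerivAt
  have h5 : HasFDerivAt (fun p : (T × S) × E => (p.1.1, H (p.1.2, p.2))) _ (0, z) :=
    hasFDerivAt_fst.fst.prodMk h3
  have h6 := HasFDerivAt.comp (f := fun p : (T × S) × E => (p.1.1, H (p.1.2, p.2))) (0, z) h4 h5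
  have h7 : fderiv ℝ (fun p : (T × S) × E => G (p.1.1, H (p.1.2, p.2))) (0, z) = _ := h6.fderiv
  rw [h7]
  simp only [ContinuousLinearMap.comp_apply, ContinuousLinearMap.prod_apply]
  have h8 : ((t, fderiv ℝ H (0, z) (s, 0)) : T × E) = (t, 0) + (0, fderiv ℝ H (0, z) (s, 0)) := by
    simp
  change fderiv ℝ G (0, z) (t, fderiv ℝ H (0, z) (s, 0)) = _
  rw [h8, map_add, hG.fderiv_inr]

lemma isIsotopyAt_snd : IsIsotopyAt r z (Prod.snd : T × E → E) where
  contDiffAt := contDiffAt_snd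
  zero := Eventually.of_forall fun _ => rfl
  rel := Eventually.of_forall fun _ => r.refl _

/-- The tangent space at `z` of an equivalence relation: the velocities at `z` of the isotopies
that preserve the classes. This makes sense for an arbitrary relation; for the relation whose
classes are the orbits of a family of vector fields it contains the tangent space of the orbit. -/
noncomputable def orbitTangent (r : Setoid E) (z : E) : Submodule ℝ E where
  carrier := {v | ∃ G : ℝ × E → E, IsIsotopyAt r z G ∧ fderiv ℝ G (0, z) (1, 0) = v}
  zero_mem' := ⟨Prod.snd, isIsotopyAt_snd, by rw [fderiv_snd]; rfl⟩
  add_mem' := by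
    rintro _ _ ⟨G, hG, rfl⟩ ⟨H, hH, rfl⟩
    refine ⟨_, (hG.comp hH).comp_linear ((ContinuousLinearMap.id ℝ ℝ).prod (.id ℝ ℝ)), ?_⟩
    rw [(hG.comp hH).fderiv_comp_linear]
    exact hG.fderiv_comp hH 1 1
  smul_mem' := by
    rintro c _ ⟨G, hG, rfl⟩
    refine ⟨_, hG.comp_linear (c • .id ℝ ℝ), ?_⟩
    rw [hG.fderiv_comp_linear, ← map_smul]
    simp

lemma IsIsotopyAt.fderiv_mem {G : T × E → E} (h : IsIsotopyAt r z G) (v : T) :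
    fderiv ℝ G (0, z) (v, 0) ∈ orbitTangent r z := by
  refine ⟨_, h.comp_linear (ContinuousLinearMap.toSpanSingleton ℝ v), ?_⟩
  rw [h.fderiv_comp_linear]
  simp

/-- Finitely many tangent vectors of a relation are velocities of one isotopy. -/
lemma exists_isotopy_of_mem (n : ℕ) (v : Fin n → E) (hv : ∀ i, v i ∈ orbitTangent r z) :
    ∃ F : (Fin n → ℝ) × E → E, IsIsotopyAt r z F ∧
      ∀ t, fderiv ℝ F (0, z) (t, 0) = ∑ i, t i • v i := by
  induction n with
  | zero =>
    refine ⟨Prod.snd, isIsotopyAt_snd, fun t => ?_⟩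
    rw [fderiv_snd, Fin.sum_univ_zero]
    rfl
  | succ n ih =>
    obtain ⟨F, hF, hF'⟩ := ih (fun i => v i.succ) (fun i => hv i.succ)
    obtain ⟨G, hG, hG'⟩ := hv 0
    refine ⟨_, (hG.comp hF).comp_linear ((ContinuousLinearMap.proj (R := ℝ)
      (φ := fun _ : Fin (n + 1) => ℝ) 0).prod
      (ContinuousLinearMap.pi fun i : Fin n => ContinuousLinearMap.proj (R := ℝ)
        (φ := fun _ : Fin (n + 1) => ℝ) i.succ)), fun t => ?_⟩
    rw [(hG.comp hF).fderiv_comp_linear]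
    refine (hG.fderiv_comp hF _ _).trans ?_
    rw [hF', Fin.sum_univ_succ, ← hG', ← map_smul]
    simp

variable [FiniteDimensional ℝ E]

/-- The dimension of the tangent space of an equivalence relation. -/
noncomputable def orbitRank (r : Setoid E) (z : E) : ℕ := Module.finrank ℝ (orbitTangent r z)

/-- One isotopy, with as many parameters as the tangent space of the relation has dimensions, whose
velocities span that tangent space; `π` is a left inverse of its derivative in the parameters. -/
lemma exists_spanning_isotopy (r : Setoid E) (z : E) :
    ∃ (F : (Fin (orbitRank r z) → ℝ) × E → E) (π : E →L[ℝ] (Fin (orbitRank r z) → ℝ)),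
      IsIsotopyAt r z F ∧ π ∘L (fderiv ℝ F (0, z) ∘L .inl ℝ _ E) = .id ℝ _ := by
  set b := Module.finBasis ℝ (orbitTangent r z) with hb
  obtain ⟨F, hF, hF'⟩ := exists_isotopy_of_mem (r := r) (z := z) (orbitRank r z)
    (fun i => (b i : E)) (fun i => (b i).2)
  set A : (Fin (orbitRank r z) → ℝ) →ₗ[ℝ] E := (fderiv ℝ F (0, z) ∘L .inl ℝ _ E).toLinearMap
  have hA : ∀ t, A t = ((∑ i, t i • b i : orbitTangent r z) : E) := by
    intro t
    have h1 : A t = fderiv ℝ F (0, z) (t, 0) := rfl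
    rw [h1, hF']
    simp
  have hinj : LinearMap.ker A = ⊥ := by
    rw [LinearMap.ker_eq_bot']
    intro t ht
    rw [hA, ZeroMemClass.coe_eq_zero] at ht
    have := Fintype.linearIndependent_iff.1 b.linearIndependent t ht
    exact funext this
  obtain ⟨p, hp⟩ := A.exists_leftInverse_of_injective hinj
  refine ⟨F, p.toContinuousLinearMap, hF, ?_⟩
  ext1 t
  exact DFunLike.congr_fun hp t

end OrbitTangent

/-! ### Transport of tangent spaces by class-preserving maps -/

section Transport

variable {E : Type*} [NormedAddCommGroup E] [NormedSpace ℝ E] [FiniteDimensional ℝ E]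
  {T : Type*} [NormedAddCommGroup T] [NormedSpace ℝ T] {r : Setoid E}

omit [FiniteDimensional ℝ E] in
lemma exists_local_inverse [CompleteSpace E] {ψ : E → E} {x : E} (hψ : ContDiffAt ℝ 1 ψ x)
    (hinv : (fderiv ℝ ψ x).IsInvertible) :
    ∃ χ : E → E, ContDiffAt ℝ 1 χ (ψ x) ∧ χ (ψ x) = x ∧ (∀ᶠ y in 𝓝 (ψ x), ψ (χ y) = y) ∧
      (∀ᶠ y in 𝓝 x, χ (ψ y) = y) ∧ (fderiv ℝ χ (ψ x)).IsInvertible := by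
  obtain ⟨e, he⟩ := hinv
  have hd : HasFDerivAt ψ (e : E →L[ℝ] E) x := by
    rw [he]; exact (hψ.differentiableAt one_ne_zero).hasFDerivAt
  have hs : HasStrictFDerivAt ψ (e : E →L[ℝ] E) x := by
    rw [he]; exact hψ.hasStrictFDerivAt one_ne_zero
  refine ⟨hs.localInverse ψ e x, hψ.to_localInverse hd one_ne_zero, hs.localInverse_apply_image,
    hs.eventually_right_inverse, hs.eventually_left_inverse, ?_⟩
  rw [hs.to_localInverse.hasFDerivAt.fderiv]
  exact ⟨e.symm, rfl⟩

/-- A local diffeomorphism that preserves the classes maps tangent spaces of the relation into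
tangent spaces of the relation. -/
lemma fderiv_mem_orbitTangent {ψ : E → E} {x : E} (hψ : ContDiffAt ℝ 1 ψ x)
    (hinv : (fderiv ℝ ψ x).IsInvertible) (hr : ∀ᶠ y in 𝓝 x, r (ψ y) y) {w : E}
    (hw : w ∈ orbitTangent r x) : fderiv ℝ ψ x w ∈ orbitTangent r (ψ x) := by
  have : CompleteSpace E := FiniteDimensional.complete ℝ E
  obtain ⟨χ, hχ, hχx, hψχ, -, -⟩ := exists_local_inverse hψ hinv
  obtain ⟨G, hG, rfl⟩ := hw
  have hG1 : ContDiffAt ℝ 1 G (0, χ (ψ x)) := by simpa only [hχx] using hG.contDiffAt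
  have hχ1 : ContDiffAt ℝ 1 (fun p : ℝ × E => (p.1, χ p.2)) (0, ψ x) :=
    contDiffAt_fst.prodMk (ContDiffAt.comp (g := χ) (0, ψ x) hχ contDiffAt_snd)
  have hχt : Tendsto χ (𝓝 (ψ x)) (𝓝 x) := by simpa only [hχx] using hχ.continuousAt.tendsto
  have hχt2 : Tendsto (fun p : ℝ × E => (p.1, χ p.2)) (𝓝 (0, ψ x)) (𝓝 (0, x)) := by
    simpa only [hχx] using hχ1.continuousAt.tendsto
  have hH : ContDiffAt ℝ 1 (fun p : ℝ × E => G (p.1, χ p.2)) (0, ψ x) :=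
    ContDiffAt.comp (f := fun p : ℝ × E => (p.1, χ p.2)) (0, ψ x) hG1 hχ1
  have hHv : G (0, χ (ψ x)) = x := by rw [hχx, hG.zero_self]
  have hψ1 : ContDiffAt ℝ 1 ψ (G (0, χ (ψ x))) := by rwa [hHv]
  refine ⟨fun p => ψ (G (p.1, χ p.2)), ⟨?_, ?_, ?_⟩, ?_⟩
  · exact ContDiffAt.comp (f := fun p : ℝ × E => G (p.1, χ p.2)) (0, ψ x) hψ1 hH
  · filter_upwards [hψχ, hχt.eventually hG.zero] with y h1 h2
    rw [h2, h1]
  · have h1 : Tendsto (fun p : ℝ × E => p.2) (𝓝 ((0 : ℝ), ψ x)) (𝓝 (ψ x)) :=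
      continuous_snd.tendsto _
    filter_upwards [hχt2.eventually hG.rel, h1.eventually hψχ, (hG.tendsto.comp hχt2).eventually hr,
      (hχt.comp h1).eventually hr] with p h2 h3 h4 h5
    have h6 : r (ψ (χ p.2)) (χ p.2) := h5
    rw [h3] at h6
    exact r.trans h4 (r.trans h2 (r.symm h6))
  · -- differentiate along the line `t ↦ (t, ψ x)`
    have hG2 : HasFDerivAt G (fderiv ℝ G (0, x)) (0, x) :=
      (hG.contDiffAt.differentiableAt one_ne_zero).hasFDerivAt
    have hline : HasDerivAt (fun t : ℝ => (t, x)) ((1, 0) : ℝ × E) 0 :=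
      (hasDerivAt_id 0).prodMk (hasDerivAt_const 0 x)
    have h1 : HasDerivAt (fun t : ℝ => G (t, x)) (fderiv ℝ G (0, x) (1, 0)) 0 :=
      HasFDerivAt.comp_hasDerivAt (f := fun t : ℝ => (t, x)) 0 hG2 hline
    have h2 : HasFDerivAt ψ (fderiv ℝ ψ x) (G (0, x)) := by
      rw [hG.zero_self]; exact (hψ.differentiableAt one_ne_zero).hasFDerivAt
    have h3 : HasDerivAt (fun t : ℝ => ψ (G (t, x))) (fderiv ℝ ψ x (fderiv ℝ G (0, x) (1, 0))) 0 :=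
      HasFDerivAt.comp_hasDerivAt (f := fun t : ℝ => G (t, x)) 0 h2 h1
    have hfull := (ContDiffAt.comp (f := fun p : ℝ × E => G (p.1, χ p.2)) (0, ψ x) hψ1
      hH).differentiableAt one_ne_zero
    have hline2 : HasDerivAt (fun t : ℝ => (t, ψ x)) ((1, 0) : ℝ × E) 0 :=
      (hasDerivAt_id 0).prodMk (hasDerivAt_const 0 (ψ x))
    have h4 := HasFDerivAt.comp_hasDerivAt (f := fun t : ℝ => (t, ψ x)) 0 hfull.hasFDerivAt hline2
    have h5 : HasDerivAt (fun t : ℝ => ψ (G (t, χ (ψ x)))) _ 0 := h4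
    simp only [hχx] at h5
    exact h5.unique h3

/-- The dimension of the tangent space of a relation is invariant under local diffeomorphisms that
preserve the classes. -/
lemma orbitRank_eq {ψ : E → E} {x : E} (hψ : ContDiffAt ℝ 1 ψ x)
    (hinv : (fderiv ℝ ψ x).IsInvertible) (hr : ∀ᶠ y in 𝓝 x, r (ψ y) y) :
    orbitRank r (ψ x) = orbitRank r x := by
  have hcomp : CompleteSpace E := FiniteDimensional.complete ℝ E
  have key : ∀ {ψ : E → E} {x : E} (_ : ContDiffAt ℝ 1 ψ x)
    (_ : (fderiv ℝ ψ x).IsInvertible) (_ : ∀ᶠ y in 𝓝 x, r (ψ y) y),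
      orbitRank r x ≤ orbitRank r (ψ x) := by
    intro ψ x hψ hinv hr
    have h1 : (orbitTangent r x).map (fderiv ℝ ψ x).toLinearMap ≤ orbitTangent r (ψ x) := by
      rintro _ ⟨w, hw, rfl⟩
      exact fderiv_mem_orbitTangent hψ hinv hr hw
    obtain ⟨e, he⟩ := hinv
    have h2 := Submodule.finrank_mono h1
    rw [← he] at h2
    have h3 : Module.finrank ℝ ((orbitTangent r x).map (e : E →L[ℝ] E).toLinearMap)
        = orbitRank r x := LinearEquiv.finrank_map_eq e.toLinearEquiv _
    rwa [h3] at h2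
  refine le_antisymm ?_ (key hψ hinv hr)
  obtain ⟨χ, hχ, hχx, hψχ, -, hχi⟩ := exists_local_inverse hψ hinv
  have hχt : Tendsto χ (𝓝 (ψ x)) (𝓝 x) := by simpa only [hχx] using hχ.continuousAt.tendsto
  have := key hχ hχi (by
    filter_upwards [hψχ, hχt.eventually hr] with y h1 h2
    rw [h1] at h2
    exact r.symm h2)
  rwa [hχx] at this

/-- The velocities of a family of class-preserving local diffeomorphisms are tangent to the
relation, also at parameters where the family is not the identity. -/
lemma fderiv_inl_mem_orbitTangent {G : T × E → E} {t : T} {x : E}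
    (hG : ContDiffAt ℝ 1 G (t, x)) (hinv : ((fderiv ℝ G (t, x)) ∘L .inr ℝ T E).IsInvertible)
    (hr : ∀ᶠ p in 𝓝 (t, x), r (G p) p.2) (v : T) :
    fderiv ℝ G (t, x) (v, 0) ∈ orbitTangent r (G (t, x)) := by
  have : CompleteSpace E := FiniteDimensional.complete ℝ E
  have hψd : HasFDerivAt (fun y => G (t, y)) ((fderiv ℝ G (t, x)) ∘L .inr ℝ T E) x :=
    HasFDerivAt.comp (g := G) x (hG.differentiableAt one_ne_zero).hasFDerivAt
      (hasFDerivAt_prodMk_right t x)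
  have hψ : ContDiffAt ℝ 1 (fun y => G (t, y)) x :=
    ContDiffAt.comp (f := fun y => (t, y)) x hG (by fun_prop)
  rw [← hψd.fderiv] at hinv
  obtain ⟨χ, hχ, hχx, hψχ, -, -⟩ := exists_local_inverse hψ hinv
  set y := G (t, x) with hy
  have hχx' : χ y = x := hχx
  have hin : ContDiffAt ℝ 1 (fun p : T × E => (t + p.1, χ p.2)) (0, y) :=
    (contDiffAt_const.add contDiffAt_fst).prodMk
      (ContDiffAt.comp (g := χ) (0, y) hχ contDiffAt_snd)
  have hin0 : (fun p : T × E => (t + p.1, χ p.2)) (0, y) = (t, x) := by simp [hχx']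
  have hin1 : Tendsto (fun p : T × E => (t + p.1, χ p.2)) (𝓝 (0, y)) (𝓝 (t, x)) := by
    simpa only [hin0] using hin.continuousAt.tendsto
  have hG' : ContDiffAt ℝ 1 G ((fun p : T × E => (t + p.1, χ p.2)) (0, y)) := by rwa [hin0]
  have hiso : IsIsotopyAt r y (fun p : T × E => G (t + p.1, χ p.2)) := by
    refine ⟨ContDiffAt.comp (f := fun p : T × E => (t + p.1, χ p.2)) (0, y) hG' hin, ?_, ?_⟩
    · filter_upwards [hψχ] with y' h1
      simpa using h1
    · have h2 : Tendsto (fun p : T × E => (t, χ p.2)) (𝓝 (0, y)) (𝓝 (t, x)) := by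
        have h3 : Tendsto χ (𝓝 y) (𝓝 x) := by
          have := hχ.continuousAt.tendsto
          rwa [hχx] at this
        exact tendsto_const_nhds.prodMk_nhds (h3.comp (continuous_snd.tendsto (0, y)))
      have h3 : Tendsto (fun p : T × E => p.2) (𝓝 (0, y)) (𝓝 y) := continuous_snd.tendsto _
      filter_upwards [hin1.eventually hr, h2.eventually hr, h3.eventually hψχ] with p h4 h5 h6
      have h7 : r (G (t, χ p.2)) (χ p.2) := h5
      have h8 : G (t, χ p.2) = p.2 := h6
      rw [h8] at h7
      exact r.trans h4 (r.symm h7)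
  have hmem := hiso.fderiv_mem v
  convert! hmem using 1
  -- both sides are the derivative of `s ↦ G (t + s • v, x)` at `0`
  have hl1 : HasDerivAt (fun s : ℝ => ((s • v, y) : T × E)) (v, 0) 0 := by
    have := ((hasDerivAt_id (0 : ℝ)).smul_const v).prodMk (hasDerivAt_const (0 : ℝ) y)
    simpa using this
  have hl2 : HasDerivAt (fun s : ℝ => ((t + s • v, x) : T × E)) (v, 0) 0 := by
    have := (((hasDerivAt_id (0 : ℝ)).smul_const v).const_add t).prodMk (hasDerivAt_const (0 : ℝ) x)
    simpa using this
  have hd1 : HasFDerivAt (fun p : T × E => G (t + p.1, χ p.2))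
      (fderiv ℝ (fun p : T × E => G (t + p.1, χ p.2)) (0, y))
        ((fun s : ℝ => ((s • v, y) : T × E)) 0) := by
    simpa using (hiso.contDiffAt.differentiableAt one_ne_zero).hasFDerivAt
  have hd2 : HasFDerivAt G (fderiv ℝ G (t, x)) ((fun s : ℝ => ((t + s • v, x) : T × E)) 0) := by
    simpa using (hG.differentiableAt one_ne_zero).hasFDerivAt
  have e0 := HasFDerivAt.comp_hasDerivAt (f := fun s : ℝ => ((s • v, y) : T × E)) 0 hd1 hl1
  have e1 : HasDerivAt (fun s : ℝ => G (t + s • v, χ y)) _ 0 := e0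
  have e2 : HasDerivAt (fun s : ℝ => G (t + s • v, x)) _ 0 :=
    HasFDerivAt.comp_hasDerivAt (f := fun s : ℝ => ((t + s • v, x) : T × E)) 0 hd2 hl2
  rw [hχx'] at e1
  exact e2.unique e1

omit [FiniteDimensional ℝ E] in
/-- Near its base point, the derivative of a spanning isotopy in the parameters stays injective. -/
lemma eventually_isUnit_comp {F : T × E → E} {z : E} {π : E →L[ℝ] T} [FiniteDimensional ℝ T]
    (hF : ContDiffAt ℝ 1 F (0, z)) (hπ : π ∘L (fderiv ℝ F (0, z) ∘L .inl ℝ T E) = .id ℝ T) :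
    ∀ᶠ p in 𝓝 ((0 : T), z), (π ∘L (fderiv ℝ F p ∘L .inl ℝ T E)).IsInvertible := by
  have : CompleteSpace T := FiniteDimensional.complete ℝ T
  have hc : ContinuousAt (fun p => π ∘L (fderiv ℝ F p ∘L .inl ℝ T E)) (0, z) := by
    have := (hF.fderiv_right (m := 0) (by norm_num)).continuousAt
    fun_prop
  have h3 := hc.tendsto
  rw [hπ] at h3
  filter_upwards [h3.eventually ((ContinuousLinearEquiv.refl ℝ T).nhds)] with p hp
  obtain ⟨e, he⟩ := hp
  exact ⟨e, he⟩

lemma eventually_invertible_inr {F : T × E → E} {z : E} (hF : IsIsotopyAt r z F) :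
    ∀ᶠ p in 𝓝 ((0 : T), z), (fderiv ℝ F p ∘L .inr ℝ T E).IsInvertible := by
  have : CompleteSpace E := FiniteDimensional.complete ℝ E
  have hc : ContinuousAt (fun p => fderiv ℝ F p ∘L .inr ℝ T E) (0, z) := by
    have := (hF.contDiffAt.fderiv_right (m := 0) (by norm_num)).continuousAt
    fun_prop
  have h3 := hc.tendsto
  have h4 : fderiv ℝ F (0, z) ∘L .inr ℝ T E
      = (ContinuousLinearEquiv.refl ℝ E : E →L[ℝ] E) := by
    ext w
    simpa using hF.fderiv_inr w
  rw [h4] at h3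
  filter_upwards [h3.eventually ((ContinuousLinearEquiv.refl ℝ E).nhds)] with p hp
  obtain ⟨e, he⟩ := hp
  exact ⟨e, he⟩

/-- The dimension of the tangent space of a relation is lower semicontinuous. -/
lemma eventually_orbitRank_le (r : Setoid E) (z : E) :
    ∀ᶠ x in 𝓝 z, orbitRank r z ≤ orbitRank r x := by
  obtain ⟨F, π, hF, hπ⟩ := exists_spanning_isotopy r z
  have ht : Tendsto (fun x : E => ((0 : Fin (orbitRank r z) → ℝ), x)) (𝓝 z) (𝓝 (0, z)) :=
    (Continuous.prodMk_right 0).tendsto z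
  filter_upwards [hF.eventually, ht.eventually (eventually_isUnit_comp hF.contDiffAt hπ)]
    with x h1 ⟨e, he⟩
  set A : (Fin (orbitRank r z) → ℝ) →ₗ[ℝ] E := (fderiv ℝ F (0, x) ∘L .inl ℝ _ E).toLinearMap
  have hA : Function.Injective A := by
    intro a b hab
    apply e.injective
    have h2 : ∀ a, e a = π (A a) := fun a => DFunLike.congr_fun he a
    rw [h2, h2, hab]
  have h3 : LinearMap.range A ≤ orbitTangent r x := by
    rintro _ ⟨v, rfl⟩
    exact h1.fderiv_mem v
  have h4 := Submodule.finrank_mono h3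
  rw [LinearMap.finrank_range_of_inj hA, Module.finrank_fin_fun] at h4
  exact h4

end Transport

/-! ### Curves tangent to an equivalence relation -/

section Curves

variable {E : Type*} [NormedAddCommGroup E] [NormedSpace ℝ E] [FiniteDimensional ℝ E]
  {r : Setoid E}

/-- A curve of class `C^1` that, for a dense set of times, is tangent to the relation `r` and passes
through points where the tangent space of `r` is not larger than at the initial point, stays for a
short positive time in the class of its initial point. -/
theorem rel_of_tangent_curve {c : ℝ → E} (hc : ContDiffAt ℝ 1 c 0) {D : Set ℝ} (hD : Dense D)
    {ε : ℝ} (hε : 0 < ε)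
    (hrank : ∀ τ ∈ D, τ ∈ Ioo 0 ε → orbitRank r (c τ) ≤ orbitRank r (c 0))
    (htan : ∀ τ ∈ D, τ ∈ Ioo 0 ε → deriv c τ ∈ orbitTangent r (c τ)) :
    ∀ᶠ τ in 𝓝[>] (0 : ℝ), r (c τ) (c 0) := by
  set z := c 0 with hz
  obtain ⟨n, hn⟩ : ∃ n, n = orbitRank r z := ⟨_, rfl⟩
  have hspan := exists_spanning_isotopy r z
  rw [← hn] at hspan
  rw [← hn] at hrank
  obtain ⟨F, π, hF, hπ⟩ := hspan
  -- choose the parameters `θ τ` so that `π (F (θ τ, c τ))` is constant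
  set Q : ℝ × (Fin n → ℝ) → (Fin n → ℝ) := fun p => π (F (p.2, c p.1)) with hQ
  have hQi : ContDiffAt ℝ 1 (fun p : ℝ × (Fin n → ℝ) => (p.2, c p.1)) (0, 0) :=
    contDiffAt_snd.prodMk (ContDiffAt.comp (g := c) ((0 : ℝ), (0 : Fin n → ℝ)) hc contDiffAt_fst)
  have hQs : ContDiffAt ℝ 1 Q (0, 0) := by
    refine π.contDiff.contDiffAt.comp _ ?_
    exact ContDiffAt.comp (f := fun p : ℝ × (Fin n → ℝ) => (p.2, c p.1)) (0, 0) hF.contDiffAt hQi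
  have hQinv : (fderiv ℝ Q (0, 0) ∘L .inr ℝ ℝ (Fin n → ℝ)).IsInvertible := by
    have h1 : HasFDerivAt (fun t => Q (0, t)) (fderiv ℝ Q (0, 0) ∘L .inr ℝ ℝ (Fin n → ℝ)) 0 :=
      HasFDerivAt.comp (g := Q) (0 : Fin n → ℝ) (hQs.differentiableAt one_ne_zero).hasFDerivAt
        (hasFDerivAt_prodMk_right 0 0)
    have h2 : HasFDerivAt (fun t => F (t, z)) (fderiv ℝ F (0, z) ∘L .inl ℝ (Fin n → ℝ) E) 0 :=
      HasFDerivAt.comp (g := F) (0 : Fin n → ℝ)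
        (hF.contDiffAt.differentiableAt one_ne_zero).hasFDerivAt (hasFDerivAt_prodMk_left 0 z)
    have h3 : HasFDerivAt (fun t => Q (0, t)) (π ∘L (fderiv ℝ F (0, z) ∘L .inl ℝ (Fin n → ℝ) E))
        0 := π.hasFDerivAt.comp (0 : Fin n → ℝ) h2
    rw [h1.unique h3, hπ]
    exact ⟨ContinuousLinearEquiv.refl ℝ _, rfl⟩
  set θ := hQs.implicitFunction one_ne_zero hQinv with hθ
  have hθs : ContDiffAt ℝ 1 θ 0 := hQs.contDiffAt_implicitFunction one_ne_zero hQinv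
  have hθ0 : θ 0 = 0 := hQs.implicitFunction_apply_self one_ne_zero hQinv
  have hθe : ∀ᶠ τ in 𝓝 0, Q (τ, θ τ) = Q (0, 0) :=
    hQs.eventually_apply_implicitFunction one_ne_zero hQinv
  have hp : ContDiffAt ℝ 1 (fun τ => (θ τ, c τ)) 0 := hθs.prodMk hc
  have hp0 : (θ 0, c 0) = (0, z) := by rw [hθ0]
  have hpt : Tendsto (fun τ => (θ τ, c τ)) (𝓝 0) (𝓝 (0, z)) := by
    simpa only [hp0] using hp.continuousAt.tendsto
  set g : ℝ → E := fun τ => F (θ τ, c τ) with hg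
  have hgs : ContDiffAt ℝ 1 g 0 := by
    refine ContDiffAt.comp (f := fun τ => (θ τ, c τ)) 0 ?_ hp
    rw [hp0]; exact hF.contDiffAt
  have hg0 : g 0 = z := by simp only [hg, hp0]; exact hF.zero_self
  have hall : ∀ᶠ τ in 𝓝 0, (∀ᶠ σ in 𝓝 τ, Q (σ, θ σ) = Q (0, 0)) ∧
      ContDiffAt ℝ 1 F (θ τ, c τ) ∧ (∀ᶠ q in 𝓝 (θ τ, c τ), r (F q) q.2) ∧
      (π ∘L (fderiv ℝ F (θ τ, c τ) ∘L .inl ℝ _ E)).IsInvertible ∧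
      (fderiv ℝ F (θ τ, c τ) ∘L .inr ℝ _ E).IsInvertible ∧
      ContDiffAt ℝ 1 c τ ∧ ContDiffAt ℝ 1 θ τ ∧ ContDiffAt ℝ 1 g τ := by
    refine hθe.eventually_nhds.and ((hpt.eventually (hF.contDiffAt.eventually (by simp))).and
      ((hpt.eventually hF.rel.eventually_nhds).and
      ((hpt.eventually (eventually_isUnit_comp hF.contDiffAt hπ)).and
      ((hpt.eventually (eventually_invertible_inr hF)).and
      ((hc.eventually (by simp)).and ((hθs.eventually (by simp)).and
        (hgs.eventually (by simp))))))))
  obtain ⟨δ', hδ', hall⟩ := Metric.eventually_nhds_iff_ball.1 hall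
  set δ := min δ' ε with hδ
  have hδ0 : 0 < δ := lt_min hδ' hε
  replace hall := fun τ (hτ : τ ∈ Ico 0 δ) => hall τ (by
    rw [Metric.mem_ball, Real.dist_eq, sub_zero, abs_of_nonneg hτ.1]
    exact hτ.2.trans_le (min_le_left _ _))
  have hderD : ∀ τ ∈ D, τ ∈ Ioo 0 δ → deriv g τ = 0 := by
    intro τ hτD hτ
    obtain ⟨h1, h2, h3, ⟨e, he⟩, h5, h6, h7, -⟩ := hall τ ⟨hτ.1.le, hτ.2⟩
    have hτε : τ ∈ Ioo 0 ε := ⟨hτ.1, hτ.2.trans_le (min_le_right _ _)⟩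
    set q := (θ τ, c τ) with hq
    have hF' := (h2.differentiableAt one_ne_zero).hasFDerivAt
    have hgd : HasDerivAt g (fderiv ℝ F q (deriv θ τ, deriv c τ)) τ :=
      HasFDerivAt.comp_hasDerivAt (f := fun τ => (θ τ, c τ)) τ hF'
        ((h7.differentiableAt one_ne_zero).hasDerivAt.prodMk
          (h6.differentiableAt one_ne_zero).hasDerivAt)
    rw [hgd.deriv]
    set w := fderiv ℝ F q (deriv θ τ, deriv c τ) with hw
    have hπw : π w = 0 := by
      have k1 : HasDerivAt (fun σ => π (g σ)) (π w) τ := π.hasFDerivAt.comp_hasDerivAt τ hgd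
      have k2 : HasDerivAt (fun σ => π (g σ)) 0 τ :=
        (hasDerivAt_const τ (Q (0, 0))).congr_of_eventuallyEq h1
      exact k1.unique k2
    have hψd : HasFDerivAt (fun y => F (θ τ, y)) ((fderiv ℝ F q) ∘L .inr ℝ (Fin n → ℝ) E) (c τ) :=
      HasFDerivAt.comp (g := F) (c τ) hF' (hasFDerivAt_prodMk_right (θ τ) (c τ))
    have hψ : ContDiffAt ℝ 1 (fun y => F (θ τ, y)) (c τ) :=
      ContDiffAt.comp (f := fun y => (θ τ, y)) (c τ) h2 (by fun_prop)
    have hψi : (fderiv ℝ (fun y => F (θ τ, y)) (c τ)).IsInvertible := by rwa [hψd.fderiv]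
    have hψr : ∀ᶠ y in 𝓝 (c τ), r (F (θ τ, y)) y :=
      ((Continuous.prodMk_right (θ τ)).tendsto (c τ)).eventually h3
    have hwmem : w ∈ orbitTangent r (g τ) := by
      have k1 := fderiv_inl_mem_orbitTangent h2 h5 h3 (deriv θ τ)
      have k2 := fderiv_mem_orbitTangent hψ hψi hψr (htan τ hτD hτε)
      rw [hψd.fderiv] at k2
      have k3 : w = fderiv ℝ F q (deriv θ τ, 0) + fderiv ℝ F q (0, deriv c τ) := by
        rw [← map_add]; simp [hw]
      rw [k3]
      exact add_mem k1 (by simpa using k2)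
    have hrk : orbitRank r (g τ) ≤ n := by
      have k1 : orbitRank r (g τ) = orbitRank r (c τ) := orbitRank_eq hψ hψi hψr
      rw [k1]
      exact hrank τ hτD hτε
    -- the parameter derivatives of `F` span the tangent space of the relation at `g τ`
    set A : (Fin n → ℝ) →ₗ[ℝ] E := (fderiv ℝ F q ∘L .inl ℝ _ E).toLinearMap with hA
    have hAe : ∀ a, e a = π (A a) := fun a => DFunLike.congr_fun he a
    have hAinj : Function.Injective A := by
      intro a b hab
      apply e.injective
      rw [hAe, hAe, hab]
    have hAle : LinearMap.range A ≤ orbitTangent r (g τ) := by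
      rintro _ ⟨v, rfl⟩
      exact fderiv_inl_mem_orbitTangent h2 h5 h3 v
    have hAeq : LinearMap.range A = orbitTangent r (g τ) := by
      apply Submodule.eq_of_le_of_finrank_le hAle
      rw [LinearMap.finrank_range_of_inj hAinj, Module.finrank_fin_fun]
      exact hrk
    rw [← hAeq] at hwmem
    obtain ⟨ξ, hξ⟩ := hwmem
    rw [← hξ, ← hAe] at hπw
    rw [← hξ, (map_eq_zero_iff e e.injective).1 hπw, map_zero]
  -- the derivative of `g` is continuous and vanishes on a dense set
  have hder0 : ∀ τ ∈ Ico 0 δ, deriv g τ = 0 := by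
    intro τ hτ
    by_contra hne
    have hcont : ContinuousAt (deriv g) τ := by
      have h1 := (hall τ hτ).2.2.2.2.2.2.2
      have h2 := (h1.fderiv_right (m := 0) (by norm_num)).continuousAt
      have h3 : deriv g = fun σ => fderiv ℝ g σ 1 := by ext σ; simp
      rw [h3]
      exact h2.clm_apply continuousAt_const
    have hev : ∀ᶠ σ in 𝓝 τ, deriv g σ ≠ 0 := hcont.eventually_ne hne
    obtain ⟨ρ, hρ, hball⟩ := Metric.eventually_nhds_iff_ball.1 hev
    obtain ⟨σ, hσ1, hσD⟩ := hD.inter_open_nonempty (Ioo τ (min (τ + ρ) δ)) isOpen_Ioo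
      (nonempty_Ioo.2 (lt_min (by linarith) hτ.2))
    rw [mem_Ioo, lt_min_iff] at hσ1
    refine hball σ ?_ (hderD σ hσD ⟨hτ.1.trans_lt hσ1.1, hσ1.2.2⟩)
    rw [Metric.mem_ball, Real.dist_eq, abs_of_pos (by linarith)]
    linarith [hσ1.2.1]
  filter_upwards [Ioo_mem_nhdsGT hδ0] with τ hτ
  have hgd : ∀ σ ∈ Icc 0 τ, DifferentiableAt ℝ g σ := fun σ hσ =>
    (hall σ ⟨hσ.1, hσ.2.trans_lt hτ.2⟩).2.2.2.2.2.2.2.differentiableAt one_ne_zero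
  have hconst := constant_of_has_deriv_right_zero (f := g) (a := 0) (b := τ)
    (fun σ hσ => (hgd σ hσ).continuousAt.continuousWithinAt) (fun σ hσ => by
      have h1 := (hgd σ ⟨hσ.1, hσ.2.le⟩).hasDerivAt
      rw [hder0 σ ⟨hσ.1, hσ.2.trans hτ.2⟩] at h1
      exact h1.hasDerivWithinAt) τ ⟨hτ.1.le, le_rfl⟩
  have h3 : r (g τ) (c τ) := (hall τ ⟨hτ.1.le, hτ.2⟩).2.2.1.self_of_nhds
  rw [hconst, hg0] at h3
  exact r.symm h3

/-- Let `ψ` be a local diffeomorphism at `x 0` and let the curve `x` be tangent to the relation. If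
`ψ` preserves the classes near `x τ` for a dense set of small positive times `τ`, then it also maps
the class of the points `x τ` to the class of `ψ (x 0)`, although it need not preserve the class of
the point `x 0` itself. -/
theorem rel_of_transport {x : ℝ → E} (hx : ContDiffAt ℝ 1 x 0) {ψ : E → E}
    (hψ : ContDiffAt ℝ 1 ψ (x 0)) (hinv : (fderiv ℝ ψ (x 0)).IsInvertible)
    {D : Set ℝ} (hD : Dense D) {ε : ℝ} (hε : 0 < ε)
    (hpres : ∀ τ ∈ D, τ ∈ Ioo 0 ε → ∀ᶠ y in 𝓝 (x τ), r (ψ y) y)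
    (hrank : ∀ τ ∈ D, τ ∈ Ioo 0 ε → orbitRank r (x τ) ≤ orbitRank r (ψ (x 0)))
    (htan : ∀ τ ∈ D, τ ∈ Ioo 0 ε → deriv x τ ∈ orbitTangent r (x τ)) :
    ∃ᶠ τ in 𝓝[>] (0 : ℝ), r (x τ) (ψ (x 0)) := by
  have hcomp : CompleteSpace E := FiniteDimensional.complete ℝ E
  obtain ⟨e, he⟩ := hinv
  have hnear : ∀ᶠ τ in 𝓝 0, ContDiffAt ℝ 1 ψ (x τ) ∧ (fderiv ℝ ψ (x τ)).IsInvertible ∧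
      DifferentiableAt ℝ x τ := by
    have h1 := hx.continuousAt.tendsto.eventually (hψ.eventually (by simp))
    have h2 := (hψ.fderiv_right (m := 0) (by norm_num)).continuousAt.tendsto
    rw [← he] at h2
    have h3 := hx.continuousAt.tendsto.eventually (h2.eventually e.nhds)
    filter_upwards [h1, h3, hx.eventually (by simp)] with τ k1 ⟨e', he'⟩ k3
    exact ⟨k1, ⟨e', he'⟩, k3.differentiableAt one_ne_zero⟩
  obtain ⟨δ', hδ', hnear⟩ := Metric.eventually_nhds_iff_ball.1 hnear
  set δ := min δ' ε with hδ
  have hδ0 : 0 < δ := lt_min hδ' hε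
  have hsub : ∀ τ ∈ Ioo 0 δ, τ ∈ Ioo 0 ε := fun τ hτ => ⟨hτ.1, hτ.2.trans_le (min_le_right _ _)⟩
  replace hnear := fun τ (hτ : τ ∈ Ioo 0 δ) => hnear τ (by
    rw [Metric.mem_ball, Real.dist_eq, sub_zero, abs_of_pos hτ.1]
    exact hτ.2.trans_le (min_le_left _ _))
  -- at the times in `D` the image curve `ψ ∘ x` inherits tangency and rank from `x`
  have key := rel_of_tangent_curve (r := r) (c := fun τ => ψ (x τ))
    (ContDiffAt.comp (g := ψ) 0 hψ hx) hD hδ0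
    (fun τ hτD hτ => by
      obtain ⟨k1, k2, -⟩ := hnear τ hτ
      rw [orbitRank_eq k1 k2 (hpres τ hτD (hsub τ hτ))]
      exact hrank τ hτD (hsub τ hτ))
    (fun τ hτD hτ => by
      obtain ⟨k1, k2, k3⟩ := hnear τ hτ
      have k4 := (k1.differentiableAt one_ne_zero).hasFDerivAt.comp_hasDerivAt τ k3.hasDerivAt
      have k5 : deriv (fun τ => ψ (x τ)) τ = _ := k4.deriv
      rw [k5]
      exact fderiv_mem_orbitTangent k1 k2 (hpres τ hτD (hsub τ hτ)) (htan τ hτD (hsub τ hτ)))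
  have hfreq : ∃ᶠ τ in 𝓝[>] (0 : ℝ), τ ∈ D ∧ τ ∈ Ioo 0 δ := by
    rw [frequently_nhdsWithin_iff, Metric.nhds_basis_ball.frequently_iff]
    intro ρ hρ
    obtain ⟨σ, hσ1, hσD⟩ := hD.inter_open_nonempty (Ioo 0 (min ρ δ)) isOpen_Ioo
      (nonempty_Ioo.2 (lt_min hρ hδ0))
    rw [mem_Ioo, lt_min_iff] at hσ1
    refine ⟨σ, ?_, ⟨hσD, hσ1.1, hσ1.2.2⟩, hσ1.1⟩
    rw [Metric.mem_ball, Real.dist_eq, sub_zero, abs_of_pos hσ1.1]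
    exact hσ1.2.1
  refine (hfreq.and_eventually key).mono ?_
  rintro τ ⟨⟨h1, h2⟩, h3⟩
  exact r.trans (r.symm (hpres τ h1 (hsub τ h2)).self_of_nhds) h3

end Curves

/-! ### Vector fields preserving an equivalence relation -/

section Preserves

variable {E : Type*} [NormedAddCommGroup E] [NormedSpace ℝ E]

/-- Near `y` the integral curves of the vector field `L` stay in their classes for `r`. -/
def PreservesAt (r : Setoid E) (L : E → E) (y : E) : Prop :=
  ∃ O ∈ 𝓝 y, ∀ (γ : ℝ → E) (a b : ℝ), (∀ t ∈ Ioo a b, HasDerivAt γ (L (γ t)) t ∧ γ t ∈ O) →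
    ∀ s ∈ Ioo a b, ∀ t ∈ Ioo a b, r (γ s) (γ t)

variable {r : Setoid E} {L : E → E} {y z : E}

lemma PreservesAt.eventually (h : PreservesAt r L y) : ∀ᶠ x in 𝓝 y, PreservesAt r L x := by
  obtain ⟨O, hO, h⟩ := h
  exact (eventually_mem_nhds_iff.2 hO).mono fun x hx => ⟨O, hx, h⟩

lemma PreservesAt.eventually_rel (h : PreservesAt r L y) {γ : ℝ → E} {t : ℝ} (hγt : γ t = y)
    (hγ : ∀ᶠ s in 𝓝 t, HasDerivAt γ (L (γ s)) s) : ∀ᶠ s in 𝓝 t, r (γ s) y := by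
  obtain ⟨O, hO, h⟩ := h
  have hc : ContinuousAt γ t := hγ.self_of_nhds.continuousAt
  have hO' : ∀ᶠ s in 𝓝 t, γ s ∈ O := hc.tendsto (by rwa [hγt])
  obtain ⟨ε, hε, hb⟩ := Metric.eventually_nhds_iff_ball.1 (hγ.and hO')
  rw [Real.ball_eq_Ioo] at hb
  have ht : t ∈ Ioo (t - ε) (t + ε) := ⟨by linarith, by linarith⟩
  filter_upwards [Ioo_mem_nhds ht.1 ht.2] with s hs
  have := h γ (t - ε) (t + ε) hb s hs t ht
  rwa [hγt] at this

omit [NormedAddCommGroup E] [NormedSpace ℝ E] in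
/-- A curve whose points are locally equivalent to each other stays in one class. -/
lemma rel_of_eventually_rel {γ : ℝ → E} {J : Set ℝ} (hJ : IsPreconnected J)
    (h : ∀ t ∈ J, ∀ᶠ s in 𝓝 t, r (γ s) (γ t)) {s t : ℝ} (hs : s ∈ J) (ht : t ∈ J) :
    r (γ s) (γ t) := by
  refine hJ.induction₂ (fun a b => r (γ a) (γ b)) ?_ (fun _ _ _ _ _ _ => r.trans)
    (fun _ _ _ _ => r.symm) hs ht
  intro a ha
  exact ((h a ha).filter_mono nhdsWithin_le_nhds).mono fun b hb => r.symm hb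

lemma rel_of_integralCurve {γ : ℝ → E} {J : Set ℝ} (hJ : IsPreconnected J)
    (h : ∀ t ∈ J, (∀ᶠ s in 𝓝 t, HasDerivAt γ (L (γ s)) s) ∧ PreservesAt r L (γ t))
    {s t : ℝ} (hs : s ∈ J) (ht : t ∈ J) : r (γ s) (γ t) :=
  rel_of_eventually_rel hJ (fun t ht => (h t ht).2.eventually_rel rfl (h t ht).1) hs ht

/-- To see that integral curves near `y` stay in their classes it suffices that each of them does so
for a short time. -/
lemma preservesAt_of_eventually (h : ∀ᶠ x in 𝓝 y, ∀ γ : ℝ → E, γ 0 = x →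
    (∀ᶠ t in 𝓝 0, HasDerivAt γ (L (γ t)) t) → ∀ᶠ t in 𝓝 0, r (γ t) x) : PreservesAt r L y := by
  refine ⟨_, h, fun γ a b hγ s hs t ht => ?_⟩
  refine rel_of_eventually_rel (J := Ioo a b) isPreconnected_Ioo ?_ hs ht
  intro σ hσ
  have htr : Tendsto (fun u => u + σ) (𝓝 0) (𝓝 σ) := by
    have : Continuous (fun u : ℝ => u + σ) := by fun_prop
    simpa using this.tendsto 0
  have h1 := (hγ σ hσ).2 (fun u => γ (u + σ)) (by simp) (by
    filter_upwards [htr.eventually (Ioo_mem_nhds hσ.1 hσ.2)] with u hu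
    exact (hγ _ hu).1.comp_add_const u σ)
  have htr2 : Tendsto (fun u => u - σ) (𝓝 σ) (𝓝 0) := by
    have : Continuous (fun u : ℝ => u - σ) := by fun_prop
    simpa using this.tendsto σ
  filter_upwards [htr2.eventually h1] with u hu
  simpa using hu

section FlowBoxes

variable {Φ : ℝ × E → E} {ε : ℝ}

lemma IsFlowBox.eventually_hasDerivAt (h : IsFlowBox L Φ z ε) {t : ℝ} {x : E} (ht : |t| < ε)
    (hx : dist x z < ε) : ∀ᶠ s in 𝓝 t, HasDerivAt (fun s => Φ (s, x)) (L (Φ (s, x))) s := by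
  have ht' := abs_lt.1 ht
  filter_upwards [Ioo_mem_nhds ht'.1 ht'.2] with s hs
  exact h.hasDerivAt s x (abs_lt.2 hs) hx

lemma IsFlowBox.rel (h : IsFlowBox L Φ z ε) {t : ℝ} {x : E} (ht : |t| < ε) (hx : dist x z < ε)
    (hp : ∀ s ∈ uIcc 0 t, PreservesAt r L (Φ (s, x))) : r (Φ (t, x)) x := by
  have hε := h.pos
  have h1 := rel_of_integralCurve (r := r) (L := L) (γ := fun s => Φ (s, x)) (J := uIcc 0 t)
    isPreconnected_uIcc (fun s hs => ⟨h.eventually_hasDerivAt ?_ hx, hp s hs⟩)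
    (right_mem_uIcc (a := 0) (b := t)) left_mem_uIcc
  · simpa only [h.zero x hx] using h1
  · have h2 : |s - 0| ≤ |t - 0| := abs_sub_left_of_mem_uIcc hs
    simp only [sub_zero] at h2
    exact h2.trans_lt ht

lemma IsFlowBox.eventually_rel (h : IsFlowBox L Φ z ε) {t : ℝ} {x : E} (ht : |t| < ε)
    (hx : dist x z < ε) (hp : ∀ s ∈ uIcc 0 t, PreservesAt r L (Φ (s, x))) :
    ∀ᶠ p in 𝓝 (t, x), r (Φ p) p.2 := by
  have hmul : ∀ s ∈ Icc (0 : ℝ) 1, ∀ t : ℝ, s * t ∈ uIcc 0 t := by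
    intro s hs t
    rcases le_total 0 t with h0 | h0
    · rw [uIcc_of_le h0]
      exact ⟨mul_nonneg hs.1 h0, mul_le_of_le_one_left h0 hs.2⟩
    · rw [uIcc_of_ge h0]
      exact ⟨by nlinarith [hs.2], mul_nonpos_of_nonneg_of_nonpos hs.1 h0⟩
  have habs : ∀ s ∈ Icc (0 : ℝ) 1, |s * t| < ε := by
    intro s hs
    rw [abs_mul, abs_of_nonneg hs.1]
    exact (mul_le_of_le_one_left (abs_nonneg t) hs.2).trans_lt ht
  have h1 : ∀ᶠ p in 𝓝 (t, x), ∀ s ∈ Icc (0 : ℝ) 1, PreservesAt r L (Φ (s * p.1, p.2)) := by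
    refine isCompact_Icc.eventually_forall_of_forall_eventually fun s hs => ?_
    have h2 := (hp _ (hmul s hs t)).eventually
    have h3 : ContinuousAt (fun q : (ℝ × E) × ℝ => Φ (q.2 * q.1.1, q.1.2)) ((t, x), s) := by
      have h4 : ContinuousAt Φ ((fun q : (ℝ × E) × ℝ => (q.2 * q.1.1, q.1.2)) ((t, x), s)) :=
        h.continuousAt (habs s hs) hx
      exact h4.comp (f := fun q : (ℝ × E) × ℝ => (q.2 * q.1.1, q.1.2)) (by fun_prop)
    exact h3.tendsto.eventually h2
  have h5 : ∀ᶠ p : ℝ × E in 𝓝 (t, x), |p.1| < ε :=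
    (continuous_fst.abs.tendsto (t, x)).eventually (gt_mem_nhds ht)
  have h6 : ∀ᶠ p : ℝ × E in 𝓝 (t, x), dist p.2 z < ε :=
    ((continuous_snd.dist continuous_const).tendsto (t, x)).eventually (gt_mem_nhds hx)
  filter_upwards [h1, h5, h6] with p k1 k2 k3
  refine h.rel (t := p.1) (x := p.2) k2 k3 fun s hs => ?_
  by_cases h0 : p.1 = 0
  · rw [h0, uIcc_self, mem_singleton_iff] at hs
    have := k1 0 ⟨le_rfl, zero_le_one⟩
    rwa [zero_mul, ← hs] at this
  · have hs' : s / p.1 ∈ Icc (0 : ℝ) 1 := by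
      rcases lt_or_gt_of_ne h0 with h0 | h0
      · rw [uIcc_of_ge h0.le] at hs
        exact ⟨div_nonneg_of_nonpos hs.2 h0.le, by rw [div_le_one_of_neg h0]; exact hs.1⟩
      · rw [uIcc_of_le h0.le] at hs
        exact ⟨div_nonneg hs.1 h0.le, by rw [div_le_one h0]; exact hs.2⟩
    have := k1 _ hs'
    rwa [div_mul_cancel₀ _ h0] at this

lemma IsFlowBox.eventually_rel_map (h : IsFlowBox L Φ z ε) {t : ℝ} {x : E} (ht : |t| < ε)
    (hx : dist x z < ε) (hp : ∀ s ∈ uIcc 0 t, PreservesAt r L (Φ (s, x))) :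
    ∀ᶠ y in 𝓝 x, r (Φ (t, y)) y :=
  ((Continuous.prodMk_right t).tendsto x).eventually (h.eventually_rel ht hx hp)

lemma IsFlowBox.contDiffAt_map (h : IsFlowBox L Φ z ε) {t : ℝ} {x : E} (ht : |t| < ε)
    (hx : dist x z < ε) : ContDiffAt ℝ 1 (fun y => Φ (t, y)) x :=
  ContDiffAt.comp (f := fun y => (t, y)) x (h.contDiffAt t x ht hx) (by fun_prop)

lemma IsFlowBox.contDiffAt_curve (h : IsFlowBox L Φ z ε) {t : ℝ} {x : E} (ht : |t| < ε)
    (hx : dist x z < ε) : ContDiffAt ℝ 1 (fun s => Φ (s, x)) t :=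
  ContDiffAt.comp (f := fun s => (s, x)) t (h.contDiffAt t x ht hx) (by fun_prop)

lemma IsFlowBox.invertible_map (h : IsFlowBox L Φ z ε) {t : ℝ} {x : E} (ht : |t| < ε)
    (hx : dist x z < ε) : (fderiv ℝ (fun y => Φ (t, y)) x).IsInvertible := by
  rw [(h.hasFDerivAt ht hx).fderiv]
  exact h.invertible t x ht hx

variable [FiniteDimensional ℝ E]

lemma IsFlowBox.orbitRank_eq (h : IsFlowBox L Φ z ε) {t : ℝ} {x : E} (ht : |t| < ε)
    (hx : dist x z < ε) (hp : ∀ s ∈ uIcc 0 t, PreservesAt r L (Φ (s, x))) :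
    orbitRank r (Φ (t, x)) = orbitRank r x :=
  OrbitDecomposition.orbitRank_eq (h.contDiffAt_map ht hx) (h.invertible_map ht hx)
    (h.eventually_rel_map ht hx hp)

/-- A vector field whose integral curves stay in their classes is tangent to the relation. -/
lemma IsFlowBox.mem_orbitTangent (h : IsFlowBox L Φ z ε) {t : ℝ} {x : E} (ht : |t| < ε)
    (hx : dist x z < ε) (hp : ∀ s ∈ uIcc 0 t, PreservesAt r L (Φ (s, x))) :
    deriv (fun s => Φ (s, x)) t ∈ orbitTangent r (Φ (t, x)) := by
  have h1 := fderiv_inl_mem_orbitTangent (r := r) (h.contDiffAt t x ht hx)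
    (h.invertible t x ht hx) (h.eventually_rel ht hx hp) 1
  have h2 := ((h.contDiffAt t x ht hx).differentiableAt one_ne_zero).hasFDerivAt
  have h3 : HasDerivAt (fun s : ℝ => (s, x)) ((1, 0) : ℝ × E) t :=
    (hasDerivAt_id t).prodMk (hasDerivAt_const t x)
  have h4 : HasDerivAt (fun s => Φ (s, x)) _ t :=
    HasFDerivAt.comp_hasDerivAt (f := fun s : ℝ => (s, x)) t h2 h3
  rwa [h4.deriv]

end FlowBoxes

/-- A version of Sard's theorem: if `h s` is expanding for each `s`, then for a dense set of `τ` the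
function `s ↦ h s τ` has only simple zeros. The zeros form a graph `τ = q s`, and the values of `τ`
at the multiple zeros are critical values of `q`. -/
lemma dense_compl_multiple_zeros {h : ℝ → ℝ → ℝ} {A B : Set ℝ} {κ : ℝ} (hκ : 0 < κ)
    (hexp : ∀ s ∈ A, ∀ τ ∈ B, ∀ τ' ∈ B, κ * |τ - τ'| ≤ |h s τ - h s τ'|) :
    Dense {τ | τ ∈ B ∧ ∃ s ∈ A, h s τ = 0 ∧ HasDerivAt (fun σ => h σ τ) 0 s}ᶜ := by
  classical
  set S := {s | s ∈ A ∧ ∃ τ ∈ B, h s τ = 0 ∧ HasDerivAt (fun σ => h σ τ) 0 s} with hS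
  choose! q hqB hq0 hqd using fun s (hs : s ∈ S) => hs.2
  -- at a multiple zero, `h` vanishes to second order in `s`, hence so does `q` by expansion in `τ`
  have hqder : ∀ s ∈ S, HasFDerivWithinAt q (0 : ℝ →L[ℝ] ℝ) S s := by
    intro s hs
    rw [hasFDerivWithinAt_iff_isLittleO, Asymptotics.isLittleO_iff]
    intro c hc
    have h1 := (hqd s hs).isLittleO
    rw [Asymptotics.isLittleO_iff] at h1
    filter_upwards [(h1 (c := κ * c) (by positivity)).filter_mono nhdsWithin_le_nhds,
      self_mem_nhdsWithin] with s' k1 k2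
    have k3 := hexp s' k2.1 (q s') (hqB s' k2) (q s) (hqB s hs)
    simp only [hq0 s hs, hq0 s' k2, smul_zero, sub_zero, zero_sub, abs_neg, Real.norm_eq_abs]
      at k1 k3
    simp only [zero_apply, sub_zero, Real.norm_eq_abs]
    have k4 : κ * |q s' - q s| ≤ κ * (c * |s' - s|) := by linarith
    exact le_of_mul_le_mul_left k4 hκ
  have hnull := MeasureTheory.addHaar_image_eq_zero_of_det_fderivWithin_eq_zero
    MeasureTheory.volume hqder
    (fun s _ => by simp [ContinuousLinearMap.det])
  have hsub : {τ | τ ∈ B ∧ ∃ s ∈ A, h s τ = 0 ∧ HasDerivAt (fun σ => h σ τ) 0 s} ⊆ q '' S := by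
    rintro τ ⟨hτ, s, hs, h0, hd⟩
    have hsS : s ∈ S := ⟨hs, τ, hτ, h0, hd⟩
    refine ⟨s, hsS, ?_⟩
    have k1 := hexp s hs (q s) (hqB s hsS) τ hτ
    rw [hq0 s hsS, h0, sub_zero, abs_zero] at k1
    have k2 : |q s - τ| ≤ 0 := by
      by_contra hne
      push Not at hne
      nlinarith [mul_pos hκ hne]
    linarith [abs_nonpos_iff.1 k2]
  have := MeasureTheory.measure_mono_null hsub hnull
  exact MeasureTheory.Measure.dense_of_ae (μ := MeasureTheory.volume)
    (p := fun τ => τ ∈ {τ | τ ∈ B ∧ ∃ s ∈ A, h s τ = 0 ∧ HasDerivAt (fun σ => h σ τ) 0 s}ᶜ)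
    (MeasureTheory.measure_eq_zero_iff_ae_notMem.1 this)

end Preserves

/-! ### Curves leaving a subspace -/

section Leaving

variable {E : Type*} [NormedAddCommGroup E] [NormedSpace ℝ E]

/-- The vector field `L` is near `y` a `C^1` section of the family `K` of subspaces. -/
def IsSectionAt (K : E → Submodule ℝ E) (L : E → E) (y : E) : Prop :=
  ContDiffAt ℝ 1 L y ∧ ∀ᶠ x in 𝓝 y, L x ∈ K x

/-- Near `z`, the sections of `K` preserve the classes at the points outside `S`. -/
def PreservedOff (K : E → Submodule ℝ E) (r : Setoid E) (S : Set E) (z : E) : Prop :=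
  ∀ᶠ y in 𝓝 z, y ∉ S → ∀ L, IsSectionAt K L y → PreservesAt r L y

/-- The integral curve of `L` starting at `y` immediately enters the class of `c`. The point `y`
itself need not belong to that class. -/
def LeavesTo (r : Setoid E) (L : E → E) (y c : E) : Prop :=
  ∀ γ : ℝ → E, γ 0 = y → (∀ᶠ t in 𝓝 0, HasDerivAt γ (L (γ t)) t) → ∀ᶠ t in 𝓝[>] 0, r (γ t) c

/-- All integral curves of sections of `K` that cross the subspace `F` at `y` transversally belong
near `y` to the class of `c`. As `-L` is a section when `L` is, both branches of the curves are
covered. -/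
def CrossesTo (F : Submodule ℝ E) (K : E → Submodule ℝ E) (r : Setoid E) (y c : E) : Prop :=
  ∀ L, IsSectionAt K L y → L y ∉ F → LeavesTo r L y c

variable {K : E → Submodule ℝ E} {F : Submodule ℝ E} {r : Setoid E} {L : E → E} {S : Set E}
  {y z c : E}

lemma IsSectionAt.eventually (h : IsSectionAt K L y) : ∀ᶠ x in 𝓝 y, IsSectionAt K L x :=
  (h.1.eventually (by simp)).and h.2.eventually_nhds

lemma IsSectionAt.neg (h : IsSectionAt K L y) : IsSectionAt K (fun x => -L x) y :=
  ⟨h.1.neg, h.2.mono fun _ hx => neg_mem hx⟩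

lemma PreservedOff.eventually (h : PreservedOff K r S z) : ∀ᶠ x in 𝓝 z, PreservedOff K r S x :=
  h.eventually_nhds

section FlowBoxes

variable {Φ : ℝ × E → E} {ε : ℝ}

/-- Integral curves are given by local flows. -/
lemma IsFlowBox.eventually_eq (h : IsFlowBox L Φ z ε) {x : E} (hx : dist x z < ε) {γ : ℝ → E}
    (h0 : γ 0 = x) (hγ : ∀ᶠ t in 𝓝 0, HasDerivAt γ (L (γ t)) t) : ∀ᶠ t in 𝓝 0, γ t = Φ (t, x) := by
  have hc : ContinuousAt γ 0 := hγ.self_of_nhds.continuousAt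
  have h1 : ∀ᶠ t in 𝓝 0, dist (γ t) z < ε :=
    (Tendsto.dist hc.tendsto tendsto_const_nhds).eventually (gt_mem_nhds (by rwa [h0]))
  obtain ⟨δ, hδ, hb⟩ := Metric.eventually_nhds_iff_ball.1 (hγ.and h1)
  rw [Real.ball_zero_eq_Ioo] at hb
  filter_upwards [Ioo_mem_nhds (neg_neg_of_pos hδ) hδ,
    Ioo_mem_nhds (neg_neg_of_pos h.pos) h.pos] with t ht ht'
  have := h.unique γ (-δ) δ 0 ⟨neg_neg_of_pos hδ, hδ⟩ hb t ht (by rw [sub_zero]; exact abs_lt.2 ht')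
  rwa [sub_zero, h0] at this

lemma IsFlowBox.leavesTo_iff (h : IsFlowBox L Φ z ε) {x : E} (hx : dist x z < ε) :
    LeavesTo r L x c ↔ ∀ᶠ t in 𝓝[>] 0, r (Φ (t, x)) c := by
  refine ⟨fun h1 => h1 (fun t => Φ (t, x)) (h.zero x hx)
    (h.eventually_hasDerivAt (by simpa using h.pos) hx), fun h1 γ h0 hγ => ?_⟩
  filter_upwards [h1, (h.eventually_eq hx h0 hγ).filter_mono nhdsWithin_le_nhds] with t h2 h3
  rwa [h3]

end FlowBoxes

variable [FiniteDimensional ℝ E]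

lemma PreservesAt.mem_orbitTangent (h : PreservesAt r L y) (hL : ContDiffAt ℝ 1 L y) :
    L y ∈ orbitTangent r y := by
  obtain ⟨Φ, ε, hΦ⟩ := exists_isFlowBox hL
  have h1 := hΦ.mem_orbitTangent (r := r) (t := 0) (x := y) (by simpa using hΦ.pos)
    (by simpa using hΦ.pos) (fun s hs => by
      rw [uIcc_self, mem_singleton_iff] at hs
      rwa [hs, hΦ.zero_self])
  rwa [(hΦ.hasDerivAt 0 y (by simpa using hΦ.pos) (by simpa using hΦ.pos)).deriv,
    hΦ.zero_self] at h1

/-- The rank of a relation is constant along integral curves that stay in their classes. -/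
lemma orbitRank_eq_of_integralCurve {γ : ℝ → E} {J : Set ℝ} (hJ : IsPreconnected J)
    (h : ∀ t ∈ J, (∀ᶠ s in 𝓝 t, HasDerivAt γ (L (γ s)) s) ∧ PreservesAt r L (γ t) ∧
      ContDiffAt ℝ 1 L (γ t)) {s t : ℝ} (hs : s ∈ J) (ht : t ∈ J) :
    orbitRank r (γ s) = orbitRank r (γ t) := by
  refine hJ.induction₂ (fun a b => orbitRank r (γ a) = orbitRank r (γ b)) ?_
    (fun _ _ _ _ _ _ => Eq.trans) (fun _ _ _ _ => Eq.symm) hs ht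
  intro a ha
  refine Eventually.filter_mono nhdsWithin_le_nhds ?_
  obtain ⟨h1, h2, h3⟩ := h a ha
  obtain ⟨Φ, ε, hΦ⟩ := exists_isFlowBox h3
  obtain ⟨δ, hδ, hδε, hδ0⟩ := ((hΦ.eventually_mem h2.eventually).and
    (hΦ.eventually_mono.and self_mem_nhdsWithin)).exists
  have htr : Tendsto (fun u => u + a) (𝓝 0) (𝓝 a) := by
    have : Continuous (fun u : ℝ => u + a) := by fun_prop
    simpa using this.tendsto 0
  have htr2 : Tendsto (fun u => u - a) (𝓝 a) (𝓝 0) := by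
    have : Continuous (fun u : ℝ => u - a) := by fun_prop
    simpa using this.tendsto a
  have hδ0' : 0 < δ := hδ0
  have hself : dist (γ a) (γ a) < δ := by simpa using hδ0'
  have h4 := hδε.eventually_eq hself (γ := fun u => γ (u + a)) (by simp) (by
    filter_upwards [htr.eventually h1] with u hu
    exact hu.comp_add_const u a)
  filter_upwards [htr2.eventually h4,
    htr2.eventually (Ioo_mem_nhds (neg_neg_of_pos hδ0') hδ0')] with b hb hbδ
  simp only [sub_add_cancel] at hb
  rw [hb]
  symm
  refine hδε.orbitRank_eq (abs_lt.2 hbδ) hself fun u hu => hδ u _ ?_ hself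
  have h2 : |u - 0| ≤ |b - a - 0| := abs_sub_left_of_mem_uIcc hu
  simp only [sub_zero] at h2
  exact h2.trans_lt (abs_lt.2 hbδ)

/-- `Φ` is a local flow of a vector field along which the linear form `ℓ` increases, and the field
preserves the classes of `r` at the points outside the kernel of `ℓ`. -/
structure IsTransverseBox (r : Setoid E) (ℓ : E →L[ℝ] ℝ) (L : E → E) (Φ : ℝ × E → E) (z : E)
    (ε : ℝ) : Prop extends IsFlowBox L Φ z ε where
  speed : ∀ t x, |t| < ε → dist x z < ε → 0 < ℓ (L (Φ (t, x)))
  smooth : ∀ t x, |t| < ε → dist x z < ε → ContDiffAt ℝ 1 L (Φ (t, x))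
  preserves : ∀ t x, |t| < ε → dist x z < ε → ℓ (Φ (t, x)) ≠ 0 → PreservesAt r L (Φ (t, x))

variable {ℓ : E →L[ℝ] ℝ} {Φ : ℝ × E → E} {ε : ℝ}

omit [FiniteDimensional ℝ E] in
lemma IsFlowBox.eventually_isTransverseBox (h : IsFlowBox L Φ z ε) (hoff : PreservedOff K r F z)
    (hF : ∀ v ∈ F, ℓ v = 0) (hL : IsSectionAt K L z) (hpos : 0 < ℓ (L z)) :
    ∀ᶠ δ in 𝓝[>] (0 : ℝ), IsTransverseBox r ℓ L Φ z δ := by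
  have h1 : ∀ᶠ y in 𝓝 z, 0 < ℓ (L y) :=
    (ℓ.continuous.continuousAt.comp hL.1.continuousAt).tendsto.eventually (lt_mem_nhds hpos)
  filter_upwards [h.eventually_mono, h.eventually_mem h1, h.eventually_mem hL.eventually,
    h.eventually_mem hoff] with δ k1 k2 k3 k4
  exact ⟨k1, k2, fun t x ht hx => (k3 t x ht hx).1,
    fun t x ht hx h0 => k4 t x ht hx (fun hmem => h0 (hF _ hmem)) L (k3 t x ht hx)⟩

namespace IsTransverseBox

variable (h : IsTransverseBox r ℓ L Φ z ε) {x : E} (hx : dist x z < ε)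
include h hx

omit [FiniteDimensional ℝ E] in
lemma strictMonoOn : StrictMonoOn (fun t => ℓ (Φ (t, x))) (Ioo (-ε) ε) := by
  have hd : ∀ t ∈ Ioo (-ε) ε, HasDerivAt (fun t => ℓ (Φ (t, x))) (ℓ (L (Φ (t, x)))) t :=
    fun t ht => ℓ.hasFDerivAt.comp_hasDerivAt t (h.hasDerivAt t x (abs_lt.2 ht) hx)
  refine strictMonoOn_of_deriv_pos (convex_Ioo _ _)
    (fun t ht => (hd t ht).continuousAt.continuousWithinAt) fun t ht => ?_
  rw [interior_Ioo] at ht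
  rw [(hd t ht).deriv]
  exact h.speed t x (abs_lt.2 ht) hx

omit [FiniteDimensional ℝ E] in
lemma apply_pos (h0 : 0 ≤ ℓ x) {t : ℝ} (ht : t ∈ Ioo 0 ε) : 0 < ℓ (Φ (t, x)) := by
  have h1 := h.strictMonoOn hx (a := 0) (b := t) ⟨neg_neg_of_pos h.pos,
    h.pos⟩ ⟨by linarith [ht.1, ht.2], ht.2⟩ ht.1
  simp only [h.zero x hx] at h1
  exact h0.trans_lt h1

omit [FiniteDimensional ℝ E] in
lemma preserves_of_nonneg (h0 : 0 ≤ ℓ x) {t : ℝ} (ht : t ∈ Ioo 0 ε) :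
    PreservesAt r L (Φ (t, x)) :=
  h.preserves t x (abs_lt.2 ⟨by linarith [ht.1, ht.2], ht.2⟩) hx (h.apply_pos hx h0 ht).ne'

omit [FiniteDimensional ℝ E] in
/-- After leaving the kernel of `ℓ` on its positive side the integral curve stays in one class. -/
lemma rel (h0 : 0 ≤ ℓ x) {s t : ℝ} (hs : s ∈ Ioo 0 ε) (ht : t ∈ Ioo 0 ε) :
    r (Φ (s, x)) (Φ (t, x)) :=
  rel_of_integralCurve (γ := fun t => Φ (t, x)) isPreconnected_Ioo
    (fun _ hu => ⟨h.eventually_hasDerivAt (abs_lt.2 ⟨by linarith [hu.1, hu.2], hu.2⟩) hx,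
      h.preserves_of_nonneg hx h0 hu⟩) hs ht

omit [FiniteDimensional ℝ E] in
lemma leavesTo (h0 : 0 ≤ ℓ x) {t : ℝ} (ht : t ∈ Ioo 0 ε) (hc : r (Φ (t, x)) c) :
    LeavesTo r L x c := by
  rw [h.leavesTo_iff hx]
  filter_upwards [Ioo_mem_nhdsGT h.pos] with s hs
  exact r.trans (h.rel hx h0 hs ht) hc

omit [FiniteDimensional ℝ E] in
lemma rel_of_leavesTo (h0 : 0 ≤ ℓ x) {t : ℝ} (ht : t ∈ Ioo 0 ε) (hc : LeavesTo r L x c) :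
    r (Φ (t, x)) c := by
  rw [h.leavesTo_iff hx] at hc
  obtain ⟨s, hs, hs'⟩ := (hc.and (Ioo_mem_nhdsGT h.pos)).exists
  exact r.trans (h.rel hx h0 ht hs') hs

lemma orbitRank_eq (h0 : 0 ≤ ℓ x) {s t : ℝ} (hs : s ∈ Ioo 0 ε) (ht : t ∈ Ioo 0 ε) :
    orbitRank r (Φ (s, x)) = orbitRank r (Φ (t, x)) :=
  orbitRank_eq_of_integralCurve (γ := fun t => Φ (t, x)) isPreconnected_Ioo
    (fun u hu => ⟨h.eventually_hasDerivAt (abs_lt.2 ⟨by linarith [hu.1, hu.2], hu.2⟩) hx,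
      h.preserves_of_nonneg hx h0 hu,
      h.smooth u x (abs_lt.2 ⟨by linarith [hu.1, hu.2], hu.2⟩) hx⟩) hs ht

lemma mem_orbitTangent (h0 : 0 ≤ ℓ x) {t : ℝ} (ht : t ∈ Ioo 0 ε) :
    deriv (fun s => Φ (s, x)) t ∈ orbitTangent r (Φ (t, x)) := by
  have ht' : |t| < ε := abs_lt.2 ⟨by linarith [ht.1, ht.2], ht.2⟩
  rw [(h.hasDerivAt t x ht' hx).deriv]
  exact (h.preserves_of_nonneg hx h0 ht).mem_orbitTangent (h.smooth t x ht' hx)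

omit [FiniteDimensional ℝ E] in
lemma preserves_uIcc (h0 : 0 < ℓ x) {t : ℝ} (ht : t ∈ Ico 0 ε) :
    ∀ s ∈ uIcc 0 t, PreservesAt r L (Φ (s, x)) := by
  intro s hs
  rw [uIcc_of_le ht.1] at hs
  rcases hs.1.eq_or_lt with h1 | h1
  · refine h.preserves s x (by rw [← h1]; simpa using h.pos) hx ?_
    rw [← h1, h.zero x hx]
    exact h0.ne'
  · exact h.preserves_of_nonneg hx h0.le ⟨h1, hs.2.trans_lt ht.2⟩

omit hx in
/-- The rank on the positive side at a point is at most the rank at the points of the positive side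
that accumulate at it. -/
lemma orbitRank_le_of_tendsto {α : Type*} {l : Filter α} {u : α → E} (hx : dist x z < ε)
    (h0 : 0 ≤ ℓ x) (hu : Tendsto u l (𝓝 x)) {n : ℕ} (hn : ∃ᶠ a in l, orbitRank r (u a) = n ∧
      ∀ s ∈ uIcc 0 (ε / 2), PreservesAt r L (Φ (s, u a))) {t : ℝ} (ht : t ∈ Ioo 0 ε) :
    orbitRank r (Φ (t, x)) ≤ n := by
  have hε := h.pos
  have hε2 : ε / 2 ∈ Ioo 0 ε := ⟨by linarith, by linarith⟩
  have habs : |ε / 2| < ε := by rw [abs_of_pos hε2.1]; exact hε2.2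
  rw [h.orbitRank_eq hx h0 ht hε2]
  have h1 : Tendsto (fun a => Φ (ε / 2, u a)) l (𝓝 (Φ (ε / 2, x))) :=
    (h.contDiffAt_map habs hx).continuousAt.tendsto.comp hu
  have h2 : ∀ᶠ a in l, dist (u a) z < ε :=
    (hu.dist tendsto_const_nhds).eventually (gt_mem_nhds hx)
  obtain ⟨a, ⟨h3, h4⟩, h5, h6⟩ :=
    (hn.and_eventually ((h1.eventually (eventually_orbitRank_le r _)).and h2)).exists
  rwa [h.toIsFlowBox.orbitRank_eq habs h6 h4, h3] at h5

end IsTransverseBox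

/-- Curves that leave the kernel of a linear form to the same side enter the same class. -/
lemma LeavesTo.congr {L' : E → E} (hLc : LeavesTo r L z c) (hoff : PreservedOff K r F z)
    (hF : ∀ v ∈ F, ℓ v = 0) (hz : z ∈ F) (hL : IsSectionAt K L z) (hpos : 0 < ℓ (L z))
    (hL' : IsSectionAt K L' z) (hpos' : 0 < ℓ (L' z)) : LeavesTo r L' z c := by
  obtain ⟨P, ε₁, hP⟩ := exists_isFlowBox hL.1
  obtain ⟨Q, ε₂, hQ⟩ := exists_isFlowBox hL'.1
  obtain ⟨ε, hP, hQ⟩ := ((hP.eventually_isTransverseBox hoff hF hL hpos).and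
    (hQ.eventually_isTransverseBox hoff hF hL' hpos')).exists
  have hε := hP.pos
  have hzz : dist z z < ε := by simpa using hε
  have hz0 : 0 ≤ ℓ z := (hF z hz).ge
  have hε2 : ε / 2 ∈ Ioo 0 ε := ⟨by linarith, by linarith⟩
  have habs : |ε / 2| < ε := by rw [abs_of_pos hε2.1]; exact hε2.2
  obtain ⟨δ, ⟨hδ0, hδε⟩, hδ⟩ := ((show ∀ᶠ δ in 𝓝[>] (0 : ℝ), δ ∈ Ioo 0 ε from
    Ioo_mem_nhdsGT hε).and (hP.eventually_mem (Metric.ball_mem_nhds z hε))).exists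
  replace hδ := fun t ht => hδ t z ht (by simpa using hδ0)
  refine hQ.leavesTo hzz hz0 hε2 ?_
  have htend : Tendsto (fun σ => Q (σ, z)) (𝓝[>] 0) (𝓝 z) := by
    have h1 := (hQ.contDiffAt_curve (t := 0) (by simpa using hε) hzz).continuousAt.tendsto
    rw [hQ.zero_self] at h1
    exact h1.mono_left nhdsWithin_le_nhds
  -- the points `Q (σ, z)` approach `z` from the positive side, where both ranks are constant
  have hrank : ∀ t ∈ Ioo 0 ε, orbitRank r (P (t, z)) ≤ orbitRank r (Q (ε / 2, z)) := by
    intro t ht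
    refine hP.orbitRank_le_of_tendsto hzz hz0 htend (Eventually.frequently ?_) ht
    filter_upwards [Ioo_mem_nhdsGT hε, htend.eventually (Metric.ball_mem_nhds z hε)] with σ hσ hσ'
    exact ⟨hQ.orbitRank_eq hzz hz0 hσ hε2,
      hP.preserves_uIcc hσ' (hQ.apply_pos hzz hz0 hσ) ⟨hε2.1.le, hε2.2⟩⟩
  have habs' : ∀ {t}, t ∈ Ioo 0 δ → |t| < δ := fun ht => abs_lt.2 ⟨by linarith [ht.1, ht.2], ht.2⟩
  -- the flow of `L'` preserves the classes near the points `P (τ, z)` for `τ > 0`, but perhaps not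
  -- near `z`
  have key := rel_of_transport (r := r) (x := fun τ => P (τ, z)) (ψ := fun y => Q (ε / 2, y))
    (hP.contDiffAt_curve (by simpa using hε) hzz)
    (by simpa only [hP.zero_self] using hQ.contDiffAt_map habs hzz)
    (by simpa only [hP.zero_self] using hQ.invertible_map habs hzz) dense_univ hδ0
    (fun τ _ hτ => hQ.eventually_rel_map habs (hδ τ (habs' hτ))
      (hQ.preserves_uIcc (hδ τ (habs' hτ)) (hP.apply_pos hzz hz0 ⟨hτ.1, hτ.2.trans hδε⟩)
        ⟨hε2.1.le, hε2.2⟩))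
    (fun τ _ hτ => by
      simpa only [hP.zero_self] using hrank τ ⟨hτ.1, hτ.2.trans hδε⟩)
    (fun τ _ hτ => hP.mem_orbitTangent hzz hz0 ⟨hτ.1, hτ.2.trans hδε⟩)
  simp only [hP.zero_self] at key
  obtain ⟨τ, h1, h2⟩ := (key.and_eventually (Ioo_mem_nhdsGT hε)).exists
  exact r.trans (r.symm h1) (hP.rel_of_leavesTo hzz hz0 h2 hLc)

omit [FiniteDimensional ℝ E] in
lemma IsSectionAt.eventually_preservesAt (h : IsSectionAt K L z) (hoff : PreservedOff K r S z) :
    ∀ᶠ y in 𝓝 z, y ∉ S → PreservesAt r L y := by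
  filter_upwards [h.eventually, hoff] with y h1 h2 h3
  exact h2 h3 L h1

/-- If the points of `F` belong to the classes of the curves crossing `F` at these points, then
transversal sections preserve the classes. -/
lemma preservesAt_of_notMem (hoff : PreservedOff K r F z)
    (hN : ∀ᶠ y in 𝓝 z, y ∈ F → CrossesTo F K r y y) (hL : IsSectionAt K L z)
    (hLF : L z ∉ F) : PreservesAt r L z := by
  have h1 : ∀ᶠ y in 𝓝 z, L y ∉ F :=
    hL.1.continuousAt.tendsto.eventually
      ((Submodule.closed_of_finiteDimensional F).isOpen_compl.mem_nhds hLF)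
  refine preservesAt_of_eventually ?_
  filter_upwards [h1, hN, hL.eventually, hL.eventually_preservesAt hoff]
    with x k1 k2 k3 k4 γ h0 hγ
  by_cases hx : x ∈ F
  · have h2 := k2 hx L k3 k1 γ h0 hγ
    have htr : Tendsto (fun t : ℝ => -t) (𝓝 0) (𝓝 0) := by
      simpa using (continuous_neg (G := ℝ)).tendsto 0
    have h3 := k2 hx _ k3.neg (fun hm => k1 (by simpa using neg_mem hm)) (fun t => γ (-t))
      (by simpa using h0) (by
        filter_upwards [htr.eventually hγ] with t ht
        have h4 := HasDerivAt.scomp t ht (hasDerivAt_neg t)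
        rwa [neg_one_smul] at h4)
    have htr2 : Tendsto (fun t : ℝ => -t) (𝓝[<] 0) (𝓝[>] 0) := by
      simpa using tendsto_neg_nhdsLT (a := (0 : ℝ))
    have h4 := htr2.eventually h3
    simp only [neg_neg] at h4
    have h5 : ∀ᶠ t in 𝓝[≠] 0, r (γ t) x := by
      rw [← nhdsLT_sup_nhdsGT, eventually_sup]
      exact ⟨h4, h2⟩
    filter_upwards [eventually_nhdsWithin_iff.1 h5] with t ht
    rcases eq_or_ne t 0 with rfl | hne
    · rw [h0]
    · exact ht hne
  · exact (k4 hx).eventually_rel h0 hγ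

lemma exists_clm_pos {v w : E} (hv : v ∉ F)
    (hw : w ∉ F ⊔ Submodule.span ℝ {v}) :
    ∃ ℓ : E →L[ℝ] ℝ, (∀ u ∈ F, ℓ u = 0) ∧ 0 < ℓ v ∧ 0 < ℓ w := by
  obtain ⟨f, hf, hf'⟩ := Submodule.exists_le_ker_of_notMem hw
  obtain ⟨g, hg, hg'⟩ := Submodule.exists_le_ker_of_notMem hv
  have hfv : f v = 0 := hf' (Submodule.mem_sup_right (Submodule.mem_span_singleton_self v))
  refine ⟨((g v)⁻¹ • g + ((1 - (g v)⁻¹ * g w) / f w) • f).toContinuousLinearMap, fun u hu => ?_,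
    ?_, ?_⟩
  · have h1 : f u = 0 := hf' (Submodule.mem_sup_left hu)
    have h2 : g u = 0 := hg' hu
    simp [h1, h2]
  · simp [hfv, hg]
  · simp [hf]

lemma exists_leavesTo (hoff : PreservedOff K r F z) (hz : z ∈ F) (hL : IsSectionAt K L z)
    (hLF : L z ∉ F) : ∃ c, LeavesTo r L z c := by
  obtain ⟨g, hg, hg'⟩ := Submodule.exists_le_ker_of_notMem hLF
  obtain ⟨Φ, ε, hΦ⟩ := exists_isFlowBox hL.1
  have hF : ∀ v ∈ F, (((g (L z))⁻¹ • g).toContinuousLinearMap : E →L[ℝ] ℝ) v = 0 := fun v hv => by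
    have : g v = 0 := hg' hv
    simp [this]
  obtain ⟨δ, h⟩ := (hΦ.eventually_isTransverseBox hoff hF hL (by simp [hg])).exists
  have hδ := h.pos
  exact ⟨Φ (δ / 2, z), h.leavesTo (by simpa using hδ) (hF z hz).ge
    (t := δ / 2) ⟨by linarith, by linarith⟩ (r.refl _)⟩

/-- If both branches of one transversal curve through `z` belong to one class, then so do all
transversal curves through `z`. -/
lemma crossesTo_of_leavesTo (hoff : PreservedOff K r F z) (hz : z ∈ F) {X : E → E}
    (hX : IsSectionAt K X z) (hXF : X z ∉ F) (h : LeavesTo r X z c)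
    (h' : LeavesTo r (fun y => -X y) z c) : CrossesTo F K r z c := by
  intro L hL hLF
  -- if `L z` is transversal to `F` and `X z` together, some linear form that vanishes on `F` is
  -- positive at both; otherwise `L` leaves to the side of `X` or to that of `-X`
  by_cases hmem : L z ∈ F ⊔ Submodule.span ℝ {X z}
  · obtain ⟨g, hg, hg'⟩ := Submodule.exists_le_ker_of_notMem hXF
    set ℓ : E →L[ℝ] ℝ := ((g (X z))⁻¹ • g).toContinuousLinearMap with hℓ
    have hF : ∀ v ∈ F, ℓ v = 0 := fun v hv => by
      have : g v = 0 := hg' hv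
      simp [hℓ, this]
    have hX1 : ℓ (X z) = 1 := by simp [hℓ, hg]
    obtain ⟨f, hf, w, hw, hfw⟩ := Submodule.mem_sup.1 hmem
    obtain ⟨a, rfl⟩ := Submodule.mem_span_singleton.1 hw
    have hLa : ℓ (L z) = a := by rw [← hfw, map_add, hF f hf, map_smul, hX1]; simp
    have ha : a ≠ 0 := by
      rintro rfl
      rw [zero_smul, add_zero] at hfw
      exact hLF (hfw ▸ hf)
    rcases lt_or_gt_of_ne ha with ha | ha
    · exact h'.congr (ℓ := -ℓ) hoff (fun v hv => by simp [hF v hv]) hz hX.neg (by simp [hX1]) hL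
        (by simpa [hLa] using ha)
    · exact h.congr hoff hF hz hX (by simp [hX1]) hL (by rwa [hLa])
  · obtain ⟨ℓ, h1, h2, h3⟩ := exists_clm_pos hXF hmem
    exact h.congr hoff h1 hz hX h2 hL h3

/-- Where `K` has at least two dimensions transversal to `F`, the two sides of `F` are connected by
turning a transversal section. -/
lemma exists_crossesTo_of_codim_two (hoff : PreservedOff K r F z) (hz : z ∈ F) {X U : E → E}
    (hX : IsSectionAt K X z) (hXF : X z ∉ F) (hU : IsSectionAt K U z)
    (hUF : U z ∉ F ⊔ Submodule.span ℝ {X z}) : ∃ c, CrossesTo F K r z c := by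
  -- `X` and `U` lie on one side of a hyperplane containing `F`, and so do `U` and `-X`
  obtain ⟨c, hc⟩ := exists_leavesTo hoff hz hX hXF
  refine ⟨c, crossesTo_of_leavesTo hoff hz hX hXF hc ?_⟩
  obtain ⟨ℓ, h1, h2, h3⟩ := exists_clm_pos hXF hUF
  have hXF' : -X z ∉ F := fun hm => hXF (by simpa using neg_mem hm)
  have hUF' : U z ∉ F ⊔ Submodule.span ℝ {-X z} := by
    rwa [← Set.neg_singleton, Submodule.span_neg]
  obtain ⟨ℓ', h1', h2', h3'⟩ := exists_clm_pos hXF' hUF'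
  exact (hc.congr hoff h1 hz hX h2 hU h3).congr hoff h1' hz hU h3' hX.neg h2'

end Leaving

/-! ### Flowing along a field through points displaced transversally -/

section TwoFlows

variable {E : Type*} [NormedAddCommGroup E] [NormedSpace ℝ E]

omit [NormedSpace ℝ E] in
lemma eventually_box₂ {z : E} {p : ℝ → ℝ → E → Prop}
    (h : ∀ᶠ q in 𝓝 ((0 : ℝ), ((0 : ℝ), z)), p q.1 q.2.1 q.2.2) :
    ∀ᶠ δ in 𝓝[>] (0 : ℝ), ∀ s t x, |s| < δ → |t| < δ → dist x z < δ → p s t x := by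
  obtain ⟨ε, hε, h⟩ := Metric.eventually_nhds_iff_ball.1 h
  filter_upwards [Ioo_mem_nhdsGT hε] with δ hδ s t x hs ht hx
  refine h (s, t, x) ?_
  rw [Metric.mem_ball, Prod.dist_eq, Prod.dist_eq, max_lt_iff, max_lt_iff]
  exact ⟨by simpa [Real.dist_eq] using hs.trans hδ.2, by simpa [Real.dist_eq] using ht.trans hδ.2,
    hx.trans hδ.2⟩

variable {r : Setoid E} {ℓ : E →L[ℝ] ℝ} {X L : E → E} {P Q : ℝ × E → E} {z : E} {ε ε' : ℝ}

lemma IsFlowBox.eventually_comp (h : IsFlowBox L Q z ε) : ∀ᶠ δ in 𝓝[>] (0 : ℝ), ∀ s t x,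
    |s| < δ → |t| < δ → dist x z < δ → Q (s, Q (t, x)) = Q (s + t, x) := by
  have hev := h.eventually_mem (Metric.ball_mem_nhds z h.pos)
  obtain ⟨δ₁, hδ₁, hδ₁0⟩ := (hev.and self_mem_nhdsWithin).exists
  have hδ₁0' : 0 < δ₁ := hδ₁0
  have h3 : 0 < min (δ₁ / 2) (ε / 2) := lt_min (half_pos hδ₁0') (half_pos h.pos)
  filter_upwards [Ioo_mem_nhdsGT h3] with δ hδ s t x hs ht hx
  rw [mem_Ioo, lt_min_iff] at hδ
  exact h.comp (by linarith) (fun u y hu hy => hδ₁ u y (by linarith) (by linarith)) hs ht hx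

/-- The composition of two local flows, as a function of both times and of the point. -/
lemma IsFlowBox.contDiffAt_comp (hP : IsFlowBox X P z ε) (hQ : IsFlowBox L Q z ε') :
    ContDiffAt ℝ 1 (fun q : ℝ × ℝ × E => Q (q.1, P q.2)) (0, (0, z)) := by
  have h1 : ContDiffAt ℝ 1 P ((fun q : ℝ × ℝ × E => q.2) (0, (0, z))) :=
    hP.contDiffAt 0 z (by simpa using hP.pos) (by simpa using hP.pos)
  have h2 : ContDiffAt ℝ 1 (fun q : ℝ × ℝ × E => P q.2) (0, (0, z)) :=
    ContDiffAt.comp (f := fun q : ℝ × ℝ × E => q.2) _ h1 contDiffAt_snd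
  have h3 : ContDiffAt ℝ 1 Q ((fun q : ℝ × ℝ × E => (q.1, P q.2)) (0, (0, z))) := by
    simpa only [hP.zero_self] using
      hQ.contDiffAt 0 z (by simpa using hQ.pos) (by simpa using hQ.pos)
  exact ContDiffAt.comp (f := fun q : ℝ × ℝ × E => (q.1, P q.2)) _ h3 (contDiffAt_fst.prodMk h2)

lemma IsFlowBox.comp_zero_self (hP : IsFlowBox X P z ε) (hQ : IsFlowBox L Q z ε') :
    Q (0, P (0, z)) = z := by rw [hP.zero_self, hQ.zero_self]

lemma IsFlowBox.eventually_mem₂ (hP : IsFlowBox X P z ε) (hQ : IsFlowBox L Q z ε') {p : E → Prop}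
    (hp : ∀ᶠ y in 𝓝 z, p y) : ∀ᶠ δ in 𝓝[>] (0 : ℝ), ∀ s t x, |s| < δ → |t| < δ → dist x z < δ →
      p (Q (s, P (t, x))) := by
  apply eventually_box₂ (p := fun s t x => p (Q (s, P (t, x))))
  have h1 := (hP.contDiffAt_comp hQ).continuousAt.tendsto
  simp only [hP.comp_zero_self hQ] at h1
  exact h1.eventually hp

/-- If `ℓ` increases along the first field, it increases along the images of its integral curves
under the flow of the second field, for short times. -/
lemma IsFlowBox.eventually_expanding (hP : IsFlowBox X P z ε) (hQ : IsFlowBox L Q z ε') {κ : ℝ}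
    (hκ : κ < ℓ (X z)) : ∀ᶠ δ in 𝓝[>] (0 : ℝ), ∀ s x, |s| < δ → dist x z < δ →
      ∀ t t', |t| < δ → |t'| < δ → t ≤ t' →
      κ * (t' - t) ≤ ℓ (Q (s, P (t', x))) - ℓ (Q (s, P (t, x))) := by
  set G : ℝ × ℝ × E → ℝ := fun q => ℓ (Q (q.1, P q.2)) with hG
  have hGc : ContDiffAt ℝ 1 G (0, (0, z)) :=
    ℓ.contDiff.contDiffAt.comp _ (hP.contDiffAt_comp hQ)
  have hline : ∀ (s t : ℝ) (x : E), HasDerivAt (fun t : ℝ => ((s, (t, x)) : ℝ × ℝ × E))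
      ((0, (1, 0)) : ℝ × ℝ × E) t := fun s t x =>
    (hasDerivAt_const t s).prodMk ((hasDerivAt_id t).prodMk (hasDerivAt_const t x))
  have hder : ∀ (s t : ℝ) (x : E), ContDiffAt ℝ 1 G (s, (t, x)) →
      HasDerivAt (fun t => ℓ (Q (s, P (t, x)))) (fderiv ℝ G (s, (t, x)) (0, (1, 0))) t :=
    fun s t x h => HasFDerivAt.comp_hasDerivAt (f := fun t : ℝ => ((s, (t, x)) : ℝ × ℝ × E)) t
      (h.differentiableAt one_ne_zero).hasFDerivAt (hline s t x)
  have h0 : fderiv ℝ G (0, (0, z)) (0, (1, 0)) = ℓ (X z) := by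
    have h1 := hder 0 0 z hGc
    have h2 : HasDerivAt (fun t => ℓ (P (t, z))) (ℓ (X (P (0, z)))) 0 :=
      ℓ.hasFDerivAt.comp_hasDerivAt 0
        (hP.hasDerivAt 0 z (by simpa using hP.pos) (by simpa using hP.pos))
    rw [hP.zero_self] at h2
    refine h1.unique (h2.congr_of_eventuallyEq ?_)
    have h3 := (hP.contDiffAt_curve (t := 0) (x := z) (by simpa using hP.pos)
      (by simpa using hP.pos)).continuousAt.tendsto
    rw [hP.zero_self] at h3
    filter_upwards [h3.eventually (Metric.ball_mem_nhds z hQ.pos)] with t ht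
    rw [hQ.zero _ ht]
  have hc : ContinuousAt (fun q => fderiv ℝ G q (0, (1, 0))) (0, (0, z)) :=
    (hGc.fderiv_right (m := 0) (by norm_num)).continuousAt.clm_apply continuousAt_const
  have hev : ∀ᶠ q in 𝓝 ((0 : ℝ), ((0 : ℝ), z)), ContDiffAt ℝ 1 G q ∧
      κ < fderiv ℝ G q (0, (1, 0)) :=
    (hGc.eventually (by simp)).and (hc.tendsto.eventually (lt_mem_nhds (by rwa [h0])))
  filter_upwards [eventually_box₂ (p := fun s t x => ContDiffAt ℝ 1 G (s, (t, x)) ∧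
      κ < fderiv ℝ G (s, (t, x)) (0, (1, 0))) hev] with δ hδ s x hs hx t t' ht ht' htt
  have hd : ∀ u ∈ Ioo (-δ) δ, HasDerivAt (fun t => ℓ (Q (s, P (t, x)))) _ u := fun u hu =>
    hder s u x (hδ s u x hs (abs_lt.2 hu) hx).1
  refine (convex_Ioo (-δ) δ).mul_sub_le_image_sub_of_le_deriv (f := fun t => ℓ (Q (s, P (t, x))))
    (fun u hu => (hd u hu).continuousAt.continuousWithinAt)
    (fun u hu => ?_) (fun u hu => ?_) t (abs_lt.1 ht) t' (abs_lt.1 ht') htt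
  · rw [interior_Ioo] at hu
    exact (hd u hu).differentiableAt.differentiableWithinAt
  · rw [interior_Ioo] at hu
    rw [(hd u hu).deriv]
    exact (hδ s u x hs (abs_lt.2 hu) hx).2.le

/-- Suppose that `L` preserves the classes except at the points of the kernel of `ℓ` at which it is
tangent to that kernel. Then the integral curves of `L` through almost all points of a curve
transversal to the kernel stay in their classes: they cross the kernel transversally. -/
lemma IsFlowBox.eventually_dense_preservesAt (hP : IsFlowBox X P z ε) (hQ : IsFlowBox L Q z ε')
    (hpos : 0 < ℓ (X z)) (hreg : ∀ᶠ y in 𝓝 z, (ℓ y ≠ 0 ∨ ℓ (L y) ≠ 0) → PreservesAt r L y) :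
    ∀ᶠ δ in 𝓝[>] (0 : ℝ), ∀ x, dist x z < δ →
      Dense {t | |t| < δ → ∀ s, |s| < δ → PreservesAt r L (Q (s, P (t, x)))} := by
  have hη := hQ.pos
  obtain ⟨δ₁, hδ₁, hδ₁0⟩ := ((hP.eventually_mem (Metric.ball_mem_nhds z hη)).and
    self_mem_nhdsWithin).exists
  filter_upwards [hP.eventually_expanding hQ (half_lt_self hpos), hP.eventually_mem₂ hQ hreg,
    Ioo_mem_nhdsGT (show (0 : ℝ) < δ₁ from hδ₁0), Ioo_mem_nhdsGT hη]
    with δ hexp hδ hδδ hδη x hx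
  have hd : ∀ s t, |s| < δ → |t| < δ →
      HasDerivAt (fun s => ℓ (Q (s, P (t, x)))) (ℓ (L (Q (s, P (t, x))))) s := fun s t hs ht =>
    ℓ.hasFDerivAt.comp_hasDerivAt s (hQ.hasDerivAt s _ (hs.trans hδη.2)
      (hδ₁ t x (ht.trans hδδ.2) (hx.trans hδδ.2)))
  refine (dense_compl_multiple_zeros (h := fun s t => ℓ (Q (s, P (t, x)))) (A := Ioo (-δ) δ)
    (B := Ioo (-δ) δ) (half_pos hpos) ?_).mono ?_
  · intro s hs t ht t' ht'
    rcases le_total t t' with h | h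
    · have h1 := hexp s x (abs_lt.2 hs) hx t t' (abs_lt.2 ht) (abs_lt.2 ht') h
      rw [abs_sub_comm t, abs_sub_comm (ℓ _), abs_of_nonneg (by linarith : 0 ≤ t' - t)]
      exact h1.trans (le_abs_self _)
    · have h1 := hexp s x (abs_lt.2 hs) hx t' t (abs_lt.2 ht') (abs_lt.2 ht) h
      rw [abs_of_nonneg (by linarith : 0 ≤ t - t')]
      exact h1.trans (le_abs_self _)
  · intro t ht ht' s hs
    refine hδ s t x hs ht' hx ?_
    by_contra! hcon
    refine ht ⟨abs_lt.1 ht', s, abs_lt.1 hs, hcon.1, ?_⟩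
    simpa only [hcon.2] using hd s t hs ht'

lemma frequently_nhdsGT_of_dense {D : Set ℝ} (hD : Dense D) (a : ℝ) : ∃ᶠ t in 𝓝[>] a, t ∈ D := by
  rw [frequently_nhdsWithin_iff, Metric.nhds_basis_ball.frequently_iff]
  intro ρ hρ
  obtain ⟨σ, hσ1, hσD⟩ := hD.inter_open_nonempty (Ioo a (a + ρ)) isOpen_Ioo
    (nonempty_Ioo.2 (by linarith))
  refine ⟨σ, ?_, hσD, hσ1.1⟩
  rw [Metric.mem_ball, Real.dist_eq, abs_of_pos (by linarith [hσ1.1])]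
  linarith [hσ1.2]

variable [FiniteDimensional ℝ E] {K : E → Submodule ℝ E} {F : Submodule ℝ E}

/-- If the points of `F` belong to the classes of the curves crossing `F` at these points, then
all sections preserve the classes, also those tangent to `F`. -/
theorem preservesAt_of_crossesTo (hoff : PreservedOff K r F z)
    (hN : ∀ᶠ y in 𝓝 z, y ∈ F → CrossesTo F K r y y)
    (hX : z ∈ F → ∃ X, IsSectionAt K X z ∧ X z ∉ F) (hL : IsSectionAt K L z) :
    PreservesAt r L z := by
  by_cases hz : z ∈ F
  swap
  · exact hoff.self_of_nhds hz L hL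
  obtain ⟨X, hX, hXF⟩ := hX hz
  obtain ⟨g, hg, hg'⟩ := Submodule.exists_le_ker_of_notMem hXF
  set ℓ : E →L[ℝ] ℝ := ((g (X z))⁻¹ • g).toContinuousLinearMap with hℓ
  have hF : ∀ v ∈ F, ℓ v = 0 := fun v hv => by
    have : g v = 0 := hg' hv
    simp [hℓ, this]
  have hX1 : 0 < ℓ (X z) := by simp [hℓ, hg]
  have hreg : ∀ᶠ y in 𝓝 z, (ℓ y ≠ 0 ∨ ℓ (L y) ≠ 0) → PreservesAt r L y := by
    filter_upwards [hoff, hoff.eventually, hN.eventually_nhds, hL.eventually] with y h1 h2 h3 h4 h5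
    by_cases hy : y ∈ F
    · refine preservesAt_of_notMem h2 h3 h4 fun hLy => ?_
      rcases h5 with h5 | h5
      exacts [h5 (hF y hy), h5 (hF _ hLy)]
    · exact h1 hy L h4
  have hXp := (preservesAt_of_notMem hoff hN hX hXF).eventually
  obtain ⟨P, ε₁, hP⟩ := exists_isFlowBox hX.1
  obtain ⟨Q, ε₂, hQ⟩ := exists_isFlowBox hL.1
  obtain ⟨ε, hP, hQ⟩ := (hP.eventually_mono.and hQ.eventually_mono).exists
  have hε := hP.pos
  obtain ⟨δ, hdense, hδX, hδP, hδ0, hδε⟩ := ((hP.eventually_dense_preservesAt hQ hX1 hreg).and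
    ((hP.eventually_mem hXp).and ((hP.eventually_mem (Metric.ball_mem_nhds z hε)).and
    (show ∀ᶠ δ in 𝓝[>] (0 : ℝ), δ ∈ Ioo 0 ε from Ioo_mem_nhdsGT hε)))).exists
  have hle : ∀ {s t : ℝ}, |t| < δ → s ∈ uIcc 0 t → |s| < δ := fun ht hs => by
    have h2 := abs_sub_left_of_mem_uIcc hs
    simp only [sub_zero] at h2
    exact h2.trans_lt ht
  have hPX : ∀ t x, |t| < δ → dist x z < δ → ∀ s ∈ uIcc 0 t, PreservesAt r X (P (s, x)) :=
    fun t x ht hx s hs => hδX s x (hle ht hs) hx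
  have hDQ : ∀ x, dist x z < δ → ∀ s, |s| < δ → ∃ᶠ t in 𝓝[>] (0 : ℝ), |t| < δ ∧
      ∀ u ∈ uIcc 0 s, PreservesAt r L (Q (u, P (t, x))) := by
    intro x hx s hs
    refine ((frequently_nhdsGT_of_dense (hdense x hx) 0).and_eventually
      (Ioo_mem_nhdsGT hδ0)).mono ?_
    rintro t ⟨h1, h2⟩
    have ht : |t| < δ := abs_lt.2 ⟨by linarith [h2.1], h2.2⟩
    exact ⟨ht, fun u hu => h1 ht u (hle hs hu)⟩
  -- the rank does not increase along the flow of `L`, by semicontinuity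
  have hrank : ∀ x, dist x z < δ → ∀ s, |s| < δ → orbitRank r (Q (s, x)) ≤ orbitRank r x := by
    intro x hx s hs
    have hc : Tendsto (fun t => Q (s, P (t, x))) (𝓝[>] 0) (𝓝 (Q (s, x))) := by
      have h1 := (hP.contDiffAt_curve (t := 0) (x := x) (by simpa using hε)
        (hx.trans hδε)).continuousAt.tendsto
      rw [hP.zero x (hx.trans hδε)] at h1
      exact (hQ.contDiffAt_map (hs.trans hδε) (hx.trans hδε)).continuousAt.tendsto.comp
        (h1.mono_left nhdsWithin_le_nhds)
    obtain ⟨t, ⟨ht, h1⟩, h2⟩ := ((hDQ x hx s hs).and_eventually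
      (hc.eventually (eventually_orbitRank_le r _))).exists
    rw [hQ.orbitRank_eq (hs.trans hδε) (hδP t x ht hx) h1,
      hP.orbitRank_eq (ht.trans hδε) (hx.trans hδε) (hPX t x ht hx)] at h2
    exact h2
  obtain ⟨δ', hcomp, hδ'Q, hδ'0, hδ'δ⟩ := (hQ.eventually_comp.and
    ((hQ.eventually_mem (Metric.ball_mem_nhds z hδ0)).and
    (show ∀ᶠ δ' in 𝓝[>] (0 : ℝ), δ' ∈ Ioo 0 δ from Ioo_mem_nhdsGT hδ0))).exists
  have key : ∀ x, dist x z < δ' → ∀ s, |s| < δ' → r (Q (s, x)) x := by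
    intro x hx s hs
    have hxδ := hx.trans hδ'δ
    have hsδ := hs.trans hδ'δ
    -- the flow is invertible, so that the rank is in fact constant
    have hrank' : orbitRank r x ≤ orbitRank r (Q (s, x)) := by
      have h1 := hrank (Q (s, x)) (hδ'Q s x hs hx) (-s) (by rwa [abs_neg])
      rwa [hcomp (-s) s x (by rwa [abs_neg]) hs hx, neg_add_cancel, hQ.zero x (hxδ.trans hδε)] at h1
    have h0 : P (0, x) = x := hP.zero x (hxδ.trans hδε)
    have habs : ∀ {t : ℝ}, t ∈ Ioo 0 δ → |t| < δ := fun ht => abs_lt.2 ⟨by linarith [ht.1], ht.2⟩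
    -- transport of the transversal curve `t ↦ P (t, x)`, for almost all `t` without tangencies
    have h1 := rel_of_transport (r := r) (x := fun t => P (t, x)) (ψ := fun y => Q (s, y))
      (hP.contDiffAt_curve (by simpa using hε) (hxδ.trans hδε))
      (by simpa only [h0] using hQ.contDiffAt_map (hsδ.trans hδε) (hxδ.trans hδε))
      (by simpa only [h0] using hQ.invertible_map (hsδ.trans hδε) (hxδ.trans hδε))
      (hdense x hxδ) hδ0
      (fun t ht ht' => hQ.eventually_rel_map (hsδ.trans hδε) (hδP t x (habs ht') hxδ)
        fun u hu => ht (habs ht') u (hle hsδ hu))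
      (fun t _ ht' => by
        rw [hP.orbitRank_eq ((habs ht').trans hδε) (hxδ.trans hδε) (hPX t x (habs ht') hxδ)]
        simpa only [h0] using hrank')
      (fun t _ ht' => hP.mem_orbitTangent ((habs ht').trans hδε) (hxδ.trans hδε)
        (hPX t x (habs ht') hxδ))
    simp only [h0] at h1
    obtain ⟨t, h2, h3⟩ := (h1.and_eventually (Ioo_mem_nhdsGT hδ0)).exists
    exact r.trans (r.symm h2) (hP.rel ((habs h3).trans hδε) (hxδ.trans hδε)
      (hPX t x (habs h3) hxδ))
  refine preservesAt_of_eventually ?_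
  filter_upwards [Metric.ball_mem_nhds z hδ'0] with x hx γ hγ0 hγ
  filter_upwards [hQ.eventually_eq ((Metric.mem_ball.1 hx).trans (hδ'δ.trans hδε)) hγ0 hγ,
    Ioo_mem_nhds (neg_neg_of_pos hδ'0) hδ'0] with t h1 h2
  rw [h1]
  exact key x hx t (abs_lt.2 h2)

end TwoFlows

/-! ### Leaving the exceptional set along a tangent section -/

section Exit

variable {E : Type*} [NormedAddCommGroup E] [NormedSpace ℝ E] {r : Setoid E} {ℓ : E →L[ℝ] ℝ}
  {X Y : E → E} {P Q : ℝ × E → E} {z : E} {ε ε' : ℝ} {B : Set E}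

/-- Let `Y` be tangent to the kernel of `ℓ` at the points of a subset `B` of that kernel. Where an
integral curve of a transversal field `X` meets `B` shortly afterwards, the rate of change of `ℓ`
along `Y` is bounded by `ℓ`. -/
lemma IsFlowBox.exists_bound_of_mem (hP : IsFlowBox X P z ε) (hX : ContinuousAt X z)
    (hpos : 0 < ℓ (X z)) (hY : ContDiffAt ℝ 1 Y z)
    (hB : ∀ᶠ y in 𝓝 z, y ∈ B → ℓ y = 0 ∧ ℓ (Y y) = 0) :
    ∃ C, ∀ᶠ δ in 𝓝[>] (0 : ℝ), ∀ x t, dist x z < δ → t ∈ Ico 0 δ → P (t, x) ∈ B →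
      |ℓ (Y x)| ≤ C * |ℓ x| ∧ (ℓ x = 0 → x ∈ B) := by
  obtain ⟨κ, hκ0, hκ⟩ := exists_between hpos
  obtain ⟨A, T, hT, hA⟩ := hY.exists_lipschitzOnWith
  set N := ‖X z‖ + 1 with hN
  have hXN : ∀ᶠ y in 𝓝 z, ‖X y‖ < N := hX.norm.tendsto.eventually (gt_mem_nhds (by simp [hN]))
  have hXκ : ∀ᶠ y in 𝓝 z, κ < ℓ (X y) :=
    (ℓ.continuous.continuousAt.comp hX).tendsto.eventually (lt_mem_nhds hκ)
  refine ⟨‖ℓ‖ * A * N / κ, ?_⟩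
  filter_upwards [hP.eventually_mem hB, hP.eventually_mem hT, hP.eventually_mem hXN,
    hP.eventually_mem hXκ, Ioo_mem_nhdsGT hP.pos] with δ h1 h2 h3 h4 hδ x t hx ht hmem
  have habs : ∀ {u}, u ∈ Icc 0 t → |u| < δ := fun hu =>
    abs_lt.2 ⟨by linarith [hu.1, hδ.1], hu.2.trans_lt ht.2⟩
  have hd : ∀ u ∈ Icc 0 t, HasDerivAt (fun u => P (u, x)) (X (P (u, x))) u := fun u hu =>
    hP.hasDerivAt u x ((habs hu).trans hδ.2) (hx.trans hδ.2)
  have hd' : ∀ u ∈ Icc 0 t, HasDerivAt (fun u => ℓ (P (u, x))) (ℓ (X (P (u, x)))) u :=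
    fun u hu => ℓ.hasFDerivAt.comp_hasDerivAt u (hd u hu)
  have h0 : P (0, x) = x := hP.zero x (hx.trans hδ.2)
  have ht0 : 0 ∈ Icc 0 t := ⟨le_rfl, ht.1⟩
  have ht1 : t ∈ Icc 0 t := ⟨ht.1, le_rfl⟩
  have k1 := (convex_Icc 0 t).mul_sub_le_image_sub_of_le_deriv (f := fun u => ℓ (P (u, x)))
    (C := κ) (fun u hu => (hd' u hu).continuousAt.continuousWithinAt)
    (fun u hu => (hd' u (interior_subset hu)).differentiableAt.differentiableWithinAt)
    (fun u hu => by
      rw [(hd' u (interior_subset hu)).deriv]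
      exact (h4 u x (habs (interior_subset hu)) hx).le) 0 ht0 t ht1 ht.1
  have k2 := norm_image_sub_le_of_norm_deriv_le_segment' (C := N)
    (fun u hu => (hd u hu).hasDerivWithinAt)
    (fun u hu => (h3 u x (habs ⟨hu.1, hu.2.le⟩) hx).le) t ht1
  obtain ⟨hb1, hb2⟩ := h1 t x (habs ht1) hx hmem
  simp only [h0, hb1, sub_zero, zero_sub] at k1 k2
  have hxT : x ∈ T := by
    have h5 : P (0, x) ∈ T := h2 0 x (habs ht0) hx
    rwa [h0] at h5
  have k3 := hA.dist_le_mul _ (h2 t x (habs ht1) hx) _ hxT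
  rw [dist_eq_norm, dist_eq_norm] at k3
  have k4 : |ℓ (Y x)| ≤ ‖ℓ‖ * ‖Y (P (t, x)) - Y x‖ := by
    have := ℓ.le_opNorm (Y (P (t, x)) - Y x)
    rwa [map_sub, hb2, zero_sub, norm_neg] at this
  have htl : t ≤ |ℓ x| / κ := by
    rw [le_div_iff₀ hκ0, mul_comm]
    exact k1.trans (neg_le_abs _)
  refine ⟨?_, fun hx0 => ?_⟩
  · calc |ℓ (Y x)| ≤ ‖ℓ‖ * (A * (N * t)) :=
        k4.trans (mul_le_mul_of_nonneg_left (k3.trans (mul_le_mul_of_nonneg_left k2 A.2))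
          (norm_nonneg ℓ))
      _ ≤ ‖ℓ‖ * (A * (N * (|ℓ x| / κ))) := by
        have : 0 ≤ N := by positivity
        gcongr
      _ = ‖ℓ‖ * A * N / κ * |ℓ x| := by ring
  · rw [hx0, abs_zero, zero_div] at htl
    rwa [le_antisymm htl ht.1, h0] at hmem

variable [FiniteDimensional ℝ E] {K : E → Submodule ℝ E} {F : Submodule ℝ E}

/-- Let the sections of `K` preserve the classes outside a closed subset `B` of `F`, and let `Y` be
a section of `K` that is tangent to `F` at the points of `B`. If `Y` leads from `z` out of `B`,
then the curves leaving the points of `B` near `z` in the direction of a transversal section `X`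
enter the class of the point that is reached along `Y`. This class does not depend on the direction
of `X`. -/
theorem IsFlowBox.exists_leavesTo_of_exit (hQ : IsFlowBox Y Q z ε) (hB : IsClosed B)
    (hBF : ∀ᶠ y in 𝓝 z, y ∈ B → y ∈ F) (hoff : PreservedOff K r B z) (hF : ∀ v ∈ F, ℓ v = 0)
    (hX : IsSectionAt K X z) (hpos : 0 < ℓ (X z)) (hY : IsSectionAt K Y z)
    (hYB : ∀ᶠ y in 𝓝 z, y ∈ B → Y y ∈ F) :
    ∀ᶠ δ in 𝓝[>] (0 : ℝ), ∀ s ∈ Ioo 0 δ, Q (s, z) ∉ B →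
      ∀ᶠ y in 𝓝 z, y ∈ B → LeavesTo r X y (Q (s, y)) := by
  have hoffF : PreservedOff K r F z := by
    filter_upwards [hoff, hBF] with y h1 h2 h3
    exact h1 fun hy => h3 (h2 hy)
  have hXB := hX.eventually_preservesAt hoff
  have hYB' := hY.eventually_preservesAt hoff
  have hB0 : ∀ᶠ y in 𝓝 z, y ∈ B → ℓ y = 0 ∧ ℓ (Y y) = 0 := by
    filter_upwards [hBF, hYB] with y h1 h2 h3
    exact ⟨hF _ (h1 h3), hF _ (h2 h3)⟩
  have hreg : ∀ᶠ y in 𝓝 z, (ℓ y ≠ 0 ∨ ℓ (Y y) ≠ 0) → PreservesAt r Y y := by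
    filter_upwards [hYB', hB0] with y h1 h2 h3
    exact h1 fun hy => h3.elim (fun h => h (h2 hy).1) fun h => h (h2 hy).2
  obtain ⟨P, ε₁, hP⟩ := exists_isFlowBox hX.1
  obtain ⟨C, hC⟩ := hP.exists_bound_of_mem hX.1.continuousAt hpos hY.1 hB0
  -- a box for `X`
  obtain ⟨η, hη, hηQ, hηB, hηX⟩ := ((hP.eventually_isTransverseBox hoffF hF hX hpos).and
    (hQ.eventually_mono.and (hC.and (hP.eventually_mem hXB)))).exists
  have hη0 := hη.pos
  have hη2 : η / 2 ∈ Ioo 0 η := ⟨by linarith, by linarith⟩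
  -- a smaller box for `Y` and the compositions
  obtain ⟨δ, hdense, hexp, hcomp, hδQ, hδP, hδY, hδ0, hδη⟩ :=
    ((hP.eventually_dense_preservesAt hQ hpos hreg).and
    ((hP.eventually_expanding hQ (half_lt_self hpos)).and (hQ.eventually_comp.and
    ((hQ.eventually_mem (Metric.ball_mem_nhds z hη0)).and
    ((hP.eventually_mem (Metric.ball_mem_nhds z hη0)).and ((hQ.eventually_mem
      (hYB'.and (hoff.and (hB0.and hY.eventually)))).and
    (show ∀ᶠ δ in 𝓝[>] (0 : ℝ), δ ∈ Ioo 0 η from Ioo_mem_nhdsGT hη0))))))).exists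
  filter_upwards [hQ.eventually_mem (Metric.ball_mem_nhds z hδ0), Ioo_mem_nhdsGT hδ0]
    with δ' hδ' hδ'δ s₀ hs₀ hexit
  have hs₀δ : |s₀| < δ := abs_lt.2 ⟨by linarith [hs₀.1], hs₀.2.trans hδ'δ.2⟩
  have hexit' : ∀ᶠ y in 𝓝 z, Q (s₀, y) ∉ B :=
    (hηQ.contDiffAt_map (hs₀δ.trans hδη) (by simpa using hη0)).continuousAt.tendsto.eventually
      (hB.isOpen_compl.mem_nhds hexit)
  filter_upwards [hexit', Metric.ball_mem_nhds z hδ'δ.1] with y hyexit hy' hyB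
  have hyδ : dist y z < δ := (Metric.mem_ball.1 hy').trans hδ'δ.2
  have hyη := hyδ.trans hδη
  have hball : ∀ s, |s| < δ' → dist (Q (s, y)) z < δ := fun s hs => hδ' s y hs hy'
  have habs' : ∀ {s}, s ∈ Icc 0 s₀ → |s| < δ' := fun hs =>
    abs_lt.2 ⟨by linarith [hs.1, hδ'δ.1], hs.2.trans_lt hs₀.2⟩
  have habsδ : ∀ {s}, s ∈ Icc 0 s₀ → |s| < δ := fun hs => (habs' hs).trans hδ'δ.2
  have hQ0 : Q (0, y) = y := hηQ.zero y hyη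
  have hQc : ContinuousOn (fun s => Q (s, y)) (Icc 0 s₀) := fun s hs =>
    (hηQ.contDiffAt_curve ((habsδ hs).trans hδη) hyη).continuousAt.continuousWithinAt
  -- the last point of `B` on the curve
  obtain ⟨s', ⟨hs'I, hs'B⟩, hlast⟩ : ∃ s' ∈ Icc 0 s₀ ∩ (fun s => Q (s, y)) ⁻¹' B,
      ∀ s ∈ Icc 0 s₀ ∩ (fun s => Q (s, y)) ⁻¹' B, s ≤ s' := by
    have hcpt : IsCompact (Icc 0 s₀ ∩ (fun s => Q (s, y)) ⁻¹' B) :=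
      isCompact_Icc.of_isClosed_subset (hQc.preimage_isClosed_of_isClosed isClosed_Icc hB)
        inter_subset_left
    exact hcpt.exists_isGreatest
      ⟨0, ⟨le_rfl, hs₀.1.le⟩, by simpa only [mem_preimage, hQ0] using hyB⟩
  set y' := Q (s', y) with hy'def
  have hs's₀ : s' < s₀ := lt_of_le_of_ne hs'I.2 fun h => hyexit (by rw [← h]; exact hs'B)
  have hafter : ∀ s ∈ Ioc s' s₀, Q (s, y) ∉ B := fun s hs hmem =>
    absurd (hlast s ⟨⟨hs'I.1.trans hs.1.le, hs.2⟩, hmem⟩) (not_le.2 hs.1)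
  have hy'δ : dist y' z < δ := hball s' (habs' hs'I)
  have hy'η := hy'δ.trans hδη
  have hℓB : ∀ s ∈ Icc 0 s₀, Q (s, y) ∈ B → ℓ (Q (s, y)) = 0 ∧ ℓ (Y (Q (s, y))) = 0 :=
    fun s hs => (hδY s y (habsδ hs) hyδ).2.2.1
  have hℓy : ℓ y = 0 := by
    have h1 := (hℓB 0 ⟨le_rfl, hs₀.1.le⟩ (by rwa [hQ0])).1
    rwa [hQ0] at h1
  have hℓy' : ℓ y' = 0 := (hℓB s' hs'I hs'B).1
  have hle : ∀ {s t : ℝ}, |t| < δ → s ∈ uIcc 0 t → |s| < δ := fun ht hs => by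
    have h2 := abs_sub_left_of_mem_uIcc hs
    simp only [sub_zero] at h2
    exact h2.trans_lt ht
  have hPtend : ∀ x, dist x z < η → Tendsto (fun t => P (t, x)) (𝓝[>] 0) (𝓝 x) := fun x hx => by
    have h1 := (hη.contDiffAt_curve (t := 0) (by simpa using hη0) hx).continuousAt.tendsto
    rw [hη.zero x hx] at h1
    exact h1.mono_left nhdsWithin_le_nhds
  have hPabs : ∀ {t : ℝ}, t ∈ Ioo 0 δ → |t| < δ := fun ht => abs_lt.2 ⟨by linarith [ht.1], ht.2⟩
  -- the ranks on the positive side do not decrease from `y` to `y'`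
  have hrank₁ : ∀ t ∈ Ioo 0 η, orbitRank r (P (t, y)) ≤ orbitRank r (P (η / 2, y')) := by
    intro t ht
    have hback : Q (-s', y') = y := by
      rw [hy'def, hcomp (-s') s' y (by rw [abs_neg]; exact habsδ hs'I) (habsδ hs'I) hyδ,
        neg_add_cancel, hQ0]
    have hs'n : |-s'| < δ := by rw [abs_neg]; exact habsδ hs'I
    have htend : Tendsto (fun t => Q (-s', P (t, y'))) (𝓝[>] 0) (𝓝 y) := by
      have h1 := (hηQ.contDiffAt_map (hs'n.trans hδη) hy'η).continuousAt.tendsto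
      rw [hback] at h1
      exact h1.comp (hPtend y' hy'η)
    refine hη.orbitRank_le_of_tendsto hyη hℓy.ge htend ?_ ht
    refine ((frequently_nhdsGT_of_dense (hdense y' hy'δ) 0).and_eventually
      ((show ∀ᶠ t in 𝓝[>] (0 : ℝ), t ∈ Ioo 0 δ from Ioo_mem_nhdsGT hδ0).and
        (htend.eventually (Metric.ball_mem_nhds y (show 0 < η - dist y z by linarith))))).mono ?_
    rintro u ⟨h1, h2, h3⟩
    have hu := hPabs h2
    have hnear : dist (Q (-s', P (u, y'))) z < η := by
      have := dist_triangle (Q (-s', P (u, y'))) y z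
      linarith [Metric.mem_ball.1 h3]
    refine ⟨?_, hη.preserves_uIcc hnear ?_ ⟨hη2.1.le, hη2.2⟩⟩
    · rw [hηQ.orbitRank_eq (hs'n.trans hδη) (hδP u y' hu hy'δ)
        fun v hv => h1 hu v (hle hs'n hv)]
      exact hη.orbitRank_eq hy'η hℓy'.ge ⟨h2.1, h2.2.trans hδη⟩ hη2
    · have h4 := hexp (-s') y' hs'n hy'δ 0 u (by simpa using hδ0) hu h2.1.le
      rw [hη.zero y' hy'η, hback, hℓy, sub_zero, sub_zero] at h4
      exact (mul_pos (half_pos hpos) h2.1).trans_le h4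
  -- the ranks do not decrease from the positive side of `y'` to the end of the curve
  have hYint : ∀ s ∈ Ioc s' s₀, (∀ᶠ u in 𝓝 s, HasDerivAt (fun u => Q (u, y)) (Y (Q (u, y))) u) ∧
      PreservesAt r Y (Q (s, y)) ∧ ContDiffAt ℝ 1 Y (Q (s, y)) := fun s hs => by
    have hsI : s ∈ Icc 0 s₀ := ⟨hs'I.1.trans hs.1.le, hs.2⟩
    obtain ⟨h1, -, -, h2⟩ := hδY s y (habsδ hsI) hyδ
    exact ⟨hηQ.eventually_hasDerivAt ((habsδ hsI).trans hδη) hyη, h1 (hafter s hs), h2.1⟩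
  have hrank₂ : orbitRank r (P (η / 2, y')) ≤ orbitRank r (Q (s₀, y)) := by
    have htend : Tendsto (fun s => Q (s, y)) (𝓝[>] s') (𝓝 y') :=
      (hηQ.contDiffAt_curve ((habsδ hs'I).trans hδη) hyη).continuousAt.tendsto.mono_left
        nhdsWithin_le_nhds
    refine hη.orbitRank_le_of_tendsto hy'η hℓy'.ge htend ?_ hη2
    suffices hfreq : ∃ᶠ s in 𝓝[>] s', ∀ u ∈ uIcc 0 (η / 2), PreservesAt r X (P (u, Q (s, y))) by
      refine (hfreq.and_eventually (Ioo_mem_nhdsGT hs's₀)).mono ?_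
      rintro s ⟨h1, h2⟩
      exact ⟨orbitRank_eq_of_integralCurve isPreconnected_Ioc hYint ⟨h2.1, h2.2.le⟩
        ⟨hs's₀, le_rfl⟩, h1⟩
    -- otherwise the curves of `X` from all points shortly after `y'` hit `B`, so that `ℓ` vanishes
    -- along the curve of `Y` by Gronwall's inequality, and this curve cannot leave `B`
    intro hcon
    obtain ⟨s₁, hs₁, hcon⟩ := mem_nhdsGT_iff_exists_Ioc_subset.1
      (hcon.and (Ioo_mem_nhdsGT hs's₀))
    have hs₁I : ∀ s ∈ Icc s' s₁, s ∈ Icc 0 s₀ := fun s hs =>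
      ⟨hs'I.1.trans hs.1, hs.2.trans (hcon ⟨hs₁, le_rfl⟩).2.2.le⟩
    have hhit : ∀ s ∈ Ioc s' s₁, |ℓ (Y (Q (s, y)))| ≤ C * |ℓ (Q (s, y))| ∧
        (ℓ (Q (s, y)) = 0 → Q (s, y) ∈ B) := by
      intro s hs
      have h1 := (hcon hs).1
      have hsI := hs₁I s ⟨hs.1.le, hs.2⟩
      have hsη := (hball s (habs' hsI)).trans hδη
      push Not at h1
      obtain ⟨u, hu, hnot⟩ := h1
      rw [uIcc_of_le hη2.1.le] at hu
      have hu' : |u| < η := abs_lt.2 ⟨by linarith [hu.1], hu.2.trans_lt hη2.2⟩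
      refine hηB _ u hsη ⟨hu.1, hu.2.trans_lt hη2.2⟩ ?_
      by_contra hmem
      exact hnot (hηX u _ hu' hsη hmem)
    have hd : ∀ s ∈ Icc s' s₁, HasDerivAt (fun s => ℓ (Q (s, y))) (ℓ (Y (Q (s, y)))) s :=
      fun s hs => ℓ.hasFDerivAt.comp_hasDerivAt s
        (hηQ.hasDerivAt s y ((habsδ (hs₁I s hs)).trans hδη) hyη)
    have hzero := eq_zero_of_abs_deriv_le_mul_abs_self_of_eq_zero_right (K := C)
      (fun s hs => (hd s hs).continuousAt.continuousWithinAt)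
      (fun s hs => (hd s ⟨hs.1, hs.2.le⟩).hasDerivWithinAt) hℓy' (fun s hs => by
        rcases hs.1.eq_or_lt with h1 | h1
        · rw [← h1, (hℓB s' hs'I hs'B).2, ← hy'def, hℓy', norm_zero, mul_zero]
        · exact (hhit s ⟨h1, hs.2.le⟩).1)
    have hs₁m : s₁ ∈ Ioc s' s₁ := ⟨hs₁, le_rfl⟩
    exact hafter s₁ ⟨hs₁, (hs₁I s₁ ⟨hs₁.le, le_rfl⟩).2⟩
      ((hhit s₁ hs₁m).2 (hzero s₁ ⟨hs₁.le, le_rfl⟩))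
  have hP0 : P (0, y) = y := hη.zero y hyη
  -- for almost all `t` the curve of `Y` through `P (t, y)` does not meet `B`
  have key := rel_of_transport (r := r) (x := fun t => P (t, y)) (ψ := fun x => Q (s₀, x))
    (hη.contDiffAt_curve (by simpa using hη0) hyη)
    (by simpa only [hP0] using hηQ.contDiffAt_map (hs₀δ.trans hδη) hyη)
    (by simpa only [hP0] using hηQ.invertible_map (hs₀δ.trans hδη) hyη)
    (hdense y hyδ) hδ0
    (fun t ht ht' => hηQ.eventually_rel_map (hs₀δ.trans hδη) (hδP t y (hPabs ht') hyδ)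
      fun u hu => ht (hPabs ht') u (hle hs₀δ hu))
    (fun t _ ht' => by
      simpa only [hP0] using (hrank₁ t ⟨ht'.1, ht'.2.trans hδη⟩).trans hrank₂)
    (fun t _ ht' => hη.mem_orbitTangent hyη hℓy.ge ⟨ht'.1, ht'.2.trans hδη⟩)
  simp only [hP0] at key
  obtain ⟨t, h1, h2⟩ := (key.and_eventually (Ioo_mem_nhdsGT hη0)).exists
  exact hη.leavesTo hyη hℓy.ge h2 h1

lemma eventually_exists_crossesTo_of_exit_right (hB : IsClosed B) (hBF : ∀ᶠ y in 𝓝 z, y ∈ B → y ∈ F)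
    (hoff : PreservedOff K r B z) (hX : IsSectionAt K X z) (hXF : X z ∉ F)
    (hY : IsSectionAt K Y z) (hYB : ∀ᶠ y in 𝓝 z, y ∈ B → Y y ∈ F) {γ : ℝ → E} (hγ0 : γ 0 = z)
    (hγ : ∀ᶠ t in 𝓝 0, HasDerivAt γ (Y (γ t)) t) (hexit : ∃ᶠ t in 𝓝[>] 0, γ t ∉ B) :
    ∀ᶠ y in 𝓝 z, y ∈ B → ∃ c, CrossesTo F K r y c := by
  obtain ⟨g, hg, hg'⟩ := Submodule.exists_le_ker_of_notMem hXF
  set ℓ : E →L[ℝ] ℝ := ((g (X z))⁻¹ • g).toContinuousLinearMap with hℓ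
  have hF : ∀ v ∈ F, ℓ v = 0 := fun v hv => by
    have : g v = 0 := hg' hv
    simp [hℓ, this]
  have hX1 : 0 < ℓ (X z) := by simp [hℓ, hg]
  obtain ⟨Q, ε, hQ⟩ := exists_isFlowBox hY.1
  have hzε : dist z z < ε := by simpa using hQ.pos
  obtain ⟨δ, h1, h2, hδ0⟩ := ((hQ.exists_leavesTo_of_exit hB hBF hoff hF hX hX1 hY hYB).and
    ((hQ.exists_leavesTo_of_exit (ℓ := -ℓ) hB hBF hoff (fun v hv => by simp [hF v hv]) hX.neg
      (by simpa using hX1) hY hYB).and self_mem_nhdsWithin)).exists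
  obtain ⟨s, hs, h3, hsδ⟩ := (hexit.and_eventually (((hQ.eventually_eq hzε hγ0 hγ).filter_mono
    nhdsWithin_le_nhds).and (Ioo_mem_nhdsGT (show (0 : ℝ) < δ from hδ0)))).exists
  rw [h3] at hs
  have hoffF : PreservedOff K r F z := by
    filter_upwards [hoff, hBF] with y h1 h2 h3
    exact h1 fun hy => h3 (h2 hy)
  have hXF' : ∀ᶠ y in 𝓝 z, X y ∉ F :=
    hX.1.continuousAt.tendsto.eventually
      ((Submodule.closed_of_finiteDimensional F).isOpen_compl.mem_nhds hXF)
  filter_upwards [h1 s hsδ hs, h2 s hsδ hs, hoffF.eventually, hX.eventually, hXF', hBF]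
    with y k1 k2 k3 k4 k5 k6 hy
  exact ⟨_, crossesTo_of_leavesTo k3 (k6 hy) k4 k5 (k1 hy) (k2 hy)⟩

/-- If a section `Y` of `K` that is tangent to `F` at the points of `B` leads from `z` out of `B`
in arbitrarily short time, then the two sides of `F` are connected near `z`. -/
theorem eventually_exists_crossesTo_of_exit (hB : IsClosed B) (hBF : ∀ᶠ y in 𝓝 z, y ∈ B → y ∈ F)
    (hoff : PreservedOff K r B z) (hX : IsSectionAt K X z) (hXF : X z ∉ F)
    (hY : IsSectionAt K Y z) (hYB : ∀ᶠ y in 𝓝 z, y ∈ B → Y y ∈ F) {γ : ℝ → E} (hγ0 : γ 0 = z)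
    (hγ : ∀ᶠ t in 𝓝 0, HasDerivAt γ (Y (γ t)) t) (hz : z ∈ B) (hexit : ∃ᶠ t in 𝓝 0, γ t ∉ B) :
    ∀ᶠ y in 𝓝 z, y ∈ B → ∃ c, CrossesTo F K r y c := by
  have h1 : (∃ᶠ t in 𝓝[<] 0, γ t ∉ B) ∨ ∃ᶠ t in 𝓝[>] 0, γ t ∉ B := by
    rw [← frequently_sup, nhdsLT_sup_nhdsGT, frequently_nhdsWithin_iff]
    refine hexit.mono fun t ht => ⟨ht, ?_⟩
    rintro rfl
    exact ht (by rwa [hγ0])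
  rcases h1 with h1 | h1
  · have htr : Tendsto (fun t : ℝ => -t) (𝓝 0) (𝓝 0) := by
      simpa using (continuous_neg (G := ℝ)).tendsto 0
    have htr2 : Tendsto (fun t : ℝ => -t) (𝓝[<] 0) (𝓝[>] 0) := by
      simpa using tendsto_neg_nhdsLT (a := (0 : ℝ))
    refine eventually_exists_crossesTo_of_exit_right hB hBF hoff hX hXF hY.neg
      (hYB.mono fun y h hy => neg_mem (h hy)) (γ := fun t => γ (-t)) (by simpa using hγ0) ?_ ?_
    · filter_upwards [htr.eventually hγ] with t ht
      have h4 := HasDerivAt.scomp t ht (hasDerivAt_neg t)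
      rwa [neg_one_smul] at h4
    · exact htr2.frequently (p := fun t => γ (-t) ∉ B) (by simpa only [neg_neg] using h1)
  · exact eventually_exists_crossesTo_of_exit_right hB hBF hoff hX hXF hY hYB hγ0 hγ h1

/-- A curve that crosses a subspace transversally meets it in an isolated point. -/
lemma eventually_notMem_of_hasDerivAt {γ : ℝ → E} {w : E} {t : ℝ} (h : HasDerivAt γ w t)
    (hw : w ∉ F) : ∀ᶠ s in 𝓝[≠] t, γ s ∉ F := by
  obtain ⟨g, hg, hg'⟩ := Submodule.exists_le_ker_of_notMem hw
  have h2 : HasDerivAt (fun s => g.toContinuousLinearMap (γ s)) (g.toContinuousLinearMap w) t :=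
    g.toContinuousLinearMap.hasFDerivAt.comp_hasDerivAt t h
  filter_upwards [h2.eventually_ne (c := 0) hg] with s hs hmem
  exact hs (hg' hmem)

lemma eventually_notMem_sup_span {U : E → E} (hX : ContinuousAt X z) (hU : ContinuousAt U z)
    (hXF : X z ∉ F) (hUF : U z ∉ F ⊔ Submodule.span ℝ {X z}) :
    ∀ᶠ y in 𝓝 z, U y ∉ F ⊔ Submodule.span ℝ {X y} := by
  obtain ⟨f, hf, hf'⟩ := Submodule.exists_le_ker_of_notMem hUF
  obtain ⟨g, hg, hg'⟩ := Submodule.exists_le_ker_of_notMem hXF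
  have hfX : f (X z) = 0 := hf' (Submodule.mem_sup_right (Submodule.mem_span_singleton_self _))
  have hfc : Continuous f := f.continuous_of_finiteDimensional
  have hgc : Continuous g := g.continuous_of_finiteDimensional
  have hc : ContinuousAt (fun y => g (X y) * f (U y) - f (X y) * g (U y)) z :=
    ((hgc.continuousAt.comp hX).mul (hfc.continuousAt.comp hU)).sub
      ((hfc.continuousAt.comp hX).mul (hgc.continuousAt.comp hU))
  have h0 : g (X z) * f (U z) - f (X z) * g (U z) ≠ 0 := by
    rw [hfX, zero_mul, sub_zero]
    exact mul_ne_zero hg hf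
  filter_upwards [hc.eventually_ne h0] with y hy hmem
  obtain ⟨a, ha, w, hw, hy'⟩ := Submodule.mem_sup.1 hmem
  obtain ⟨s, rfl⟩ := Submodule.mem_span_singleton.1 hw
  have hfa : f a = 0 := hf' (Submodule.mem_sup_left ha)
  have hga : g a = 0 := hg' ha
  apply hy
  rw [← hy', map_add, map_add, map_smul, map_smul, hfa, hga, smul_eq_mul, smul_eq_mul]
  ring

/-- Two dimensions of `K` transversal to `F` at `z` suffice to connect the sides of `F` at all
points near `z`. -/
lemma eventually_exists_crossesTo_of_codim_two {U : E → E} (hoff : PreservedOff K r F z)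
    (hX : IsSectionAt K X z) (hXF : X z ∉ F) (hU : IsSectionAt K U z)
    (hUF : U z ∉ F ⊔ Submodule.span ℝ {X z}) :
    ∀ᶠ y in 𝓝 z, y ∈ F → ∃ c, CrossesTo F K r y c := by
  have hXF' : ∀ᶠ y in 𝓝 z, X y ∉ F :=
    hX.1.continuousAt.tendsto.eventually
      ((Submodule.closed_of_finiteDimensional F).isOpen_compl.mem_nhds hXF)
  filter_upwards [hoff.eventually, hX.eventually, hU.eventually, hXF',
    eventually_notMem_sup_span hX.1.continuousAt hU.1.continuousAt hXF hUF] with y h1 h2 h3 h4 h5 hy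
  exact exists_crossesTo_of_codim_two h1 hy h2 h4 h3 h5

end Exit

/-! ### Charts -/

section Charts

variable {E : Type*} [NormedAddCommGroup E] [NormedSpace ℝ E]
  {M : Type*} [TopologicalSpace M] [ChartedSpace E M]

/-- The value of a vector field as an element of the model space `E`, of which all tangent spaces
are copies. -/
def fieldValue (L : VField E M) (x : M) : E := L x

/-- The subspace `K x` of the tangent space as a subspace of the model space. -/
def fiber (K : Distr E M) (x : M) : Submodule ℝ E := K x

/-- The derivative of a chart, as an endomorphism of the model space. -/
noncomputable def chartDeriv (φ : OpenPartialHomeomorph M E) (x : M) : E →L[ℝ] E :=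
  mfderiv 𝓘(ℝ, E) 𝓘(ℝ, E) φ x

/-- The derivative of the inverse of a chart, as an endomorphism of the model space. -/
noncomputable def chartSymmDeriv (φ : OpenPartialHomeomorph M E) (y : E) : E →L[ℝ] E :=
  mfderiv 𝓘(ℝ, E) 𝓘(ℝ, E) φ.symm y

/-- The vector field on the model space that represents the vector field `L` in the chart `φ`. -/
noncomputable def pushField (φ : OpenPartialHomeomorph M E) (L : VField E M) (y : E) : E :=
  chartDeriv φ (φ.symm y) (fieldValue L (φ.symm y))

/-- The vector field on `M` that is represented in the chart `φ` by the vector field `L`. -/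
noncomputable def pullField (φ : OpenPartialHomeomorph M E) (L : E → E) : VField E M :=
  fun x => (chartSymmDeriv φ (φ x) (L (φ x)) : E)

/-- The family of subspaces of the model space that represents the family `K` in the chart `φ`. -/
noncomputable def pushDistr (φ : OpenPartialHomeomorph M E) (K : Distr E M) (y : E) :
    Submodule ℝ E :=
  (fiber K (φ.symm y)).comap (chartSymmDeriv φ y).toLinearMap

variable {φ : OpenPartialHomeomorph M E} {x : M} {y : E} {K : Distr E M}

lemma mem_pushDistr {w : E} : w ∈ pushDistr φ K y ↔
    chartSymmDeriv φ y w ∈ fiber K (φ.symm y) := Iff.rfl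

lemma fieldValue_pullField (L : E → E) (x : M) :
    fieldValue (pullField φ L) x = chartSymmDeriv φ (φ x) (L (φ x)) := rfl

lemma pullField_mem (hx : x ∈ φ.source) {L : E → E} (h : L (φ x) ∈ pushDistr φ K (φ x)) :
    pullField φ L x ∈ K x := by
  rw [mem_pushDistr, φ.left_inv hx] at h
  exact h

lemma mdifferentiable_chart_of_mem (hφ : φ ∈ IsManifold.maximalAtlas 𝓘(ℝ, E) 2 M) :
    φ.MDifferentiable 𝓘(ℝ, E) 𝓘(ℝ, E) :=
  ⟨(contMDiffOn_of_mem_maximalAtlas hφ).mdifferentiableOn (by norm_num),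
    (contMDiffOn_symm_of_mem_maximalAtlas hφ).mdifferentiableOn (by norm_num)⟩

variable (hφ : φ ∈ IsManifold.maximalAtlas 𝓘(ℝ, E) 2 M)
include hφ

lemma chartSymmDeriv_chartDeriv (hx : x ∈ φ.source) (v : E) :
    chartSymmDeriv φ (φ x) (chartDeriv φ x v) = v :=
  DFunLike.congr_fun ((mdifferentiable_chart_of_mem hφ).symm_comp_deriv hx) v

lemma chartDeriv_chartSymmDeriv (hy : y ∈ φ.target) (w : E) :
    chartDeriv φ (φ.symm y) (chartSymmDeriv φ y w) = w :=
  DFunLike.congr_fun ((mdifferentiable_chart_of_mem hφ).comp_symm_deriv hy) w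

lemma chartSymmDeriv_chartDeriv' (hy : y ∈ φ.target) (v : E) :
    chartSymmDeriv φ y (chartDeriv φ (φ.symm y) v) = v := by
  have h := chartSymmDeriv_chartDeriv hφ (φ.map_target hy) v
  rwa [φ.right_inv hy] at h

lemma chartDeriv_chartSymmDeriv' (hx : x ∈ φ.source) (w : E) :
    chartDeriv φ x (chartSymmDeriv φ (φ x) w) = w := by
  have h := chartDeriv_chartSymmDeriv hφ (φ.map_source hx) w
  rwa [φ.left_inv hx] at h

lemma isInvertible_chartDeriv (hx : x ∈ φ.source) : (chartDeriv φ x).IsInvertible :=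
  ⟨.equivOfInverse (chartDeriv φ x) (chartSymmDeriv φ (φ x)) (chartSymmDeriv_chartDeriv hφ hx)
    (chartDeriv_chartSymmDeriv' hφ hx), rfl⟩

lemma isInvertible_chartSymmDeriv (hy : y ∈ φ.target) : (chartSymmDeriv φ y).IsInvertible :=
  ⟨.equivOfInverse (chartSymmDeriv φ y) (chartDeriv φ (φ.symm y)) (chartDeriv_chartSymmDeriv hφ hy)
    (chartSymmDeriv_chartDeriv' hφ hy), rfl⟩

lemma inverse_chartDeriv (hx : x ∈ φ.source) :
    (chartDeriv φ x).inverse = chartSymmDeriv φ (φ x) := by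
  ext w
  rw [(isInvertible_chartDeriv hφ hx).inverse_apply_eq, chartDeriv_chartSymmDeriv' hφ hx]

lemma inverse_chartSymmDeriv (hy : y ∈ φ.target) :
    (chartSymmDeriv φ y).inverse = chartDeriv φ (φ.symm y) := by
  ext w
  rw [(isInvertible_chartSymmDeriv hφ hy).inverse_apply_eq, chartSymmDeriv_chartDeriv' hφ hy]

lemma pushField_mem (hy : y ∈ φ.target) {L : VField E M} (h : L (φ.symm y) ∈ K (φ.symm y)) :
    pushField φ L y ∈ pushDistr φ K y := by
  rw [mem_pushDistr, pushField, chartSymmDeriv_chartDeriv' hφ hy]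
  exact h

variable [IsManifold 𝓘(ℝ, E) 2 M] [FiniteDimensional ℝ E]

lemma contDiffAt_pushField {U : Set M} (hU : IsOpen U) {L : VField E M} (hL : IsC1On L U)
    (hy : y ∈ φ.target) (hyU : φ.symm y ∈ U) : ContDiffAt ℝ 1 (pushField φ L) y := by
  have : CompleteSpace E := FiniteDimensional.complete ℝ E
  have : IsManifold 𝓘(ℝ, E) 1 M := IsManifold.of_le (n := 2) (by norm_num)
  have hi := isInvertible_chartSymmDeriv hφ hy
  have h1 := ContMDiffAt.mpullback_vectorField_preimage (I := 𝓘(ℝ, E)) (I' := 𝓘(ℝ, E)) (m := 1)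
    (n := 2) (V := L) (hL.contMDiffAt (hU.mem_nhds hyU))
    (contMDiffAt_symm_of_mem_maximalAtlas hφ hy) hi (by norm_num)
  have h2 := contMDiffAt_vectorSpace_iff_contDiffAt.1 h1
  refine ContDiffAt.congr_of_eventuallyEq (f := fun y => (chartSymmDeriv φ y).inverse
    (fieldValue L (φ.symm y))) h2 ?_
  filter_upwards [φ.open_target.mem_nhds hy] with y' hy'
  rw [inverse_chartSymmDeriv hφ hy', pushField]

lemma contMDiffAt_pullField {L : E → E} (hx : x ∈ φ.source) (hL : ContDiffAt ℝ 1 L (φ x)) :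
    ContMDiffAt 𝓘(ℝ, E) (𝓘(ℝ, E)).tangent 1
      (fun x => (⟨x, pullField φ L x⟩ : TangentBundle 𝓘(ℝ, E) M)) x := by
  have : CompleteSpace E := FiniteDimensional.complete ℝ E
  have : IsManifold 𝓘(ℝ, E) 1 M := IsManifold.of_le (n := 2) (by norm_num)
  have hi := isInvertible_chartDeriv hφ hx
  have h1 := ContMDiffAt.mpullback_vectorField_preimage (I := 𝓘(ℝ, E)) (I' := 𝓘(ℝ, E)) (m := 1)
    (n := 2) (V := L) (contMDiffAt_vectorSpace_iff_contDiffAt.2 hL)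
    (contMDiffAt_of_mem_maximalAtlas hφ hx) hi (by norm_num)
  refine h1.congr_of_eventuallyEq ?_
  filter_upwards [φ.open_source.mem_nhds hx] with x' hx'
  have h2 : fieldValue (pullField φ L) x' = (chartDeriv φ x').inverse (L (φ x')) := by
    rw [inverse_chartDeriv hφ hx', fieldValue_pullField]
  exact congrArg (fun v : E => (⟨x', v⟩ : TangentBundle 𝓘(ℝ, E) M)) h2

end Charts

/-! ### Curves, orbits and submanifolds in charts -/

section Curves

variable {E : Type*} [NormedAddCommGroup E] [NormedSpace ℝ E]
  {M : Type*} [TopologicalSpace M] [ChartedSpace E M]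

/-- The curve `γ` has the velocity `v` at the time `t`. -/
def HasVelocityAt (γ : ℝ → M) (v : E) (t : ℝ) : Prop :=
  HasMFDerivAt 𝓘(ℝ, ℝ) 𝓘(ℝ, E) γ t ((1 : ℝ →L[ℝ] ℝ).smulRight v : ℝ →L[ℝ] E)

lemma isMIntegralCurveOn_iff_hasVelocityAt {γ : ℝ → M} {L : VField E M} {a b : ℝ} :
    IsMIntegralCurveOn γ L (Ioo a b) ↔
      ∀ t ∈ Ioo a b, HasVelocityAt γ (fieldValue L (γ t)) t :=
  ⟨fun h t ht => (h t ht).hasMFDerivAt (isOpen_Ioo.mem_nhds ht),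
    fun h t ht => HasMFDerivAt.hasMFDerivWithinAt (h t ht)⟩

lemma HasVelocityAt.continuousAt {γ : ℝ → M} {v : E} {t : ℝ} (h : HasVelocityAt γ v t) :
    ContinuousAt γ t := HasMFDerivAt.continuousAt h

variable {φ : OpenPartialHomeomorph M E} (hφ : φ ∈ IsManifold.maximalAtlas 𝓘(ℝ, E) 2 M)
include hφ

lemma HasVelocityAt.hasDerivAt {γ : ℝ → M} {v : E} {t : ℝ} (h : HasVelocityAt γ v t)
    (ht : γ t ∈ φ.source) : HasDerivAt (fun s => φ (γ s)) (chartDeriv φ (γ t) v) t := by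
  have h1 : HasMFDerivAt 𝓘(ℝ, E) 𝓘(ℝ, E) φ (γ t) (chartDeriv φ (γ t) : E →L[ℝ] E) :=
    ((mdifferentiable_chart_of_mem hφ).mdifferentiableAt ht).hasMFDerivAt
  have h2 : HasFDerivAt (fun s => φ (γ s))
      (chartDeriv φ (γ t) ∘L ((1 : ℝ →L[ℝ] ℝ).smulRight v)) t :=
    hasMFDerivAt_iff_hasFDerivAt.1 (HasMFDerivAt.comp t h1 h)
  have h3 := h2.hasDerivAt
  simpa using h3

lemma hasVelocityAt_symm_comp {γ : ℝ → E} {w : E} {t : ℝ} (h : HasDerivAt γ w t)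
    (ht : γ t ∈ φ.target) :
    HasVelocityAt (fun s => φ.symm (γ s)) (chartSymmDeriv φ (γ t) w) t := by
  have h1 : HasMFDerivAt 𝓘(ℝ, E) 𝓘(ℝ, E) φ.symm (γ t)
      (chartSymmDeriv φ (γ t) : E →L[ℝ] E) :=
    ((mdifferentiable_chart_of_mem hφ).mdifferentiableAt_symm ht).hasMFDerivAt
  have h2 : HasMFDerivAt 𝓘(ℝ, ℝ) 𝓘(ℝ, E) (fun s => φ.symm (γ s)) t
      (chartSymmDeriv φ (γ t) ∘L ((1 : ℝ →L[ℝ] ℝ).smulRight w) : ℝ →L[ℝ] E) :=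
    HasMFDerivAt.comp t h1 (hasMFDerivAt_iff_hasFDerivAt.2 h.hasFDerivAt)
  have h3 : chartSymmDeriv φ (γ t) ∘L ((1 : ℝ →L[ℝ] ℝ).smulRight w)
      = (1 : ℝ →L[ℝ] ℝ).smulRight (chartSymmDeriv φ (γ t) w) := by
    ext; simp
  rw [h3] at h2
  exact h2

end Curves

section FlowSteps

variable {E : Type*} [NormedAddCommGroup E] [NormedSpace ℝ E]
  {M : Type*} [TopologicalSpace M] [ChartedSpace E M] {S : Set M → VField E M → Prop} {W : Set M}

lemma flowStep_of_curve {U : Set M} (hU : IsOpen U) (hUW : U ⊆ W) {L : VField E M} (hS : S U L)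
    {γ : ℝ → M} {a b : ℝ}
    (hγ : ∀ t ∈ Ioo a b, HasVelocityAt γ (fieldValue L (γ t)) t ∧ γ t ∈ U) {s t : ℝ}
    (hs : s ∈ Ioo a b) (ht : t ∈ Ioo a b) : FlowStep S W (γ s) (γ t) := by
  have h1 := (isMIntegralCurveOn_iff_hasVelocityAt.2 fun t ht => (hγ t ht).1).comp_add s
  refine ⟨U, L, hU, hUW, hS, γ ∘ (· + s), a - s, b - s, t - s,
    ⟨by linarith [hs.1], by linarith [hs.2]⟩, ⟨by linarith [ht.1], by linarith [ht.2]⟩,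
    h1.mono fun u hu => ⟨by linarith [hu.1], by linarith [hu.2]⟩, fun u hu => ?_, by simp, by simp⟩
  exact (hγ (u + s) ⟨by linarith [hu.1], by linarith [hu.2]⟩).2

lemma FlowStep.symm {p q : M} (h : FlowStep S W p q) : FlowStep S W q p := by
  obtain ⟨U, L, hU, hUW, hS, γ, a, b, t, h0, ht, hγ, hγU, rfl, rfl⟩ := h
  exact flowStep_of_curve hU hUW hS
    (fun s hs => ⟨isMIntegralCurveOn_iff_hasVelocityAt.1 hγ s hs, hγU s hs⟩) ht h0

lemma mem_orbit_self (p : M) : p ∈ orbit S W p := Relation.ReflTransGen.refl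

lemma FlowStep.orbit_eq {p q : M} (h : FlowStep S W p q) : orbit S W p = orbit S W q := by
  ext x
  exact ⟨fun hx => Relation.ReflTransGen.head h.symm hx, fun hx => Relation.ReflTransGen.head h hx⟩

lemma FlowStep.mono {W' : Set M} (hW : W ⊆ W') {p q : M} (h : FlowStep S W p q) :
    FlowStep S W' p q := by
  obtain ⟨U, L, hU, hUW, h⟩ := h
  exact ⟨U, L, hU, hUW.trans hW, h⟩

lemma orbit_mono {W' : Set M} (hW : W ⊆ W') {p : M} : orbit S W p ⊆ orbit S W' p :=
  fun _ h => Relation.ReflTransGen.mono (fun _ _ h => FlowStep.mono hW h) _ _ h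

lemma FlowStep.right_mem {p q : M} (h : FlowStep S W p q) : q ∈ W := by
  obtain ⟨U, L, -, hUW, -, γ, a, b, t, -, ht, -, hγU, -, rfl⟩ := h
  exact hUW (hγU t ht)

lemma orbit_subset {p : M} (hp : p ∈ W) : orbit S W p ⊆ W := by
  intro q hq
  induction hq with
  | refl => exact hp
  | tail _ h _ => exact h.right_mem

end FlowSteps

section Ranks

variable {E : Type*} [NormedAddCommGroup E] [NormedSpace ℝ E]
  {M : Type*} [TopologicalSpace M] [ChartedSpace E M] {φ : OpenPartialHomeomorph M E}
  {K : Distr E M} {y : E}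

lemma finrank_pushDistr (hφ : φ ∈ IsManifold.maximalAtlas 𝓘(ℝ, E) 2 M) (hy : y ∈ φ.target) :
    Module.finrank ℝ (pushDistr φ K y) = Module.finrank ℝ (fiber K (φ.symm y)) := by
  obtain ⟨e, he⟩ := isInvertible_chartSymmDeriv hφ hy
  have h1 : pushDistr φ K y = (fiber K (φ.symm y)).map e.symm.toLinearEquiv.toLinearMap := by
    rw [pushDistr, ← he]
    exact Submodule.comap_equiv_eq_map_symm e.toLinearEquiv _
  rw [h1]
  exact LinearEquiv.finrank_map_eq e.symm.toLinearEquiv _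

lemma IsC1Subbundle.finrank_fiber [IsManifold 𝓘(ℝ, E) 2 M] {m : ℕ} (hK : IsC1Subbundle m K)
    (x : M) :
    Module.finrank ℝ (fiber K x) = m := by
  obtain ⟨U, hU, hyU, X, hX, hspan⟩ := hK x
  have h1 : LinearIndependent ℝ (fun i => fieldValue (X i) x) := (hspan x hyU).1
  have h2 : Submodule.span ℝ (range fun i => fieldValue (X i) x) = fiber K x := (hspan x hyU).2
  rw [← h2, finrank_span_eq_card h1, Fintype.card_fin]

end Ranks

section Sections

variable {E : Type*} [NormedAddCommGroup E] [NormedSpace ℝ E] [FiniteDimensional ℝ E]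
  {M : Type*} [TopologicalSpace M] [ChartedSpace E M] [IsManifold 𝓘(ℝ, E) 2 M]
  {φ : OpenPartialHomeomorph M E} (hφ : φ ∈ IsManifold.maximalAtlas 𝓘(ℝ, E) 2 M)
  {K : Distr E M} {x : M} {y : E}
include hφ

lemma IsSectionOn.isSectionAt {U : Set M} (hU : IsOpen U) {L : VField E M}
    (hL : IsSectionOn K U L) (hy : y ∈ φ.target) (hyU : φ.symm y ∈ U) :
    IsSectionAt (pushDistr φ K) (pushField φ L) y := by
  refine ⟨contDiffAt_pushField hφ hU hL.1 hy hyU, ?_⟩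
  filter_upwards [φ.open_target.mem_nhds hy,
    (φ.continuousAt_symm hy).preimage_mem_nhds (hU.mem_nhds hyU)] with y' h1 h2
  exact pushField_mem hφ h1 (hL.2 _ h2)

lemma IsSectionAt.exists_isSectionOn {L : E → E} (hy : y ∈ φ.target)
    (h : IsSectionAt (pushDistr φ K) L y) {W : Set M} (hW : W ∈ 𝓝 (φ.symm y)) :
    ∃ U, IsOpen U ∧ φ.symm y ∈ U ∧ U ⊆ W ∩ φ.source ∧ IsSectionOn K U (pullField φ L) := by
  have hx := φ.map_target hy
  have hc : Tendsto φ (𝓝 (φ.symm y)) (𝓝 y) := by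
    have := (φ.continuousAt hx).tendsto
    rwa [φ.right_inv hy] at this
  obtain ⟨U, hU, hUo, hyU⟩ := eventually_nhds_iff.1
    ((hc.eventually h.eventually).and (Filter.inter_mem hW (φ.open_source.mem_nhds hx)))
  refine ⟨U, hUo, hyU, fun x hx => (hU x hx).2, fun x hx => ?_, fun x hx => ?_⟩
  · exact (contMDiffAt_pullField hφ (hU x hx).2.2 (hU x hx).1.1).contMDiffWithinAt
  · exact pullField_mem (hU x hx).2.2 (hU x hx).1.2.self_of_nhds

/-- A `C^1` subbundle has sections with given values. -/
lemma IsC1Subbundle.exists_isSectionAt {m : ℕ} (hK : IsC1Subbundle m K) (hy : y ∈ φ.target)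
    {w : E} (hw : w ∈ pushDistr φ K y) :
    ∃ L, IsSectionAt (pushDistr φ K) L y ∧ L y = w := by
  obtain ⟨U, hU, hyU, X, hX, hspan⟩ := hK (φ.symm y)
  have h1 : ∀ i, IsSectionAt (pushDistr φ K) (pushField φ (X i)) y := fun i =>
    IsSectionOn.isSectionAt hφ hU ⟨hX i, fun x hx => by
      rw [← (hspan x hx).2]
      exact Submodule.subset_span ⟨i, rfl⟩⟩ hy hyU
  have h2 : chartSymmDeriv φ y w ∈
      Submodule.span ℝ (range fun i => fieldValue (X i) (φ.symm y)) := by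
    have h3 := (hspan _ hyU).2
    have h4 : chartSymmDeriv φ y w ∈ fiber K (φ.symm y) := hw
    unfold fiber at h4
    rw [← h3] at h4
    exact h4
  obtain ⟨c, hc⟩ := (Submodule.mem_span_range_iff_exists_fun ℝ).1 h2
  refine ⟨fun y => ∑ i, c i • pushField φ (X i) y, ⟨?_, ?_⟩, ?_⟩
  · exact ContDiffAt.sum fun i _ => (h1 i).1.const_smul (c i)
  · filter_upwards [eventually_all.2 fun i => (h1 i).2] with y' h
    exact sum_mem fun i _ => Submodule.smul_mem _ _ (h i)
  · have h5 := congrArg (chartDeriv φ (φ.symm y)) hc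
    rw [chartDeriv_chartSymmDeriv hφ hy, map_sum] at h5
    simpa only [pushField, map_smul] using h5

end Sections

section Adapted

variable {E : Type*} [NormedAddCommGroup E] [NormedSpace ℝ E]
  {M : Type*} [TopologicalSpace M] [ChartedSpace E M]

/-- The chart `φ` maps `N` to the linear subspace `F` of the model space. -/
structure IsAdaptedChart (N : Set M) (F : Submodule ℝ E) (φ : OpenPartialHomeomorph M E) :
    Prop where
  mem_atlas : φ ∈ IsManifold.maximalAtlas 𝓘(ℝ, E) 2 M
  mem_iff : ∀ x ∈ φ.source, x ∈ N ↔ φ x ∈ F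

variable {N : Set M} {F : Submodule ℝ E} {φ : OpenPartialHomeomorph M E}
  (h : IsAdaptedChart N F φ)
include h

lemma IsAdaptedChart.symm_mem_iff {y : E} (hy : y ∈ φ.target) : φ.symm y ∈ N ↔ y ∈ F := by
  rw [h.mem_iff _ (φ.map_target hy), φ.right_inv hy]

/-- The tangent spaces of a submanifold, defined by velocities of curves, are represented in an
adapted chart by the subspace `F`. -/
lemma IsAdaptedChart.pushDistr_tangentTo [FiniteDimensional ℝ E] {y : E} (hy : y ∈ φ.target)
    (hyF : y ∈ F) :
    pushDistr φ (tangentTo N) y = F := by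
  have hφ := h.mem_atlas
  apply le_antisymm
  · have hle : fiber (tangentTo N) (φ.symm y) ≤ F.comap (chartDeriv φ (φ.symm y)).toLinearMap := by
      refine Submodule.span_le.2 ?_
      rintro (v : E) ⟨γ, hγ0, hγN, hγ⟩
      have hγ' : HasVelocityAt (E := E) γ v 0 := hγ
      have hsrc : γ 0 ∈ φ.source := by rw [hγ0]; exact φ.map_target hy
      have h1 := hγ'.hasDerivAt hφ hsrc
      change chartDeriv φ (φ.symm y) v ∈ F
      rw [hγ0] at h1
      by_contra hnot
      obtain ⟨g, hg, hg'⟩ := Submodule.exists_le_ker_of_notMem hnot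
      apply hg
      have h2 : HasDerivAt (fun t => g.toContinuousLinearMap (φ (γ t)))
          (g.toContinuousLinearMap (chartDeriv φ (φ.symm y) v)) 0 :=
        g.toContinuousLinearMap.hasFDerivAt.comp_hasDerivAt 0 h1
      refine h2.unique ((hasDerivAt_const (0 : ℝ) (0 : ℝ)).congr_of_eventuallyEq ?_)
      filter_upwards [hγN, hγ'.continuousAt.preimage_mem_nhds (φ.open_source.mem_nhds hsrc)]
        with t h3 h4
      exact hg' ((h.mem_iff _ h4).1 h3)
    intro w hw
    have h1 := hle hw
    rwa [Submodule.mem_comap, ContinuousLinearMap.coe_coe, ContinuousLinearMap.coe_coe,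
      chartDeriv_chartSymmDeriv hφ hy] at h1
  · intro w hw
    refine Submodule.subset_span ?_
    have hd : HasDerivAt (fun t : ℝ => y + t • w) w 0 := by
      simpa using ((hasDerivAt_id (0 : ℝ)).smul_const w).const_add y
    have h0 : y + (0 : ℝ) • w = y := by simp
    refine ⟨fun t => φ.symm (y + t • w), by simp, ?_, ?_⟩
    · have h1 : ∀ᶠ t : ℝ in 𝓝 0, y + t • w ∈ φ.target :=
        hd.continuousAt.preimage_mem_nhds (φ.open_target.mem_nhds (by rwa [h0]))
      filter_upwards [h1] with t ht
      exact (h.symm_mem_iff ht).2 (add_mem hyF (F.smul_mem t hw))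
    · have h2 := hasVelocityAt_symm_comp hφ hd (by rwa [h0])
      rw [h0] at h2
      exact h2

end Adapted

/-! ### Classes of points and the orbit decomposition -/

section Classes

variable {E : Type*} [NormedAddCommGroup E] [NormedSpace ℝ E]
  {M : Type*} [TopologicalSpace M] [ChartedSpace E M] [IsManifold 𝓘(ℝ, E) 2 M]

/-- All curves that cross `N` at `x` along a section of `K` transversal to `N` run near `x` in the
orbit `C` of the complement of `N`. As with `CrossesTo`, it suffices to consider positive times. -/
def IsCrossingClass (K : Distr E M) (N : Set M) (x : M) (C : Set M) : Prop :=
  ∀ (U : Set M) (L : VField E M) (γ : ℝ → M), IsOpen U → x ∈ U → IsSectionOn K U L →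
    fieldValue L x ∉ fiber (tangentTo N) x → γ 0 = x →
    (∀ᶠ t in 𝓝 0, HasVelocityAt γ (fieldValue L (γ t)) t) →
    ∀ᶠ t in 𝓝[>] 0, γ t ∉ N → orbit (IsSectionOn K) Nᶜ (γ t) = C

open Classical in
/-- The orbit in the complement of `N` to which the point `x` is assigned: its own orbit if `x` is
not in `N`, and the common orbit of the curves crossing `N` at `x` if `x` is in `N` and these curves
have a common orbit. The remaining points are collected in a class of their own. -/
noncomputable def orbitClass (K : Distr E M) (N : Set M) (x : M) : Set M :=
  if x ∈ N then if h : ∃ C, IsCrossingClass K N x C then h.choose else ∅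
  else orbit (IsSectionOn K) Nᶜ x

/-- The relation of belonging to the same class, in a chart. -/
noncomputable def classSetoid (φ : OpenPartialHomeomorph M E) (K : Distr E M) (N : Set M) :
    Setoid E :=
  Setoid.ker fun y => orbitClass K N (φ.symm y)

variable {K : Distr E M} {N : Set M} {φ : OpenPartialHomeomorph M E} {F : Submodule ℝ E} {x : M}
  {y z c : E}

lemma classSetoid_iff {y y' : E} : classSetoid φ K N y y' ↔
    orbitClass K N (φ.symm y) = orbitClass K N (φ.symm y') := Iff.rfl

lemma orbitClass_of_notMem (hx : x ∉ N) : orbitClass K N x = orbit (IsSectionOn K) Nᶜ x :=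
  if_neg hx

lemma isCrossingClass_orbitClass (hx : x ∈ N) (h : ∃ C, IsCrossingClass K N x C) :
    IsCrossingClass K N x (orbitClass K N x) := by
  rw [orbitClass, if_pos hx, dif_pos h]
  exact h.choose_spec

/-- Integral curves of sections of `K` stay in their class while they do not meet `N`. -/
lemma orbitClass_eq_of_curve {U : Set M} (hU : IsOpen U) (hUN : U ⊆ Nᶜ) {L : VField E M}
    (hL : IsSectionOn K U L) {γ : ℝ → M} {a b : ℝ}
    (hγ : ∀ t ∈ Ioo a b, HasVelocityAt γ (fieldValue L (γ t)) t ∧ γ t ∈ U) {s t : ℝ}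
    (hs : s ∈ Ioo a b) (ht : t ∈ Ioo a b) : orbitClass K N (γ s) = orbitClass K N (γ t) := by
  rw [orbitClass_of_notMem (hUN (hγ s hs).2), orbitClass_of_notMem (hUN (hγ t ht).2)]
  exact (flowStep_of_curve hU hUN hL hγ hs ht).orbit_eq

omit [IsManifold 𝓘(ℝ, E) 2 M] in
lemma fieldValue_pullField_symm (hy : y ∈ φ.target) (L : E → E) :
    fieldValue (pullField φ L) (φ.symm y) = chartSymmDeriv φ y (L y) := by
  rw [fieldValue_pullField, φ.right_inv hy]

omit [NormedSpace ℝ E] [ChartedSpace E M] [IsManifold 𝓘(ℝ, E) 2 M] in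
lemma eventually_chart {p : M → Prop} (hy : y ∈ φ.target) (h : ∀ᶠ x in 𝓝 (φ.symm y), p x) :
    ∀ᶠ y' in 𝓝 y, p (φ.symm y') :=
  (φ.continuousAt_symm hy).tendsto.eventually h

omit [NormedSpace ℝ E] [ChartedSpace E M] [IsManifold 𝓘(ℝ, E) 2 M] in
lemma eventually_of_chart {p : M → Prop} (hx : x ∈ φ.source)
    (h : ∀ᶠ y in 𝓝 (φ x), p (φ.symm y)) : ∀ᶠ x' in 𝓝 x, p x' := by
  filter_upwards [(φ.continuousAt hx).tendsto.eventually h, φ.open_source.mem_nhds hx]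
    with x' h1 h2
  rwa [φ.left_inv h2] at h1

variable [FiniteDimensional ℝ E] (hF : IsAdaptedChart N F φ)
include hF

lemma preservedOff_classSetoid (hN : IsClosed N) (hz : z ∈ φ.target) :
    PreservedOff (pushDistr φ K) (classSetoid φ K N) F z := by
  filter_upwards [φ.open_target.mem_nhds hz] with y hy hyF L hL
  have hyN : φ.symm y ∉ N := fun h => hyF ((hF.symm_mem_iff hy).1 h)
  obtain ⟨U, hU, hyU, hUN, hLU⟩ :=
    hL.exists_isSectionOn hF.mem_atlas hy (hN.isOpen_compl.mem_nhds hyN)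
  refine ⟨_, Filter.inter_mem (φ.open_target.mem_nhds hy)
    ((φ.continuousAt_symm hy).preimage_mem_nhds (hU.mem_nhds hyU)), fun γ a b hγ s hs t ht => ?_⟩
  refine orbitClass_eq_of_curve (γ := fun t => φ.symm (γ t)) hU (fun x hx => (hUN hx).1) hLU
    (fun u hu => ⟨?_, (hγ u hu).2.2⟩) hs ht
  rw [fieldValue_pullField_symm (hγ u hu).2.1]
  exact hasVelocityAt_symm_comp hF.mem_atlas (hγ u hu).1 (hγ u hu).2.1

lemma crossesTo_classSetoid (hy : y ∈ φ.target) (hyF : y ∈ F)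
    (h : ∃ C, IsCrossingClass K N (φ.symm y) C) :
    CrossesTo F (pushDistr φ K) (classSetoid φ K N) y y := by
  have hyN : φ.symm y ∈ N := (hF.symm_mem_iff hy).2 hyF
  intro L hL hLF γ hγ0 hγ
  obtain ⟨U, hU, hyU, -, hLU⟩ := hL.exists_isSectionOn hF.mem_atlas hy univ_mem
  have hγt : ∀ᶠ t in 𝓝 0, γ t ∈ φ.target :=
    hγ.self_of_nhds.continuousAt.preimage_mem_nhds (φ.open_target.mem_nhds (by rwa [hγ0]))
  have h1 := isCrossingClass_orbitClass hyN h U _ (fun t => φ.symm (γ t)) hU hyU hLU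
    (by
      rw [fieldValue_pullField_symm hy, ← mem_pushDistr, hF.pushDistr_tangentTo hy hyF]
      exact hLF) (by rw [hγ0])
    (by
      filter_upwards [hγ, hγt] with t h1 h2
      rw [fieldValue_pullField_symm h2]
      exact hasVelocityAt_symm_comp hF.mem_atlas h1 h2)
  have h0 := hγ.self_of_nhds
  rw [hγ0] at h0
  have hle : 𝓝[>] (0 : ℝ) ≤ 𝓝[≠] 0 := nhdsWithin_mono _ fun t (ht : 0 < t) => ht.ne'
  filter_upwards [h1, (eventually_notMem_of_hasDerivAt h0 hLF).filter_mono hle,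
    hγt.filter_mono nhdsWithin_le_nhds] with t h2 h3 h4
  have h5 : φ.symm (γ t) ∉ N := fun h => h3 ((hF.symm_mem_iff h4).1 h)
  rw [classSetoid_iff, orbitClass_of_notMem h5]
  exact h2 h5

lemma exists_isCrossingClass (hy : y ∈ φ.target) (hyF : y ∈ F)
    (h : CrossesTo F (pushDistr φ K) (classSetoid φ K N) y c) :
    ∃ C, IsCrossingClass K N (φ.symm y) C := by
  refine ⟨orbitClass K N (φ.symm c), fun U L γ hU hyU hL hLN hγ0 hγ => ?_⟩
  have hγs : ∀ᶠ t in 𝓝 0, γ t ∈ φ.source :=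
    hγ.self_of_nhds.continuousAt.preimage_mem_nhds
      (φ.open_source.mem_nhds (by rw [hγ0]; exact φ.map_target hy))
  have h1 := h (pushField φ L) (hL.isSectionAt hF.mem_atlas hU hy hyU)
    (by
      rwa [← hF.pushDistr_tangentTo hy hyF, mem_pushDistr, pushField,
        chartSymmDeriv_chartDeriv' hF.mem_atlas hy])
    (fun t => φ (γ t)) (by rw [hγ0, φ.right_inv hy])
    (by
      filter_upwards [hγ, hγs] with t h1 h2
      rw [pushField, φ.left_inv h2]
      exact h1.hasDerivAt hF.mem_atlas h2)
  filter_upwards [h1, hγs.filter_mono nhdsWithin_le_nhds] with t h2 h3 h4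
  rw [classSetoid_iff, φ.left_inv h3, orbitClass_of_notMem h4] at h2
  exact h2

lemma exists_transverse_section {m : ℕ} (hK : IsC1Subbundle m K)
    (hKN : ∀ p ∈ N, ¬ K p ≤ tangentTo N p) (hy : y ∈ φ.target) (hyF : y ∈ F) :
    ∃ X, IsSectionAt (pushDistr φ K) X y ∧ X y ∉ F := by
  obtain ⟨(v : E), hv, hvN⟩ := SetLike.not_le_iff_exists.1 (hKN _ ((hF.symm_mem_iff hy).2 hyF))
  obtain ⟨X, hX, hXy⟩ := hK.exists_isSectionAt hF.mem_atlas hy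
    (w := chartDeriv φ (φ.symm y) v) (by
      rw [mem_pushDistr, chartSymmDeriv_chartDeriv' hF.mem_atlas hy]
      exact hv)
  refine ⟨X, hX, ?_⟩
  rw [hXy, ← hF.pushDistr_tangentTo hy hyF, mem_pushDistr,
    chartSymmDeriv_chartDeriv' hF.mem_atlas hy]
  exact hvN

/-- Near a point of `N` that is not exceptional, all points of `N` have a crossing class. -/
lemma eventually_exists_crossesTo_of_notMem_excSet {m : ℕ} (hK : IsC1Subbundle m K)
    (hKN : ∀ p ∈ N, ¬ K p ≤ tangentTo N p) (hN : IsClosed N) (hy : y ∈ φ.target) (hyF : y ∈ F)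
    (hexc : φ.symm y ∉ excSet m K N) : ∀ᶠ y' in 𝓝 y, y' ∈ F →
      ∃ c, CrossesTo F (pushDistr φ K) (classSetoid φ K N) y' c := by
  obtain ⟨X, hX, hXF⟩ := exists_transverse_section hF hK hKN hy hyF
  have hXK : X y ∈ pushDistr φ K y := hX.2.self_of_nhds
  have hrank : Module.finrank ℝ (pushDistr φ K y) = m := by
    rw [finrank_pushDistr hF.mem_atlas hy, hK.finrank_fiber]
  have hrank' : Module.finrank ℝ (pushDistr φ K y ⊓ F : Submodule ℝ E) + 1 ≠ m := by
    intro h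
    refine hexc ⟨(hF.symm_mem_iff hy).2 hyF, ?_⟩
    rw [← hF.pushDistr_tangentTo hy hyF] at h
    have h1 := finrank_pushDistr (K := fun x => K x ⊓ tangentTo N x) hF.mem_atlas hy
    have h2 : pushDistr φ (fun x => K x ⊓ tangentTo N x) y
        = pushDistr φ K y ⊓ pushDistr φ (tangentTo N) y := rfl
    rw [h2] at h1
    rw [h1] at h
    exact h
  have hnot : ¬ pushDistr φ K y ≤ F ⊔ Submodule.span ℝ {X y} := by
    intro hle
    apply hrank'
    have h1 : Submodule.span ℝ {X y} ≤ pushDistr φ K y := by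
      rwa [Submodule.span_singleton_le_iff_mem]
    have h2 : pushDistr φ K y = (pushDistr φ K y ⊓ F) ⊔ Submodule.span ℝ {X y} := by
      rw [inf_sup_assoc_of_le F h1, inf_eq_left.2 hle]
    have h3 : X y ∉ pushDistr φ K y ⊓ F := fun h => hXF h.2
    rw [← Submodule.finrank_sup_span_singleton h3, ← h2, hrank]
  obtain ⟨u, huK, hu⟩ := SetLike.not_le_iff_exists.1 hnot
  obtain ⟨U, hU, rfl⟩ := hK.exists_isSectionAt hF.mem_atlas hy huK
  exact eventually_exists_crossesTo_of_codim_two (preservedOff_classSetoid hF hN hy) hX hXF hU hu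

/-- Outside a closed set that contains all points of `N` without a crossing class, all sections of
`K` preserve the classes. -/
lemma preservedOff_of_forall_isCrossingClass {m : ℕ} (hK : IsC1Subbundle m K)
    (hKN : ∀ p ∈ N, ¬ K p ≤ tangentTo N p) (hN : IsClosed N) {B : Set M} (hB : IsClosed B)
    (hgood : ∀ x ∈ N, x ∉ B → ∃ C, IsCrossingClass K N x C) (hz : z ∈ φ.target) :
    PreservedOff (pushDistr φ K) (classSetoid φ K N) (φ.target ∩ φ.symm ⁻¹' Bᶜ)ᶜ z := by
  filter_upwards [φ.open_target.mem_nhds hz] with y hy hyB L hL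
  rw [notMem_compl_iff] at hyB
  refine preservesAt_of_crossesTo (preservedOff_classSetoid hF hN hy) ?_
    (exists_transverse_section hF hK hKN hy) hL
  filter_upwards [φ.open_target.mem_nhds hy,
    eventually_chart hy (hB.isOpen_compl.mem_nhds hyB.2)] with y' h1 h2 h3
  exact crossesTo_classSetoid hF h1 h3 (hgood _ ((hF.symm_mem_iff h1).2 h3) h2)

omit hF in
/-- If all points of `N` have a crossing class, then the flows of the sections of `K` preserve the
classes. -/
lemma orbitClass_eq_of_flowStep {m : ℕ} (hK : IsC1Subbundle m K)
    (hKN : ∀ p ∈ N, ¬ K p ≤ tangentTo N p) (hN : IsClosed N)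
    (hchart : ∀ p ∈ N, ∃ (F : Submodule ℝ E) (φ : OpenPartialHomeomorph M E),
      IsAdaptedChart N F φ ∧ p ∈ φ.source)
    (hgood : ∀ x ∈ N, ∃ C, IsCrossingClass K N x C) {p q : M}
    (h : FlowStep (IsSectionOn K) univ p q) : orbitClass K N p = orbitClass K N q := by
  obtain ⟨U, L, hU, -, hL, γ, a, b, t, h0, ht, hγ, hγU, rfl, rfl⟩ := h
  rw [isMIntegralCurveOn_iff_hasVelocityAt] at hγ
  refine rel_of_eventually_rel (r := Setoid.ker (orbitClass K N)) (γ := γ) isPreconnected_Ioo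
    (fun s hs => ?_) h0 ht
  change ∀ᶠ u in 𝓝 s, orbitClass K N (γ u) = orbitClass K N (γ s)
  have hc := (hγ s hs).continuousAt
  by_cases hsN : γ s ∈ N
  · obtain ⟨F, φ, hF, hφ⟩ := hchart _ hsN
    have hy := φ.map_source hφ
    have hUy : φ.symm (φ (γ s)) ∈ U := by rw [φ.left_inv hφ]; exact hγU s hs
    have h1 := (preservedOff_of_forall_isCrossingClass hF hK hKN hN isClosed_empty
      (fun x hx _ => hgood x hx) hy).self_of_nhds
      (by
        rw [notMem_compl_iff]
        exact ⟨hy, notMem_empty _⟩) _ (hL.isSectionAt hF.mem_atlas hU hy hUy)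
    have hsrc : ∀ᶠ u in 𝓝 s, γ u ∈ φ.source := hc.preimage_mem_nhds (φ.open_source.mem_nhds hφ)
    have h2 := h1.eventually_rel (γ := fun u => φ (γ u)) rfl (by
      filter_upwards [hsrc, Ioo_mem_nhds hs.1 hs.2] with u h1 h2
      rw [pushField, φ.left_inv h1]
      exact (hγ u h2).hasDerivAt hF.mem_atlas h1)
    filter_upwards [h2, hsrc] with u h3 h4
    rwa [classSetoid_iff, φ.left_inv h4, φ.left_inv hφ] at h3
  · have h1 : ∀ᶠ u in 𝓝 s, γ u ∈ U ∩ Nᶜ ∧ u ∈ Ioo a b :=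
      Filter.inter_mem (hc.preimage_mem_nhds
        ((hU.inter hN.isOpen_compl).mem_nhds ⟨hγU s hs, hsN⟩)) (Ioo_mem_nhds hs.1 hs.2)
    obtain ⟨ε, hε, hball⟩ := Metric.eventually_nhds_iff_ball.1 h1
    rw [Real.ball_eq_Ioo] at hball
    filter_upwards [Ioo_mem_nhds (show s - ε < s by linarith) (show s < s + ε by linarith)]
      with u hu
    refine orbitClass_eq_of_curve (hU.inter hN.isOpen_compl) inter_subset_right
      ⟨hL.1.mono inter_subset_left, fun x hx => hL.2 x hx.1⟩
      (fun v hv => ⟨hγ v (hball v hv).2, (hball v hv).1⟩) hu ⟨by linarith, by linarith⟩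

omit hF in
lemma orbitClass_eq_of_mem_orbit {m : ℕ} (hK : IsC1Subbundle m K)
    (hKN : ∀ p ∈ N, ¬ K p ≤ tangentTo N p) (hN : IsClosed N)
    (hchart : ∀ p ∈ N, ∃ (F : Submodule ℝ E) (φ : OpenPartialHomeomorph M E),
      IsAdaptedChart N F φ ∧ p ∈ φ.source)
    (hgood : ∀ x ∈ N, ∃ C, IsCrossingClass K N x C) {p q : M}
    (h : q ∈ orbit (IsSectionOn K) univ p) : orbitClass K N p = orbitClass K N q := by
  induction h with
  | refl => rfl
  | tail _ hstep ih => exact ih.trans (orbitClass_eq_of_flowStep hK hKN hN hchart hgood hstep)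

omit hF in
/-- If no orbit of the sections of `K` that are tangent to `N` at the exceptional points is
contained in `N`, then all points of `N` have a crossing class. -/
lemma forall_exists_isCrossingClass {m : ℕ} (hK : IsC1Subbundle m K)
    (hKN : ∀ p ∈ N, ¬ K p ≤ tangentTo N p) (hN : IsClosed N)
    (hchart : ∀ p ∈ N, ∃ (F : Submodule ℝ E) (φ : OpenPartialHomeomorph M E),
      IsAdaptedChart N F φ ∧ p ∈ φ.source)
    (hΥ : ∀ p ∈ N, ¬ orbit (IsTangentSectionOn m K N) univ p ⊆ N) :
    ∀ x ∈ N, ∃ C, IsCrossingClass K N x C := by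
  set A := {x | x ∈ N ∧ ¬ ∃ C, IsCrossingClass K N x C} with hA
  set B := closure A with hBdef
  have hB : IsClosed B := isClosed_closure
  have hAB : A ⊆ B := subset_closure
  have hBN : B ⊆ N := hN.closure_subset_iff.2 fun x hx => hx.1
  have hgood : ∀ x ∈ N, x ∉ B → ∃ C, IsCrossingClass K N x C := fun x hx hxB => by
    by_contra h
    exact hxB (hAB ⟨hx, h⟩)
  -- a point of `B` is a limit of points without a crossing class
  have hlim : ∀ x ∈ B, ¬ ∀ᶠ x' in 𝓝 x, x' ∈ B → ∃ C, IsCrossingClass K N x' C := by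
    intro x hx h
    obtain ⟨x', h1, h2⟩ := ((mem_closure_iff_frequently.1 hx).and_eventually h).exists
    exact h1.2 (h2 (hAB h1))
  have hBexc : B ⊆ excSet m K N := by
    intro x hx
    by_contra hexc
    obtain ⟨F, φ, hF, hφ⟩ := hchart x (hBN hx)
    have hy := φ.map_source hφ
    refine hlim x hx (eventually_of_chart hφ ?_)
    filter_upwards [eventually_exists_crossesTo_of_notMem_excSet hF hK hKN hN hy
      ((hF.mem_iff x hφ).1 (hBN hx)) (by rwa [φ.left_inv hφ]), φ.open_target.mem_nhds hy]
      with y h1 h2 h3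
    have hyF := (hF.symm_mem_iff h2).1 (hBN h3)
    obtain ⟨c, hc⟩ := h1 hyF
    exact exists_isCrossingClass hF h2 hyF hc
  suffices hempty : ∀ x, x ∉ B from fun x hx => hgood x hx (hempty x)
  intro p₀ hp₀
  -- a step of the orbit of `p₀` that leaves `B`
  obtain ⟨p, hp, q, hq, hstep⟩ : ∃ p ∈ B, ∃ q ∉ B,
      FlowStep (IsTangentSectionOn m K N) univ p q := by
    by_contra! hcon
    refine hΥ p₀ (hBN hp₀) fun q hq => hBN ?_
    induction hq with
    | refl => exact hp₀
    | tail _ hstep ih =>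
      by_contra h
      exact hcon _ ih _ h hstep
  obtain ⟨U, L, hU, -, hL, γ, a, b, t, h0, ht, hγ, hγU, rfl, rfl⟩ := hstep
  rw [isMIntegralCurveOn_iff_hasVelocityAt] at hγ
  obtain ⟨t', ht', ht'B, hexit⟩ : ∃ t' ∈ Ioo a b, γ t' ∈ B ∧ ∃ᶠ s in 𝓝 t', γ s ∉ B := by
    by_contra! hcon
    have h1 := rel_of_eventually_rel (r := Setoid.ker (· ∈ B)) (γ := γ) (J := Ioo a b)
      isPreconnected_Ioo (fun s hs => ?_) h0 ht
    · have h2 : (γ 0 ∈ B) = (γ t ∈ B) := h1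
      exact hq (h2 ▸ hp)
    · change ∀ᶠ u in 𝓝 s, (γ u ∈ B) = (γ s ∈ B)
      by_cases hsB : γ s ∈ B
      · filter_upwards [hcon s hs hsB] with u hu
        simp [hu, hsB]
      · filter_upwards [(hγ s hs).continuousAt.preimage_mem_nhds (hB.isOpen_compl.mem_nhds hsB)]
          with u hu
        have hu' : γ u ∉ B := hu
        simp [hu', hsB]
  obtain ⟨F, φ, hF, hφ⟩ := hchart _ (hBN ht'B)
  have hy := φ.map_source hφ
  have hyF : φ (γ t') ∈ F := (hF.mem_iff _ hφ).1 (hBN ht'B)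
  have hUy : φ.symm (φ (γ t')) ∈ U := by rw [φ.left_inv hφ]; exact hγU t' ht'
  set B' := (φ.target ∩ φ.symm ⁻¹' Bᶜ)ᶜ with hB'
  have hB'iff : ∀ y ∈ φ.target, y ∈ B' ↔ φ.symm y ∈ B := fun y hy => by
    simp [hB', hy]
  have hB'closed : IsClosed B' :=
    (φ.symm.isOpen_inter_preimage hB.isOpen_compl).isClosed_compl
  obtain ⟨X, hX, hXF⟩ := exists_transverse_section hF hK hKN hy hyF
  refine hlim _ ht'B (eventually_of_chart hφ ?_)
  have htr : Tendsto (fun s : ℝ => s + t') (𝓝 0) (𝓝 t') := by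
    have : Continuous (fun s : ℝ => s + t') := by fun_prop
    simpa using this.tendsto 0
  have hsrc : ∀ᶠ s in 𝓝 t', γ s ∈ φ.source :=
    (hγ t' ht').continuousAt.preimage_mem_nhds (φ.open_source.mem_nhds hφ)
  have key := eventually_exists_crossesTo_of_exit (F := F) (B := B') (z := φ (γ t'))
    (Y := pushField φ L) (γ := fun s => φ (γ (s + t'))) hB'closed
    (by
      filter_upwards [φ.open_target.mem_nhds hy] with y h1 h2
      exact (hF.symm_mem_iff h1).1 (hBN ((hB'iff y h1).1 h2)))
    (preservedOff_of_forall_isCrossingClass hF hK hKN hN hB hgood hy) hX hXF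
    (hL.1.isSectionAt hF.mem_atlas hU hy hUy)
    (by
      filter_upwards [φ.open_target.mem_nhds hy, eventually_chart hy (hU.mem_nhds hUy)]
        with y h1 h2 h3
      have h4 := (hB'iff y h1).1 h3
      rw [← hF.pushDistr_tangentTo h1 ((hF.symm_mem_iff h1).1 (hBN h4))]
      exact pushField_mem hF.mem_atlas h1 (hL.2 _ ⟨hBexc h4, h2⟩))
    (by simp)
    (by
      filter_upwards [htr.eventually hsrc, htr.eventually (Ioo_mem_nhds ht'.1 ht'.2)] with s h1 h2
      rw [pushField, φ.left_inv h1]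
      exact ((hγ _ h2).hasDerivAt hF.mem_atlas h1).comp_add_const s t')
    ((hB'iff _ hy).2 (by rwa [φ.left_inv hφ]))
    (by
      have htr2 : Tendsto (fun s : ℝ => s - t') (𝓝 t') (𝓝 0) := by
        have : Continuous (fun s : ℝ => s - t') := by fun_prop
        simpa using this.tendsto t'
      refine htr2.frequently ((hexit.and_eventually hsrc).mono ?_)
      rintro s ⟨h1, h2⟩
      rw [sub_add_cancel, hB'iff _ (φ.map_source h2), φ.left_inv h2]
      exact h1)
  filter_upwards [key, φ.open_target.mem_nhds hy] with y h1 h2 h3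
  obtain ⟨c, hc⟩ := h1 ((hB'iff y h2).2 h3)
  exact exists_isCrossingClass hF h2 ((hF.symm_mem_iff h2).1 (hBN h3)) hc

end Classes

end OrbitDecomposition

theorem theorem6
    {E : Type*} [NormedAddCommGroup E] [NormedSpace ℝ E] [FiniteDimensional ℝ E]
    {M : Type*} [TopologicalSpace M] [T2Space M] [SecondCountableTopology M]
    [ChartedSpace E M] [IsManifold 𝓘(ℝ, E) 2 M]
    (m : ℕ) (hm : 2 ≤ m)
    (K : (x : M) → Submodule ℝ (TangentSpace 𝓘(ℝ, E) x))
    (hK : OrbitDecomposition.IsC1Subbundle m K)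
    (N : Set M) (hNclosed : IsClosed N)
    (k : ℕ) (hN : OrbitDecomposition.IsC2Submanifold (E := E) k N)
    (hcodim : k + 2 ≤ Module.finrank ℝ E)
    (hKN : ∀ p ∈ N, ¬ K p ≤ OrbitDecomposition.tangentTo N p)
    (hΥ : ∀ p ∈ N, ¬ OrbitDecomposition.orbit
      (OrbitDecomposition.IsTangentSectionOn m K N) Set.univ p ⊆ N) :
    ∀ p ∈ Nᶜ, ∃ q : M,
      OrbitDecomposition.orbit (OrbitDecomposition.IsSectionOn K) Nᶜ p =
        OrbitDecomposition.orbit (OrbitDecomposition.IsSectionOn K) Set.univ q \ N := by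
  intro p hp
  have hchart : ∀ p ∈ N, ∃ (F : Submodule ℝ E) (φ : OpenPartialHomeomorph M E),
      OrbitDecomposition.IsAdaptedChart N F φ ∧ p ∈ φ.source := fun p hp => by
    obtain ⟨φ, hφ, hpφ, F, -, hF⟩ := hN p hp
    exact ⟨F, φ, ⟨hφ, hF⟩, hpφ⟩
  have hgood := OrbitDecomposition.forall_exists_isCrossingClass hK hKN hNclosed hchart hΥ
  refine ⟨p, Set.Subset.antisymm (fun q hq => ⟨?_, OrbitDecomposition.orbit_subset hp hq⟩) ?_⟩
  · exact OrbitDecomposition.orbit_mono (Set.subset_univ _) hq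
  · rintro q ⟨hq, hqN⟩
    have hclass := OrbitDecomposition.orbitClass_eq_of_mem_orbit hK hKN hNclosed hchart hgood hq
    rw [OrbitDecomposition.orbitClass_of_notMem hp,
      OrbitDecomposition.orbitClass_of_notMem hqN] at hclass
    rw [hclass]
    exact OrbitDecomposition.mem_orbit_self q
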